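/- Let $B\subseteq\mathbb C$ be a nonempty open set, let $r$ be a holomorphic function without zeros on $B$, let $\sqrt{r}$ and $\sqrt{-r}$ be holomorphic functions on $B$ with squares $r$ and $-r$, and let $c_1,c_2\in\mathbb C$ with $c_2\neq 0$. Write $i=\sqrt{-1}$, and consider the Hamiltonian system on $\mathbb C^2\times B\ni(x,y,t)$ $$\frac{dx}{dt}=\frac{\partial H}{\partial y},\qquad \frac{dy}{dt}=-\frac{\partial H}{\partial x},\qquad H=\frac{x^2y^2}{2}+\Bigl(i c_1+\frac{r'(t)}{2r(t)}\Bigr)xy+\sqrt{-r(t)}\,y-\frac{c_2e^{c_1t}}{\sqrt{r(t)}}\,x ,$$ and the coordinate changes 0) $x_0=x,\quad y_0=y$, 1) $x_1=x+\dfrac{2(1+i)c_1}{y}-\dfrac{2c_2e^{c_1t}}{\sqrt{r(t)}\,y^2},\quad y_1=y\qquad (y\neq0)$, 2) $x_2=x,\quad y_2=y+\dfrac{2ic_1}{x}+\dfrac{2\sqrt{-r(t)}}{x^2}\qquad (x\neq0)$. Then the following holds. (a) The coordinate changes are birational and symplectic in $(x,y)$ for each $t\in B$: on the indicated domains ($\mathbb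 C^2$, $\{y\ne0\}$, $\{x\neq 0\}$) they are bijections onto $\mathbb C^2$, $\{y_1\neq 0\}$, $\{x_2\ne0\}$, the inverses being given by the formulas solved for $x,y$, with $dx_k\wedge dy_k=dx\wedge dy$; they and their inverses are holomorphic in all variables including $t$. For $k=0,1,2$ the system becomes, in the coordinates $(x_k,y_k)$, a Hamiltonian system whose Hamiltonian is a polynomial in $x_k,y_k$ with coefficients holomorphic in $t\in B$. (b) Let $\mathcal X\to B$ be the space glued from three copies $\mathbb C^2\times B\ni(x_k,y_k,t)$, $k=0,1,2$, by identifying the points that correspond to the same $(x,y,t)$ under these coordinate changes. Then $\mathcal X$ is a Hausdorff complex manifold of dimension three in which the three copies are open coordinate patches (hence, by (a), the system is holomorphic everywhere on $\mathcal X$). (c) For each $t\in B$ the fibre $\mathcal X_t$ is biholomorphic, by a map that is the identity on the patch $\mathbb C^2\ni (x,y)$, to $S_t\setminus\bigcup_{j=0}^{7}D_j$, where $S_t$ is a rational surface of type $D_7^{(1)}$ with boundary curves $D_0,\dots,D_7$: the $D_j$ are smooth rational curves with $D_j^2=-2$, two of them meet transversally in exactly one point if they are joined in the affine Dynkin diagram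 $D_7^{(1)}$ and are disjoint otherwise, and $\sum_j m_jD_j$ is an anticanonical divisor, namely the pole divisor of the extension of $dx\wedge dy$ to $S_t$ (which has no zeros), where $m_j$ are the marks of the diagram ($1$ at the four end nodes, $2$ at the four inner nodes). The surface $S_t$ is obtained from $\mathbb P^2\supset\mathbb C^2\ni(x,y)$, $(x,y)\mapsto[1:x:y]$, by the following blow-ups and blow-downs, which do not affect $\mathbb C^2$. Let $\gamma_1$ be the curve $\{x_1=0\}$ with parameter $y_1=s$, and $\gamma_2$ the curve $\{y_2=0\}$ with parameter $x_2=s$; the end point of such a curve on a surface is its limit for $s\to0$. Blow up the end points $[0:1:0]$ of $\gamma_1$ and $[0:0:1]$ of $\gamma_2$; blow down (contract) the strict transform of the line at infinity, to the end point of the curve $(x,y)=(1/s,1/s)$; then blow up four times in succession the end point of $\gamma_1$, and four times in succession the end point of $\gamma_2$. -/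

import Mathlib

open Set Filter Topology
open scoped Manifold ContDiff LinearAlgebra.Projectivization

noncomputable section

namespace Ince

/-! ### Complex surfaces, holomorphic coordinates, blow-ups -/

/-- The holomorphic coordinate systems of a complex surface `S` (its maximal holomorphic atlas). -/
abbrev Coord (S : Type) [TopologicalSpace S] [ChartedSpace (ℂ × ℂ) S] :
    Set (OpenPartialHomeomorph S (ℂ × ℂ)) :=
  IsManifold.maximalAtlas 𝓘(ℂ, ℂ × ℂ) ω S

/-- `f : ℂ² → S` is a biholomorphic map of `ℂ²` onto an open subset of the complex surface `S`. -/
def IsAffinePatch {S : Type} [TopologicalSpace S] [ChartedSpace (ℂ × ℂ) S]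
    (f : ℂ × ℂ → S) : Prop :=
  ∃ e ∈ Coord S, e.target = univ ∧ ∀ z, e.symm z = f z

/-- A Hausdorff complex surface with a distinguished affine patch `ℂ² → S`. -/
structure MarkedSurface where
  carrier : Type
  [top : TopologicalSpace carrier]
  [t2 : T2Space carrier]
  [charted : ChartedSpace (ℂ × ℂ) carrier]
  [mfd : IsManifold 𝓘(ℂ, ℂ × ℂ) ω carrier]
  /-- the distinguished patch -/
  patch : ℂ × ℂ → carrier
  isPatch : IsAffinePatch patch

instance : CoeSort MarkedSurface Type := ⟨MarkedSurface.carrier⟩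

attribute [instance] MarkedSurface.top MarkedSurface.t2 MarkedSurface.charted MarkedSurface.mfd

/-- The three standard affine patches of `ℙ²`:
`(x, y) ↦ [1 : x : y]`, `(X₁, Y₁) ↦ [X₁ : 1 : Y₁]`, `(X₂, Y₂) ↦ [Y₂ : X₂ : 1]`. -/
def affine : Fin 3 → ℂ × ℂ → ℙ ℂ (Fin 3 → ℂ)
  | 0, z => .mk ℂ ![1, z.1, z.2] fun h => by simpa using congrFun h 0
  | 1, z => .mk ℂ ![z.1, 1, z.2] fun h => by simpa using congrFun h 1
  | 2, z => .mk ℂ ![z.2, z.1, 1] fun h => by simpa using congrFun h 2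

/-- `M` is the complex projective plane, with distinguished patch `(x, y) ↦ [1 : x : y]`. The
requirement on the three affine patches determines the topology and the complex structure. -/
def IsProjectivePlane (M : MarkedSurface) : Prop :=
  ∃ θ : M ≃ ℙ ℂ (Fin 3 → ℂ),
    (∀ k, IsAffinePatch fun z => θ.symm (affine k z)) ∧ ∀ z, θ (M.patch z) = affine 0 z

/-- `M'` is the blow-up of `M` at the point `p`, by a map `π` that respects the distinguished
patches: `π` is holomorphic, it is biholomorphic over `M ∖ {p}`, and over the domain of a
coordinate system `e` of `M` centred at `p` it is the standard blow-up
`{(z, ℓ) ∈ e.target × ℙ¹ | z ∈ ℓ} → e.target` of the origin, written in the two standard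
coordinate systems `(u, v) ↦ ((u, u v), [1 : v])` and `(u, v) ↦ ((u v, v), [u : 1])`. -/
def IsBlowUp (M' M : MarkedSurface) (p : M) : Prop :=
  ∃ π : M' → M,
    ContMDiff 𝓘(ℂ, ℂ × ℂ) 𝓘(ℂ, ℂ × ℂ) ω π ∧
    (∀ z, π (M'.patch z) = M.patch z) ∧
    (∃ τ : M → M', ContMDiffOn 𝓘(ℂ, ℂ × ℂ) 𝓘(ℂ, ℂ × ℂ) ω τ {p}ᶜ ∧
      (∀ q, q ≠ p → π (τ q) = q) ∧ ∀ q', π q' ≠ p → τ (π q') = q') ∧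
    ∃ e ∈ Coord M, p ∈ e.source ∧ e p = 0 ∧
      ∃ e₁ ∈ Coord M', ∃ e₂ ∈ Coord M',
        e₁.source ∪ e₂.source = π ⁻¹' e.source ∧
        e₁.target = {w | (w.1, w.1 * w.2) ∈ e.target} ∧
        e₂.target = {w | (w.1 * w.2, w.2) ∈ e.target} ∧
        (∀ q ∈ e₁.source, e (π q) = ((e₁ q).1, (e₁ q).1 * (e₁ q).2)) ∧
        (∀ q ∈ e₂.source, e (π q) = ((e₂ q).1 * (e₂ q).2, (e₂ q).2)) ∧
        (∀ q ∈ e₁.source, q ∈ e₂.source ↔ (e₁ q).2 ≠ 0) ∧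
        (∀ q ∈ e₂.source, q ∈ e₁.source ↔ (e₂ q).1 ≠ 0) ∧
        ∀ q ∈ e₁.source ∩ e₂.source, (e₁ q).2 * (e₂ q).1 = 1

/-- A single modification of a marked surface: a blow-up or a blow-down. The curve
`γ(s) = (x(s), y(s))` in the distinguished patch names the point that is blown up (for a
blow-down: the point to which a curve is contracted), as the limit of `γ(s)` for `s → 0`. -/
inductive Modification where
  | blowUp (γ : ℂ → ℂ × ℂ)
  | blowDown (γ : ℂ → ℂ × ℂ)

/-- `N` is the blow-up of `M` at the point `lim_{s → 0} γ(s)` of `M`. -/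
def IsBlowUpAlong (γ : ℂ → ℂ × ℂ) (N M : MarkedSurface) : Prop :=
  ∃ p : M, Tendsto (fun s => M.patch (γ s)) (𝓝[≠] 0) (𝓝 p) ∧ IsBlowUp N M p

/-- The modification leads from `M` to `N`. -/
def Modification.Leads : Modification → MarkedSurface → MarkedSurface → Prop
  | .blowUp γ, M, N => IsBlowUpAlong γ N M
  | .blowDown γ, M, N => IsBlowUpAlong γ M N

/-- `N` arises from `M` by the listed modifications, performed in the order of the list. -/
def Arises : List Modification → MarkedSurface → MarkedSurface → Prop
  | [], M, N => M = N
  | s :: l, M, N => ∃ M', s.Leads M M' ∧ Arises l M' N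

/-! ### Curves, anticanonical divisors, type `D₇⁽¹⁾` -/

/-- `C` is a smooth rational curve with self-intersection number `n` in the complex surface `S`,
i.e. `C ≅ ℙ¹` with normal bundle `𝒪(n)`: near `C`, coordinates `(ζ, z)` on a
neighbourhood of `C ∖ {∞} ≅ ℂ` and `(ζ', z')` near `∞` are given in which `C` is `z = 0`, resp.
`z' = 0`, and on `C` one has `ζ' = 1 / ζ` and `∂z'/∂z = ζ⁻ⁿ`. -/
def IsRationalCurve {S : Type} [TopologicalSpace S] [ChartedSpace (ℂ × ℂ) S]
    (C : Set S) (n : ℤ) : Prop :=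
  ∃ e₀ ∈ Coord S, ∃ e₁ ∈ Coord S,
    (∀ ζ : ℂ, (ζ, (0 : ℂ)) ∈ e₀.target) ∧ (0, 0) ∈ e₁.target ∧
    C ⊆ insert (e₁.symm (0, 0)) e₀.source ∧
    (∀ q ∈ e₀.source, q ∈ C ↔ (e₀ q).2 = 0) ∧
    (∀ q ∈ e₁.source, q ∈ C ↔ (e₁ q).2 = 0) ∧
    ∀ ζ : ℂ, e₀.symm (ζ, 0) ∈ e₁.source →
      (e₁ (e₀.symm (ζ, 0))).1 * ζ = 1 ∧
      HasDerivAt (fun s : ℂ => (e₁ (e₀.symm (ζ, s))).2) (ζ ^ (-n)) 0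

/-- The curves `C`, `C'` meet in exactly one point, and transversally there. -/
def MeetOnce {S : Type} [TopologicalSpace S] [ChartedSpace (ℂ × ℂ) S] (C C' : Set S) : Prop :=
  ∃ q, C ∩ C' = {q} ∧ ∃ e ∈ Coord S, q ∈ e.source ∧
    ∀ w ∈ e.source, (w ∈ C ↔ (e w).1 = 0) ∧ (w ∈ C' ↔ (e w).2 = 0)

/-- `∑ mᵢ Dᵢ` (with smooth curves `Dᵢ`) is the pole divisor of the meromorphic two-form on `M` that
extends `dx ∧ dy` from the (dense) distinguished patch, and this form has no zeros. In local
coordinates `(z₁, z₂) = e` and with local equations `fᵢ` of `Dᵢ` this says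
`dx ∧ dy = h / ∏ fᵢ ^ mᵢ · dz₁ ∧ dz₂`, with `h` holomorphic without zeros. -/
def IsAnticanonical (M : MarkedSurface) {ι : Type} [Fintype ι] (D : ι → Set M) (m : ι → ℕ) :
    Prop :=
  DenseRange M.patch ∧
  ∀ q : M, ∃ e ∈ Coord M, q ∈ e.source ∧ ∃ (h : ℂ × ℂ → ℂ) (f : ι → ℂ × ℂ → ℂ),
    DifferentiableOn ℂ h e.target ∧ (∀ z ∈ e.target, h z ≠ 0) ∧
    (∀ i, DifferentiableOn ℂ (f i) e.target ∧ ∀ z ∈ e.target,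
      (f i z = 0 ↔ e.symm z ∈ D i) ∧ (f i z = 0 → fderiv ℂ (f i) z ≠ 0)) ∧
    ∀ w : ℂ × ℂ, M.patch w ∈ e.source →
      (fderiv ℂ (fun w' => e (M.patch w')) w).det * h (e (M.patch w)) =
        ∏ i, f i (e (M.patch w)) ^ m i

/-- The Dynkin diagram `D₇⁽¹⁾`: the path `2 - 3 - 4 - 5`, with two further nodes `0, 1` joined
to `2` and two further nodes `6, 7` joined to `5`. -/
def affineD7 : SimpleGraph (Fin 8) :=
  SimpleGraph.fromEdgeSet {s(0, 2), s(1, 2), s(2, 3), s(3, 4), s(4, 5), s(5, 6), s(5, 7)}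

/-- The marks of the nodes of `D₇⁽¹⁾`. -/
def marksD7 : Fin 8 → ℕ := ![1, 1, 2, 2, 2, 2, 1, 1]

/-- `M` is of type `D₇⁽¹⁾` with boundary curves `D₀, …, D₇`: these are smooth rational curves with
self-intersection `-2`, meeting according to the Dynkin diagram `D₇⁽¹⁾`, and `∑ mᵢ Dᵢ`,
with the marks `mᵢ` of the diagram, is an anticanonical divisor. -/
def IsTypeD7 (M : MarkedSurface) (D : Fin 8 → Set M) : Prop :=
  (∀ i, IsRationalCurve (D i) (-2)) ∧
  (∀ i j, affineD7.Adj i j → MeetOnce (D i) (D j)) ∧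
  (∀ i j, i ≠ j → ¬ affineD7.Adj i j → Disjoint (D i) (D j)) ∧
  IsAnticanonical M D marksD7

/-! ### The Hamiltonian system -/

/-- The data of the system: the constants `c₁, c₂`, the function `r`, and functions in the roles
of `√r` and `√(-r)`. -/
structure Data where
  c₁ : ℂ
  c₂ : ℂ
  r : ℂ → ℂ
  sqrtR : ℂ → ℂ
  sqrtNegR : ℂ → ℂ

/-- Polynomials in two variables `x = X 0`, `y = X 1` with coefficients functions of `t`. -/
abbrev TPoly := MvPolynomial (Fin 2) (ℂ → ℂ)

/-- The value of such a polynomial at `t` and `(x, y) = z`. -/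
def TPoly.val (P : TPoly) (t : ℂ) (z : ℂ × ℂ) : ℂ :=
  MvPolynomial.eval₂ (Pi.evalRingHom (fun _ : ℂ => ℂ) t) ![z.1, z.2] P

/-- The right-hand side `(∂K/∂y, -∂K/∂x)` of the Hamiltonian system with Hamiltonian `K`. -/
def hamField (K : TPoly) (t : ℂ) (z : ℂ × ℂ) : ℂ × ℂ :=
  (TPoly.val (MvPolynomial.pderiv 1 K) t z, -TPoly.val (MvPolynomial.pderiv 0 K) t z)

namespace Data

variable (P : Data)

open MvPolynomial in
/-- The Hamiltonian
`H = x²y²/2 + (√(-1) c₁ + r'(t) / (2 r(t))) x y + √(-r(t)) y - (c₂ exp(c₁ t) / √r(t)) x`. -/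
def hamiltonian : TPoly :=
  C (fun _ => 1 / 2) * X 0 ^ 2 * X 1 ^ 2
    + C (fun t => Complex.I * P.c₁ + deriv P.r t / (2 * P.r t)) * X 0 * X 1
    + C P.sqrtNegR * X 1
    - C (fun t => P.c₂ * Complex.exp (P.c₁ * t) / P.sqrtR t) * X 0

/-- The coordinate changes `(x, y) ↦ (x_k, y_k)`. -/
def toChart : Fin 3 → ℂ → ℂ × ℂ → ℂ × ℂ
  | 0, _, z => z
  | 1, t, z => (z.1 + 2 * (1 + Complex.I) * P.c₁ / z.2
      - 2 * P.c₂ * Complex.exp (P.c₁ * t) / (P.sqrtR t * z.2 ^ 2), z.2)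
  | 2, t, z => (z.1, z.2 + 2 * Complex.I * P.c₁ / z.1 + 2 * P.sqrtNegR t / z.1 ^ 2)

/-- The inverse coordinate changes `(x_k, y_k) ↦ (x, y)`. -/
def ofChart : Fin 3 → ℂ → ℂ × ℂ → ℂ × ℂ
  | 0, _, z => z
  | 1, t, z => (z.1 - 2 * (1 + Complex.I) * P.c₁ / z.2
      + 2 * P.c₂ * Complex.exp (P.c₁ * t) / (P.sqrtR t * z.2 ^ 2), z.2)
  | 2, t, z => (z.1, z.2 - 2 * Complex.I * P.c₁ / z.1 - 2 * P.sqrtNegR t / z.1 ^ 2)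

end Data

/-- The domain of the `k`-th coordinate change (and of its inverse). -/
def dom : Fin 3 → Set (ℂ × ℂ)
  | 0 => univ
  | 1 => {z | z.2 ≠ 0}
  | 2 => {z | z.1 ≠ 0}

namespace Data

variable (P : Data) (B : Set ℂ)

/-- The identifications between the three copies of `ℂ² × B`: a point of the `k`-th copy is
identified with a point of the `l`-th copy if they have the same `t` and are the images of
the same point `(x, y)` under the `k`-th and the `l`-th coordinate change. -/
def Glue (a b : Fin 3 × ((ℂ × ℂ) × B)) : Prop :=
  a.2.2 = b.2.2 ∧ ∃ z ∈ dom a.1 ∩ dom b.1,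
    P.toChart a.1 a.2.2 z = a.2.1 ∧ P.toChart b.1 b.2.2 z = b.2.1

/-- Three copies of `ℂ² × B` glued along the coordinate changes. -/
def PhaseSpace : Type := Quot (P.Glue B)

/-- The quotient topology. -/
instance : TopologicalSpace (P.PhaseSpace B) :=
  inferInstanceAs (TopologicalSpace (Quot (P.Glue B)))

/-- The `k`-th copy of `ℂ² × B` in the glued space. -/
def incl (k : Fin 3) (p : (ℂ × ℂ) × B) : P.PhaseSpace B := Quot.mk _ (k, p)

/-- The projection to `B`. -/
def time : P.PhaseSpace B → B := Quot.lift (fun a => a.2.2) fun _ _ h => h.1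

/-- The fibre of the glued space over `t`. -/
def Fibre (t : B) : Type := {q : P.PhaseSpace B // P.time B q = t}

/-- The `k`-th copy of `ℂ²` in the fibre over `t`. -/
def fibreIncl (t : B) (k : Fin 3) (z : ℂ × ℂ) : P.Fibre B t := ⟨P.incl B k (z, t), rfl⟩

/-- The sequence of modifications of `ℙ²` for the parameter value `t`: with the curves
`γ₁ = {x₁ = 0}`, `γ₂ = {y₂ = 0}`, `δ = {x = y}`, blow up the end point (`s → 0`) of `γ₁` and of
`γ₂`, blow down (contracting a curve to the end point of `δ`), and then blow up four times the
end point of `γ₁` and four times the end point of `γ₂`. -/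
def modifications (t : ℂ) : List Modification :=
  let γ₁ : ℂ → ℂ × ℂ := fun s => P.ofChart 1 t (0, s)
  let γ₂ : ℂ → ℂ × ℂ := fun s => P.ofChart 2 t (s, 0)
  let δ : ℂ → ℂ × ℂ := fun s => (1 / s, 1 / s)
  [.blowUp γ₁, .blowUp γ₂, .blowDown δ,
    .blowUp γ₁, .blowUp γ₁, .blowUp γ₁, .blowUp γ₁,
    .blowUp γ₂, .blowUp γ₂, .blowUp γ₂, .blowUp γ₂]

end Data

end Ince

end

noncomputable section

namespace Ince

/-! ### Coordinate systems -/

section Coord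

variable {S : Type} [TopologicalSpace S] [ChartedSpace (ℂ × ℂ) S]
  [IsManifold 𝓘(ℂ, ℂ × ℂ) ω S]

/-! The charts. Put `h = c₂ exp(c₁ t) / √r`, `s = √(-r)`, `A = i c₁ + r' / (2 r)`, so that `H =
x²y²/2 + A x y + s y - h x` with `h'/h = c₁ - r'/(2r)` and `s'/s = r'/(2r)`. Substituting `x₁ = x +
β/y - 2h/y²` turns the equation for `y` into one of the same shape, with `-h` for `h` and `A - β`
for `A`. In `dx₁/dt` the terms in `y⁻³` and `y⁻¹` cancel by themselves, and those in `y⁻²` cancel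
exactly if `β = 2 (A + h'/h) = 2 (1 + i) c₁`. In the same way `y₂ = y + β'/x + 2s/x²` requires `β' =
2 (A - s'/s) = 2 i c₁`, and `s` changes its sign (`Data.hasDerivAt_toChart`). Both changes are
shears, hence symplectic.

Gluing. The graph of the first change is `y² x₁ = y² x + β y - 2h`, `y₁ = y`. As `h ≠ 0`, this has
no solution with `y = 0`, so the graph is closed; likewise for the second change, as `s ≠ 0`. Hence
the gluing relation is closed, and since the quotient map is open, the glued space is Hausdorff
(`Data.isClosed_incl_eq`).

Compactification. The two blow-ups and the blow-down turn `ℙ²` into `ℙ¹ × ℙ¹`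
(`exists_planeToLineProduct`), where the end points of the curves are `(∞, 0)` and `(0, ∞)`.
Consider the first; the second is the same with `x`, `y` exchanged. With `α = 2h` the curve `x₁ = 0`
is `x⁻¹ = y²/(α - β y) = y²/α + β y³/α² + O(y⁴)`. In the coordinate `X = x⁻¹ - y²/α - β y³/α²` it
becomes `X = O(y⁴)`, so the four centres are simply the origins of `(X / yⁿ, y)` for `n = 0, 1, 2,
3` (`exists_tower`).

Let `E₀, …, E₃` be the exceptional curves and `L` the line `x = ∞`, that is, `X + y²/α + β y³/α² =
0`. This touches `X = 0` to order exactly two, so `L` passes through the first two centres only, and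
its self-intersection drops from `0` to `-2`. Each of `E₀, E₁, E₂` contains exactly one later centre
and becomes a `-2`-curve. They form the chain `E₀ - E₁ - E₂`, and `L` is attached to `E₁`. The two
lines meet at `(∞, ∞)`, which completes the diagram `D₇⁽¹⁾`. On `ℙ¹ × ℙ¹` the form `dx ∧ dy` has
double poles along the two lines; an exceptional curve gets the sum of the orders of the curves
through its centre, minus one. This gives `1, 2, 1, 0` on `E₀, …, E₃`, the marks of the diagram,
with no pole on `E₃` (`IsSide.isAnticanonicalAt`, `IsTwoSided.isTypeD7`).

The complement of the boundary is `ℂ²` together with `E₃` without its point on `E₂`, for both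
towers. On that affine line `y = 0` and `x₁` is an affine function of `X / y⁴`, so `(x₁, y)` is a
coordinate system with values in all of `ℂ²` (`IsSide.exists_patch`). The affine lines are thus the
sets `y₁ = 0` and `x₂ = 0` added in the glued space.

Surfaces are built from explicit charts (`exists_surface`, `exists_isStdBlowUp`). Maps between them
are given chart by chart and fit together because they agree on the dense patch `ℂ²`
(`exists_extension`). -/

theorem mem_coord_iff {e : OpenPartialHomeomorph S (ℂ × ℂ)} :
    e ∈ Coord S ↔ ContMDiffOn 𝓘(ℂ, ℂ × ℂ) 𝓘(ℂ, ℂ × ℂ) ω e e.source ∧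
      ContMDiffOn 𝓘(ℂ, ℂ × ℂ) 𝓘(ℂ, ℂ × ℂ) ω e.symm e.target :=
  IsManifold.mem_maximalAtlas_iff_contMDiffOn e

/-- A coordinate system with values in all of `ℂ²` followed by a biholomorphic map between open
subsets of `ℂ²`. -/
theorem exists_coord_comp {e : OpenPartialHomeomorph S (ℂ × ℂ)} (he : e ∈ Coord S)
    (hu : e.target = univ) {f g : ℂ × ℂ → ℂ × ℂ} {s t : Set (ℂ × ℂ)}
    (hs : IsOpen s) (ht : IsOpen t) (hf : MapsTo f s t) (hg : MapsTo g t s)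
    (hl : LeftInvOn g f s) (hr : LeftInvOn f g t)
    (cf : ContDiffOn ℂ ω f s) (cg : ContDiffOn ℂ ω g t) :
    ∃ e' ∈ Coord S, (∀ q, q ∈ e'.source ↔ q ∈ e.source ∧ e q ∈ s) ∧ e'.target = t ∧
      (∀ q, e' q = f (e q)) ∧ ∀ z, e'.symm z = e.symm (g z) := by
  let h : OpenPartialHomeomorph (ℂ × ℂ) (ℂ × ℂ) :=
    { toFun := f
      invFun := g
      source := s
      target := t
      map_source' := hf
      map_target' := hg
      left_inv' := hl
      right_inv' := hr
      open_source := hs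
      open_target := ht
      continuousOn_toFun := cf.continuousOn
      continuousOn_invFun := cg.continuousOn }
  have hsrc : ∀ q, q ∈ (e.trans h).source ↔ q ∈ e.source ∧ e q ∈ s := fun q => by
    rw [OpenPartialHomeomorph.trans_source]; rfl
  have htgt : (e.trans h).target = t := by
    rw [OpenPartialHomeomorph.trans_target, hu, preimage_univ, inter_univ]
  refine ⟨e.trans h, mem_coord_iff.2 ⟨?_, ?_⟩, hsrc, htgt, fun _ => rfl, fun _ => rfl⟩
  · exact (contMDiffOn_iff_contDiffOn.2 cf).comp ((mem_coord_iff.1 he).1.mono fun q hq =>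
      ((hsrc q).1 hq).1) fun q hq => ((hsrc q).1 hq).2
  · rw [htgt]
    exact (mem_coord_iff.1 he).2.comp (contMDiffOn_iff_contDiffOn.2 cg) fun z _ => by simp [hu]

/-- Two coordinate systems that agree on the intersection of their domains, and whose union is
injective, combine to one coordinate system. -/
theorem exists_coord_union {f₁ f₂ : OpenPartialHomeomorph S (ℂ × ℂ)} (h₁ : f₁ ∈ Coord S)
    (h₂ : f₂ ∈ Coord S) (heq : ∀ q ∈ f₁.source, q ∈ f₂.source → f₁ q = f₂ q)
    (hinj : ∀ z ∈ f₁.target, z ∈ f₂.target → f₂.symm z ∈ f₁.source) :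
    ∃ e ∈ Coord S, e.source = f₁.source ∪ f₂.source ∧ e.target = f₁.target ∪ f₂.target ∧
      (∀ q ∈ f₁.source, e q = f₁ q) ∧ (∀ q ∈ f₂.source, e q = f₂ q) ∧
      (∀ z ∈ f₁.target, e.symm z = f₁.symm z) ∧ ∀ z ∈ f₂.target, e.symm z = f₂.symm z := by
  classical
  let F : S → ℂ × ℂ := fun q => if q ∈ f₁.source then f₁ q else f₂ q
  let G : ℂ × ℂ → S := fun z => if z ∈ f₁.target then f₁.symm z else f₂.symm z
  have F1 : ∀ q ∈ f₁.source, F q = f₁ q := fun q hq => if_pos hq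
  have F2 : ∀ q ∈ f₂.source, F q = f₂ q := fun q hq => by
    by_cases h : q ∈ f₁.source
    · rw [F1 q h, heq q h hq]
    · exact if_neg h
  have G1 : ∀ z ∈ f₁.target, G z = f₁.symm z := fun q hq => if_pos hq
  have G2 : ∀ z ∈ f₂.target, G z = f₂.symm z := fun z hz => by
    by_cases h : z ∈ f₁.target
    · rw [G1 z h]
      -- The point `f₂.symm z` lies in both domains, where the two systems agree, so it also has the
      -- coordinates `z` in `f₁`.
      have h3 := hinj z h hz
      have h4 := heq _ h3 (f₂.map_target hz)
      rw [f₂.right_inv hz] at h4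
      rw [← f₁.left_inv h3, h4]
    · exact if_neg h
  have cF : ContMDiffOn 𝓘(ℂ, ℂ × ℂ) 𝓘(ℂ, ℂ × ℂ) ω F (f₁.source ∪ f₂.source) :=
    ((mem_coord_iff.1 h₁).1.congr F1).union_of_isOpen ((mem_coord_iff.1 h₂).1.congr F2)
      f₁.open_source f₂.open_source
  have cG : ContMDiffOn 𝓘(ℂ, ℂ × ℂ) 𝓘(ℂ, ℂ × ℂ) ω G (f₁.target ∪ f₂.target) :=
    ((mem_coord_iff.1 h₁).2.congr G1).union_of_isOpen ((mem_coord_iff.1 h₂).2.congr G2)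
      f₁.open_target f₂.open_target
  let e : OpenPartialHomeomorph S (ℂ × ℂ) :=
    { toFun := F
      invFun := G
      source := f₁.source ∪ f₂.source
      target := f₁.target ∪ f₂.target
      map_source' := by
        rintro q (hq | hq)
        · rw [F1 q hq]; exact Or.inl (f₁.map_source hq)
        · rw [F2 q hq]; exact Or.inr (f₂.map_source hq)
      map_target' := by
        rintro q (hq | hq)
        · rw [G1 q hq]; exact Or.inl (f₁.map_target hq)
        · rw [G2 q hq]; exact Or.inr (f₂.map_target hq)
      left_inv' := by
        rintro q (hq | hq)
        · rw [F1 q hq, G1 _ (f₁.map_source hq), f₁.left_inv hq]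
        · rw [F2 q hq, G2 _ (f₂.map_source hq), f₂.left_inv hq]
      right_inv' := by
        rintro q (hq | hq)
        · rw [G1 q hq, F1 _ (f₁.map_target hq), f₁.right_inv hq]
        · rw [G2 q hq, F2 _ (f₂.map_target hq), f₂.right_inv hq]
      open_source := f₁.open_source.union f₂.open_source
      open_target := f₁.open_target.union f₂.open_target
      continuousOn_toFun := cF.continuousOn
      continuousOn_invFun := cG.continuousOn }
  exact ⟨e, mem_coord_iff.2 ⟨cF, cG⟩, rfl, rfl, F1, F2, G1, G2⟩

theorem exists_coord_mem (q : S) : ∃ e ∈ Coord S, q ∈ e.source :=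
  ⟨chartAt (ℂ × ℂ) q, IsManifold.chart_mem_maximalAtlas q, mem_chart_source _ q⟩

end Coord

/-! ### Surfaces from coordinate changes -/

section Core

/-- A set with a covering family of injective partial charts in `ℂ²`, the coordinate changes being
holomorphic on open sets, is a complex surface. -/
theorem exists_surface {X ι : Type} (φ : ι → PartialEquiv X (ℂ × ℂ))
    (cov : ∀ x, ∃ i, x ∈ (φ i).source)
    (op : ∀ i j, IsOpen ((φ i).symm.trans (φ j)).source)
    (sm : ∀ i j, ContDiffOn ℂ ω ((φ i).symm.trans (φ j)) ((φ i).symm.trans (φ j)).source) :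
    ∃ (_ : TopologicalSpace X) (_ : ChartedSpace (ℂ × ℂ) X)
      (_ : IsManifold 𝓘(ℂ, ℂ × ℂ) ω X) (Φ : ι → OpenPartialHomeomorph X (ℂ × ℂ)),
      (∀ i, Φ i ∈ Coord X) ∧ ∀ i, (Φ i).toPartialEquiv = φ i := by
  choose c hc using cov
  let core : ChartedSpaceCore (ℂ × ℂ) X :=
    { atlas := range φ
      chartAt := fun x => φ (c x)
      mem_chart_source := hc
      chart_mem_atlas := fun x => mem_range_self _
      open_source := by
        rintro _ _ ⟨i, rfl⟩ ⟨j, rfl⟩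
        exact op i j
      continuousOn_toFun := by
        rintro _ _ ⟨i, rfl⟩ ⟨j, rfl⟩
        exact (sm i j).continuousOn }
  let t : TopologicalSpace X := core.toTopologicalSpace
  let cs : ChartedSpace (ℂ × ℂ) X := core.toChartedSpace
  let Φ : ι → OpenPartialHomeomorph X (ℂ × ℂ) := fun i =>
    core.openPartialHomeomorph (φ i) (mem_range_self i)
  have hat : atlas (ℂ × ℂ) X = range Φ := by
    ext e
    constructor
    · intro he
      obtain ⟨_, h⟩ := mem_iUnion.1 he
      obtain ⟨⟨i, rfl⟩, h⟩ := mem_iUnion.1 h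
      exact ⟨i, h.symm⟩
    · rintro ⟨i, rfl⟩
      exact mem_iUnion.2 ⟨φ i, mem_iUnion.2 ⟨mem_range_self i, rfl⟩⟩
  have m : IsManifold 𝓘(ℂ, ℂ × ℂ) ω X := by
    refine isManifold_of_contDiffOn _ _ _ fun e e' he he' => ?_
    rw [hat] at he he'
    obtain ⟨i, rfl⟩ := he
    obtain ⟨j, rfl⟩ := he'
    have h := sm i j
    simp only [mfld_simps] at h ⊢
    exact h
  refine ⟨t, cs, m, Φ, fun i => ?_, fun i => rfl⟩
  exact IsManifold.subset_maximalAtlas (by rw [hat]; exact mem_range_self i)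

end Core

section CoordChange

variable {S : Type} [TopologicalSpace S] [ChartedSpace (ℂ × ℂ) S]
  [IsManifold 𝓘(ℂ, ℂ × ℂ) ω S]

theorem contDiffOn_coord_change {d d' : OpenPartialHomeomorph S (ℂ × ℂ)} (hd : d ∈ Coord S)
    (hd' : d' ∈ Coord S) {s : Set (ℂ × ℂ)} (h₁ : s ⊆ d.target) (h₂ : MapsTo d.symm s d'.source) :
    ContDiffOn ℂ ω (fun z => d' (d.symm z)) s :=
  contMDiffOn_iff_contDiffOn.1 ((mem_coord_iff.1 hd').1.comp ((mem_coord_iff.1 hd).2.mono h₁) h₂)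

variable {T : Type} [TopologicalSpace T] [ChartedSpace (ℂ × ℂ) T]

/-- Holomorphy of a map is read off from its expression `g` in one coordinate system of the source.
The blow-down maps and their inverses are treated this way. -/
theorem contMDiffOn_of_comp_symm {f : S → T} {e : OpenPartialHomeomorph S (ℂ × ℂ)}
    (he : e ∈ Coord S) {g : ℂ × ℂ → T} {s : Set (ℂ × ℂ)}
    (hg : ContMDiffOn 𝓘(ℂ, ℂ × ℂ) 𝓘(ℂ, ℂ × ℂ) ω g s) {U : Set S} (hU : U ⊆ e.source)
    (hUs : MapsTo e U s) (hf : ∀ q ∈ U, f q = g (e q)) :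
    ContMDiffOn 𝓘(ℂ, ℂ × ℂ) 𝓘(ℂ, ℂ × ℂ) ω f U :=
  (hg.comp ((mem_coord_iff.1 he).1.mono hU) hUs).congr hf

end CoordChange

/-! ### Blow-ups -/

/-- `π : M' → M` is the blow-up of the origin of the coordinate system `c` with values in all of
`ℂ²`, and `e₁`, `e₂` are the two standard coordinate systems of the blow-up. -/
structure IsStdBlowUp (M' M : MarkedSurface) (c : OpenPartialHomeomorph M (ℂ × ℂ)) (π : M' → M)
    (e₁ e₂ : OpenPartialHomeomorph M' (ℂ × ℂ)) : Prop where
  c_mem : c ∈ Coord M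
  c_target : c.target = univ
  smooth : ContMDiff 𝓘(ℂ, ℂ × ℂ) 𝓘(ℂ, ℂ × ℂ) ω π
  patch : ∀ z, π (M'.patch z) = M.patch z
  sect : ∃ τ : M → M', ContMDiffOn 𝓘(ℂ, ℂ × ℂ) 𝓘(ℂ, ℂ × ℂ) ω τ {c.symm 0}ᶜ ∧
    (∀ q, q ≠ c.symm 0 → π (τ q) = q) ∧ ∀ q', π q' ≠ c.symm 0 → τ (π q') = q'
  mem₁ : e₁ ∈ Coord M'
  mem₂ : e₂ ∈ Coord M'
  source : ∀ q, q ∈ e₁.source ∨ q ∈ e₂.source ↔ π q ∈ c.source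
  target₁ : e₁.target = univ
  target₂ : e₂.target = univ
  eq₁ : ∀ q ∈ e₁.source, c (π q) = ((e₁ q).1, (e₁ q).1 * (e₁ q).2)
  eq₂ : ∀ q ∈ e₂.source, c (π q) = ((e₂ q).1 * (e₂ q).2, (e₂ q).2)
  overlap₁ : ∀ q ∈ e₁.source, q ∈ e₂.source ↔ (e₁ q).2 ≠ 0
  overlap₂ : ∀ q ∈ e₂.source, q ∈ e₁.source ↔ (e₂ q).1 ≠ 0
  mul_eq_one : ∀ q ∈ e₁.source ∩ e₂.source, (e₁ q).2 * (e₂ q).1 = 1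

theorem IsStdBlowUp.isBlowUp {M' M : MarkedSurface} {c : OpenPartialHomeomorph M (ℂ × ℂ)}
    {π : M' → M} {e₁ e₂ : OpenPartialHomeomorph M' (ℂ × ℂ)} (h : IsStdBlowUp M' M c π e₁ e₂) :
    IsBlowUp M' M (c.symm 0) :=
  ⟨π, h.smooth, h.patch, h.sect, c, h.c_mem, c.map_target (by simp [h.c_target]),
    c.right_inv (by simp [h.c_target]), e₁, h.mem₁, e₂, h.mem₂, ext h.source,
    by simp [h.target₁, h.c_target], by simp [h.target₂, h.c_target], h.eq₁, h.eq₂, h.overlap₁,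
    h.overlap₂, h.mul_eq_one⟩

/-! ### Construction of the blow-up of a point -/

section Existence

variable (M : MarkedSurface) (c : OpenPartialHomeomorph M (ℂ × ℂ))

/-- The points of the blow-up of `M` at the origin of `c`; on the exceptional curve, `some h` is the
direction `[1 : h]` and `none` is the direction `[0 : 1]`. -/
abbrev BlowUpSet : Type := {q : M // q ≠ c.symm 0} ⊕ Option ℂ

variable {M}

/-- The projection of the blow-up. -/
def blowDownMap : BlowUpSet M c → M
  | .inl q => q.1
  | .inr _ => c.symm 0

open Classical in
/-- The inverse of the projection away from the centre. -/
def blowUpSection (q : M) : BlowUpSet M c := if h : q ≠ c.symm 0 then .inl ⟨q, h⟩ else .inr none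

variable {c}

theorem blowUpSection_of_ne {q : M} (h : q ≠ c.symm 0) : blowUpSection c q = .inl ⟨q, h⟩ :=
  dif_pos h

theorem blowUpSection_inl (q : {q : M // q ≠ c.symm 0}) : blowUpSection c q.1 = .inl q :=
  dif_pos q.2

variable (c)

/-- The charts of the blow-up away from the exceptional curve. -/
def blowUpChartOff (d : OpenPartialHomeomorph M (ℂ × ℂ)) :
    PartialEquiv (BlowUpSet M c) (ℂ × ℂ) where
  toFun x := d (blowDownMap c x)
  invFun z := blowUpSection c (d.symm z)
  source := {x | (∃ q, x = .inl q) ∧ blowDownMap c x ∈ d.source}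
  target := {z | z ∈ d.target ∧ d.symm z ≠ c.symm 0}
  map_source' := by
    rintro _ ⟨⟨q, rfl⟩, hq⟩
    exact ⟨d.map_source hq, by rw [d.left_inv hq]; exact q.2⟩
  map_target' := by
    rintro z ⟨hz, hz'⟩
    rw [blowUpSection_of_ne hz']
    exact ⟨⟨_, rfl⟩, d.map_target hz⟩
  left_inv' := by
    rintro _ ⟨⟨q, rfl⟩, hq⟩
    rw [d.left_inv hq]
    exact blowUpSection_inl q
  right_inv' := by
    rintro z ⟨hz, hz'⟩
    rw [blowUpSection_of_ne hz']
    exact d.right_inv hz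

variable {c}

theorem symm_ne_symm_zero (hc : c.target = univ) {z : ℂ × ℂ} (hz : z ≠ 0) :
    c.symm z ≠ c.symm 0 := fun h => hz <| by
  rw [← c.right_inv (x := z) (by simp [hc]), h, c.right_inv (by simp [hc])]

theorem fst_ne {a b : ℂ} (h : a ≠ 0) : ((a, b) : ℂ × ℂ) ≠ 0 := fun h' => h (congrArg Prod.fst h')

theorem snd_ne {a b : ℂ} (h : b ≠ 0) : ((a, b) : ℂ × ℂ) ≠ 0 := fun h' => h (congrArg Prod.snd h')

open Classical in
/-- The chart `(u, v) ↦ ((u, u v), [1 : v])` of the blow-up. -/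
def blowUpChart₁ (hc : c.target = univ) : PartialEquiv (BlowUpSet M c) (ℂ × ℂ) where
  toFun
    | .inl q => ((c q.1).1, (c q.1).2 / (c q.1).1)
    | .inr (some h) => (0, h)
    | .inr none => 0
  invFun z := if z.1 = 0 then .inr (some z.2) else blowUpSection c (c.symm (z.1, z.1 * z.2))
  source
    | .inl q => q.1 ∈ c.source ∧ (c q.1).1 ≠ 0
    | .inr (some _) => True
    | .inr none => False
  target := univ
  map_source' _ _ := trivial
  map_target' z _ := by
    by_cases h : z.1 = 0
    · rw [if_pos h]; trivial
    · rw [if_neg h, blowUpSection_of_ne (symm_ne_symm_zero hc (fst_ne h))]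
      refine ⟨c.map_target (by simp [hc]), ?_⟩
      rw [c.right_inv (by simp [hc])]
      exact h
  left_inv' := by
    rintro (q | _ | h) hq
    · have h1 := hq.1
      have h2 := hq.2
      simp only [h2, if_false]
      rw [mul_div_cancel₀ _ h2, Prod.mk.eta, c.left_inv h1, blowUpSection_inl]
    · exact hq.elim
    · exact if_pos rfl
  right_inv' z _ := by
    by_cases h : z.1 = 0
    · rw [if_pos h, ← h]
    · rw [if_neg h, blowUpSection_of_ne (symm_ne_symm_zero hc (fst_ne h))]
      simp only
      rw [c.right_inv (by simp [hc]), mul_div_cancel_left₀ _ h]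

open Classical in
/-- The chart `(u, v) ↦ ((u v, v), [u : 1])` of the blow-up. -/
def blowUpChart₂ (hc : c.target = univ) : PartialEquiv (BlowUpSet M c) (ℂ × ℂ) where
  toFun
    | .inl q => ((c q.1).1 / (c q.1).2, (c q.1).2)
    | .inr (some h) => (h⁻¹, 0)
    | .inr none => 0
  invFun z := if z.2 = 0 then (if z.1 = 0 then .inr none else .inr (some z.1⁻¹))
    else blowUpSection c (c.symm (z.1 * z.2, z.2))
  source
    | .inl q => q.1 ∈ c.source ∧ (c q.1).2 ≠ 0
    | .inr (some h) => h ≠ 0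
    | .inr none => True
  target := univ
  map_source' _ _ := trivial
  map_target' z _ := by
    by_cases h : z.2 = 0
    · rw [if_pos h]
      by_cases h' : z.1 = 0
      · rw [if_pos h']; trivial
      · rw [if_neg h']; exact inv_ne_zero h'
    · rw [if_neg h, blowUpSection_of_ne (symm_ne_symm_zero hc (snd_ne h))]
      refine ⟨c.map_target (by simp [hc]), ?_⟩
      rw [c.right_inv (by simp [hc])]
      exact h
  left_inv' := by
    rintro (q | _ | h) hq
    · have h1 := hq.1
      have h2 := hq.2
      simp only [h2, if_false]
      rw [div_mul_cancel₀ _ h2, Prod.mk.eta, c.left_inv h1, blowUpSection_inl]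
    · simp
    · have : h ≠ 0 := hq
      simp [this]
  right_inv' z _ := by
    by_cases h : z.2 = 0
    · rw [if_pos h]
      by_cases h' : z.1 = 0
      · rw [if_pos h']; exact Prod.ext h'.symm h.symm
      · rw [if_neg h']; exact Prod.ext (inv_inv _) h.symm
    · rw [if_neg h, blowUpSection_of_ne (symm_ne_symm_zero hc (snd_ne h))]
      simp only
      rw [c.right_inv (by simp [hc]), mul_div_cancel_right₀ _ h]

/-- The charts of the blow-up. -/
def blowUpChart (hc : c.target = univ) : Coord M ⊕ Bool → PartialEquiv (BlowUpSet M c) (ℂ × ℂ)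
  | .inl d => blowUpChartOff c d.1
  | .inr false => blowUpChart₁ hc
  | .inr true => blowUpChart₂ hc

theorem contDiff_blow₁ : ContDiff ℂ ω fun z : ℂ × ℂ => (z.1, z.1 * z.2) := by fun_prop

theorem contDiff_blow₂ : ContDiff ℂ ω fun z : ℂ × ℂ => (z.1 * z.2, z.2) := by fun_prop

/-- Pairs involving a chart of `M` reduce to coordinate changes of `M`, composed with the blow-up
formulas or followed by a quotient of coordinates. The two charts along the exceptional curve are
related by `(u, v) ↦ (v⁻¹, u v)` and its inverse `(u, v) ↦ (u v, u⁻¹)`, which stay valid on the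
exceptional curve itself. -/
theorem blowUpChart_compat (hcm : c ∈ Coord M) (hc : c.target = univ) (i j : Coord M ⊕ Bool) :
    IsOpen ((blowUpChart hc i).symm.trans (blowUpChart hc j)).source ∧
    ContDiffOn ℂ ω ((blowUpChart hc i).symm.trans (blowUpChart hc j))
      ((blowUpChart hc i).symm.trans (blowUpChart hc j)).source := by
  -- It suffices to exhibit each coordinate change as an explicit formula `f` on an explicit open
  -- set `s`.
  have key : ∀ (i j : Coord M ⊕ Bool) (f : ℂ × ℂ → ℂ × ℂ) (s : Set (ℂ × ℂ)), IsOpen s →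
      ContDiffOn ℂ ω f s →
      (∀ z, z ∈ s ↔ z ∈ (blowUpChart hc i).target ∧
        (blowUpChart hc i).symm z ∈ (blowUpChart hc j).source) →
      (∀ z ∈ s, blowUpChart hc j ((blowUpChart hc i).symm z) = f z) →
      IsOpen ((blowUpChart hc i).symm.trans (blowUpChart hc j)).source ∧
      ContDiffOn ℂ ω ((blowUpChart hc i).symm.trans (blowUpChart hc j))
        ((blowUpChart hc i).symm.trans (blowUpChart hc j)).source := by
    intro i j f s hs hf h1 h2
    have : ((blowUpChart hc i).symm.trans (blowUpChart hc j)).source = s := by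
      ext z
      rw [h1, PartialEquiv.trans_source]
      rfl
    rw [this]
    exact ⟨hs, hf.congr h2⟩
  have open1 : ∀ (d d' : Coord M) {U : Set (ℂ × ℂ)}, IsOpen U →
      IsOpen (d.1.target ∩ d.1.symm ⁻¹' (d'.1.source ∩ d'.1 ⁻¹' U)) := fun d d' U hU =>
    d.1.symm.isOpen_inter_preimage (d'.1.isOpen_inter_preimage hU)
  have openp : ∀ (d : Coord M), IsOpen (d.1.target ∩ d.1.symm ⁻¹' {c.symm 0}ᶜ) := fun d =>
    d.1.symm.isOpen_inter_preimage isOpen_compl_singleton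
  have cu : ∀ z, z ∈ c.target := fun z => by simp [hc]
  rcases i with d | _ | _ <;> rcases j with d' | _ | _
  · refine key _ _ (fun z => d'.1 (d.1.symm z)) (d.1.target ∩ d.1.symm ⁻¹' d'.1.source ∩
      (d.1.target ∩ d.1.symm ⁻¹' {c.symm 0}ᶜ))
      ((d.1.symm.isOpen_inter_preimage d'.1.open_source).inter (openp d))
      (contDiffOn_coord_change d.2 d'.2 (fun z hz => hz.1.1) fun z hz => hz.1.2) (fun z => ?_)
      fun z hz => ?_
    · constructor
      · rintro ⟨⟨h1, h2⟩, -, h3⟩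
        refine ⟨⟨h1, h3⟩, ?_⟩
        change blowUpSection c _ ∈ _
        rw [blowUpSection_of_ne h3]
        exact ⟨⟨_, rfl⟩, h2⟩
      · rintro ⟨⟨h1, h3⟩, h2⟩
        change blowUpSection c _ ∈ _ at h2
        rw [blowUpSection_of_ne h3] at h2
        exact ⟨⟨h1, h2.2⟩, h1, h3⟩
    · change d'.1 (blowDownMap c (blowUpSection c _)) = _
      rw [blowUpSection_of_ne hz.2.2]
      rfl
  · refine key _ _ (fun z => ((c (d.1.symm z)).1, (c (d.1.symm z)).2 / (c (d.1.symm z)).1))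
      (d.1.target ∩ d.1.symm ⁻¹' (c.source ∩ c ⁻¹' {z | z.1 ≠ 0}) ∩
        (d.1.target ∩ d.1.symm ⁻¹' {c.symm 0}ᶜ))
      ((open1 d ⟨c, hcm⟩ (isOpen_ne.preimage continuous_fst)).inter (openp d)) ?_ (fun z => ?_)
      fun z hz => ?_
    · have h := contDiffOn_coord_change (s := d.1.target ∩ d.1.symm ⁻¹' (c.source ∩ c ⁻¹'
        {z | z.1 ≠ 0}) ∩ (d.1.target ∩ d.1.symm ⁻¹' {c.symm 0}ᶜ)) d.2 hcm (fun z hz => hz.1.1)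
        fun z hz => hz.1.2.1
      exact h.fst.prodMk (h.snd.div h.fst fun z hz => hz.1.2.2)
    · constructor
      · rintro ⟨⟨h1, h2⟩, -, h3⟩
        refine ⟨⟨h1, h3⟩, ?_⟩
        change blowUpSection c _ ∈ _
        rw [blowUpSection_of_ne h3]
        exact h2
      · rintro ⟨⟨h1, h3⟩, h2⟩
        change blowUpSection c _ ∈ _ at h2
        rw [blowUpSection_of_ne h3] at h2
        exact ⟨⟨h1, h2⟩, h1, h3⟩
    · change blowUpChart₁ hc (blowUpSection c _) = _
      rw [blowUpSection_of_ne hz.2.2]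
      rfl
  · refine key _ _ (fun z => ((c (d.1.symm z)).1 / (c (d.1.symm z)).2, (c (d.1.symm z)).2))
      (d.1.target ∩ d.1.symm ⁻¹' (c.source ∩ c ⁻¹' {z | z.2 ≠ 0}) ∩
        (d.1.target ∩ d.1.symm ⁻¹' {c.symm 0}ᶜ))
      ((open1 d ⟨c, hcm⟩ (isOpen_ne.preimage continuous_snd)).inter (openp d)) ?_ (fun z => ?_)
      fun z hz => ?_
    · have h := contDiffOn_coord_change (s := d.1.target ∩ d.1.symm ⁻¹' (c.source ∩ c ⁻¹'
        {z | z.2 ≠ 0}) ∩ (d.1.target ∩ d.1.symm ⁻¹' {c.symm 0}ᶜ)) d.2 hcm (fun z hz => hz.1.1)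
        fun z hz => hz.1.2.1
      exact (h.fst.div h.snd fun z hz => hz.1.2.2).prodMk h.snd
    · constructor
      · rintro ⟨⟨h1, h2⟩, -, h3⟩
        refine ⟨⟨h1, h3⟩, ?_⟩
        change blowUpSection c _ ∈ _
        rw [blowUpSection_of_ne h3]
        exact h2
      · rintro ⟨⟨h1, h3⟩, h2⟩
        change blowUpSection c _ ∈ _ at h2
        rw [blowUpSection_of_ne h3] at h2
        exact ⟨⟨h1, h2⟩, h1, h3⟩
    · change blowUpChart₂ hc (blowUpSection c _) = _
      rw [blowUpSection_of_ne hz.2.2]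
      rfl
  · have h1 : ∀ (z : ℂ × ℂ) (hz : z.1 ≠ 0), (blowUpChart hc (.inr false)).symm z =
        .inl ⟨c.symm (z.1, z.1 * z.2), symm_ne_symm_zero hc (fst_ne hz)⟩ := fun z hz =>
      (if_neg hz).trans (blowUpSection_of_ne _)
    refine key _ _ (fun z => d'.1 (c.symm (z.1, z.1 * z.2)))
      ({z | z.1 ≠ 0} ∩ (fun z : ℂ × ℂ => (z.1, z.1 * z.2)) ⁻¹' (c.target ∩ c.symm ⁻¹' d'.1.source))
      ((isOpen_ne.preimage continuous_fst).inter ((c.symm.isOpen_inter_preimage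
        d'.1.open_source).preimage contDiff_blow₁.continuous)) ?_ (fun z => ?_) fun z hz => ?_
    · exact (contDiffOn_coord_change (s := c.target ∩ c.symm ⁻¹' d'.1.source) hcm d'.2
        (fun z hz => hz.1) fun z hz => hz.2).comp contDiff_blow₁.contDiffOn fun z hz => hz.2
    · constructor
      · rintro ⟨h2, h3⟩
        refine ⟨trivial, ?_⟩
        rw [h1 z h2]
        exact ⟨⟨_, rfl⟩, h3.2⟩
      · rintro ⟨-, h2⟩
        by_cases hz : z.1 = 0
        · have h3 : (blowUpChart hc (.inr false)).symm z = .inr (some z.2) := if_pos hz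
          rw [h3] at h2
          obtain ⟨⟨q, h4⟩, -⟩ := h2
          cases h4
        · rw [h1 z hz] at h2
          exact ⟨hz, cu _, h2.2⟩
    · rw [h1 z hz.1]
      rfl
  · refine key _ _ (fun z => z) univ isOpen_univ contDiffOn_id (fun z => ?_) fun z hz => ?_
    · exact ⟨fun _ => ⟨trivial, (blowUpChart hc (.inr false)).map_target trivial⟩, fun _ => trivial⟩
    · exact (blowUpChart hc (.inr false)).right_inv trivial
  · refine key _ _ (fun z => (z.2⁻¹, z.1 * z.2)) {z | z.2 ≠ 0} (isOpen_ne.preimage continuous_snd)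
      ((contDiffOn_snd.inv fun z hz => hz).prodMk (contDiff_fst.mul contDiff_snd).contDiffOn)
      (fun z => ?_) fun z hz => ?_
    · by_cases hz : z.1 = 0
      · have h3 : (blowUpChart hc (.inr false)).symm z = .inr (some z.2) := if_pos hz
        rw [h3]
        exact ⟨fun h => ⟨trivial, h⟩, fun h => h.2⟩
      · have h3 : (blowUpChart hc (.inr false)).symm z = .inl ⟨c.symm (z.1, z.1 * z.2),
            symm_ne_symm_zero hc (fst_ne hz)⟩ := (if_neg hz).trans (blowUpSection_of_ne _)
        rw [h3]
        have h4 : c (c.symm (z.1, z.1 * z.2)) = _ := c.right_inv (cu _)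
        constructor
        · intro h
          refine ⟨trivial, c.map_target (cu _), ?_⟩
          rw [h4]
          exact mul_ne_zero hz h
        · rintro ⟨-, -, h⟩
          rw [h4] at h
          exact right_ne_zero_of_mul h
    · have hz' : z.2 ≠ 0 := hz
      by_cases hz : z.1 = 0
      · have h3 : (blowUpChart hc (.inr false)).symm z = .inr (some z.2) := if_pos hz
        rw [h3, hz, zero_mul]
        rfl
      · have h3 : (blowUpChart hc (.inr false)).symm z = .inl ⟨c.symm (z.1, z.1 * z.2),
            symm_ne_symm_zero hc (fst_ne hz)⟩ := (if_neg hz).trans (blowUpSection_of_ne _)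
        rw [h3]
        have h4 : c (c.symm (z.1, z.1 * z.2)) = _ := c.right_inv (cu _)
        change ((c (c.symm (z.1, z.1 * z.2))).1 / (c (c.symm (z.1, z.1 * z.2))).2,
          (c (c.symm (z.1, z.1 * z.2))).2) = _
        rw [h4]
        refine Prod.ext ?_ rfl
        simp only
        field_simp
  · have h1 : ∀ (z : ℂ × ℂ) (hz : z.2 ≠ 0), (blowUpChart hc (.inr true)).symm z =
        .inl ⟨c.symm (z.1 * z.2, z.2), symm_ne_symm_zero hc (snd_ne hz)⟩ := fun z hz =>
      (if_neg hz).trans (blowUpSection_of_ne _)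
    refine key _ _ (fun z => d'.1 (c.symm (z.1 * z.2, z.2)))
      ({z | z.2 ≠ 0} ∩ (fun z : ℂ × ℂ => (z.1 * z.2, z.2)) ⁻¹' (c.target ∩ c.symm ⁻¹' d'.1.source))
      ((isOpen_ne.preimage continuous_snd).inter ((c.symm.isOpen_inter_preimage
        d'.1.open_source).preimage contDiff_blow₂.continuous)) ?_ (fun z => ?_) fun z hz => ?_
    · exact (contDiffOn_coord_change (s := c.target ∩ c.symm ⁻¹' d'.1.source) hcm d'.2
        (fun z hz => hz.1) fun z hz => hz.2).comp contDiff_blow₂.contDiffOn fun z hz => hz.2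
    · constructor
      · rintro ⟨h2, h3⟩
        refine ⟨trivial, ?_⟩
        rw [h1 z h2]
        exact ⟨⟨_, rfl⟩, h3.2⟩
      · rintro ⟨-, h2⟩
        by_cases hz : z.2 = 0
        · have h3 : ∃ o, (blowUpChart hc (.inr true)).symm z = .inr o := by
            have h3 : (blowUpChart hc (.inr true)).symm z = _ := if_pos hz
            rw [h3]
            split_ifs <;> exact ⟨_, rfl⟩
          obtain ⟨o, h3⟩ := h3
          rw [h3] at h2
          obtain ⟨⟨q, h4⟩, -⟩ := h2
          cases h4
        · rw [h1 z hz] at h2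
          exact ⟨hz, cu _, h2.2⟩
    · rw [h1 z hz.1]
      rfl
  · have h0 : ∀ z : ℂ × ℂ, z.2 = 0 → z.1 ≠ 0 →
        (blowUpChart hc (.inr true)).symm z = .inr (some z.1⁻¹) := fun z h h' =>
      (if_pos h).trans (if_neg h')
    have h0' : ∀ z : ℂ × ℂ, z.2 = 0 → z.1 = 0 →
        (blowUpChart hc (.inr true)).symm z = .inr none := fun z h h' =>
      (if_pos h).trans (if_pos h')
    have h3 : ∀ (z : ℂ × ℂ) (hz : z.2 ≠ 0), (blowUpChart hc (.inr true)).symm z =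
        .inl ⟨c.symm (z.1 * z.2, z.2), symm_ne_symm_zero hc (snd_ne hz)⟩ := fun z hz =>
      (if_neg hz).trans (blowUpSection_of_ne _)
    have h4 : ∀ z : ℂ × ℂ, c (c.symm (z.1 * z.2, z.2)) = (z.1 * z.2, z.2) := fun z =>
      c.right_inv (cu _)
    refine key _ _ (fun z => (z.1 * z.2, z.1⁻¹)) {z | z.1 ≠ 0} (isOpen_ne.preimage continuous_fst)
      ((contDiff_fst.mul contDiff_snd).contDiffOn.prodMk (contDiffOn_fst.inv fun z hz => hz))
      (fun z => ?_) fun z hz => ?_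
    · by_cases hz : z.2 = 0
      · by_cases hz' : z.1 = 0
        · rw [h0' z hz hz']
          exact ⟨fun h => (h hz').elim, fun h => h.2.elim⟩
        · rw [h0 z hz hz']
          exact ⟨fun h => ⟨trivial, trivial⟩, fun h => hz'⟩
      · rw [h3 z hz]
        constructor
        · intro h
          refine ⟨trivial, c.map_target (cu _), ?_⟩
          rw [h4]
          exact mul_ne_zero h hz
        · rintro ⟨-, -, h⟩
          rw [h4] at h
          exact left_ne_zero_of_mul h
    · have hz' : z.1 ≠ 0 := hz
      by_cases hz : z.2 = 0
      · rw [h0 z hz hz', hz, mul_zero]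
        rfl
      · rw [h3 z hz]
        change ((c (c.symm (z.1 * z.2, z.2))).1,
          (c (c.symm (z.1 * z.2, z.2))).2 / (c (c.symm (z.1 * z.2, z.2))).1) = _
        rw [h4]
        refine Prod.ext rfl ?_
        simp only
        field_simp
  · refine key _ _ (fun z => z) univ isOpen_univ contDiffOn_id (fun z => ?_) fun z hz => ?_
    · exact ⟨fun _ => ⟨trivial, (blowUpChart hc (.inr true)).map_target trivial⟩, fun _ => trivial⟩
    · exact (blowUpChart hc (.inr true)).right_inv trivial

end Existence

/-- Two distinct points in the domain of a coordinate system have disjoint neighbourhoods. -/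
theorem exists_separated_of_mem_source {S : Type} [TopologicalSpace S]
    (e : OpenPartialHomeomorph S (ℂ × ℂ)) {x y : S} (hx : x ∈ e.source) (hy : y ∈ e.source)
    (hxy : x ≠ y) : ∃ u v : Set S, IsOpen u ∧ IsOpen v ∧ x ∈ u ∧ y ∈ v ∧ Disjoint u v := by
  obtain ⟨u, v, hu, hv, h1, h2, h3⟩ := t2_separation fun h => hxy (e.injOn hx hy h)
  exact ⟨_, _, e.isOpen_inter_preimage hu, e.isOpen_inter_preimage hv, ⟨hx, h1⟩, ⟨hy, h2⟩,
    disjoint_left.2 fun q hq hq' => disjoint_left.1 h3 hq.2 hq'.2⟩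

/-- The blow-up of the origin of a coordinate system with values in all of `ℂ²` exists. -/
theorem exists_isStdBlowUp (M : MarkedSurface) {c : OpenPartialHomeomorph M (ℂ × ℂ)}
    (hcm : c ∈ Coord M) (hc : c.target = univ) (hp : ∀ z, M.patch z ≠ c.symm 0) :
    ∃ M' π e₁ e₂, IsStdBlowUp M' M c π e₁ e₂ := by
  have cu : ∀ z, z ∈ c.target := fun z => by simp [hc]
  have cov : ∀ x, ∃ i, x ∈ (blowUpChart hc i).source := by
    rintro (q | _ | h)
    · obtain ⟨d, hd, hq⟩ := exists_coord_mem (S := M) q.1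
      exact ⟨.inl ⟨d, hd⟩, ⟨q, rfl⟩, hq⟩
    · exact ⟨.inr true, trivial⟩
    · exact ⟨.inr false, trivial⟩
  obtain ⟨t, cs, m, Φ, hΦ, hφ⟩ := exists_surface (blowUpChart hc) cov
    (fun i j => (blowUpChart_compat hcm hc i j).1) fun i j => (blowUpChart_compat hcm hc i j).2
  have hsrc : ∀ i, (Φ i).source = (blowUpChart hc i).source := fun i => by rw [hφ]
  have htgt : ∀ i, (Φ i).target = (blowUpChart hc i).target := fun i => by rw [hφ]
  have hfun : ∀ i x, Φ i x = blowUpChart hc i x := fun i x =>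
    congrFun (congrArg PartialEquiv.toFun (hφ i)) x
  have hinv : ∀ i z, (Φ i).symm z = (blowUpChart hc i).symm z := fun i z =>
    congrFun (congrArg PartialEquiv.invFun (hφ i)) z
  have π₁ : ∀ z, blowDownMap c ((blowUpChart hc (.inr false)).symm z) =
      c.symm (z.1, z.1 * z.2) := fun z => by
    change blowDownMap c (if _ then _ else _) = _
    split_ifs with h
    · rw [h, zero_mul]; rfl
    · rw [blowUpSection_of_ne (symm_ne_symm_zero hc (fst_ne h))]; rfl
  have π₂ : ∀ z, blowDownMap c ((blowUpChart hc (.inr true)).symm z) =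
      c.symm (z.1 * z.2, z.2) := fun z => by
    change blowDownMap c (if _ then _ else _) = _
    split_ifs with h h'
    · rw [h, mul_zero]; rfl
    · rw [h, mul_zero]; rfl
    · rw [blowUpSection_of_ne (symm_ne_symm_zero hc (snd_ne h))]; rfl
  have eq₁ : ∀ q ∈ (Φ (.inr false)).source, blowDownMap c q =
      c.symm ((Φ (.inr false) q).1, (Φ (.inr false) q).1 * (Φ (.inr false) q).2) := fun q hq => by
    rw [← π₁, ← hinv, (Φ _).left_inv hq]
  have eq₂ : ∀ q ∈ (Φ (.inr true)).source, blowDownMap c q =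
      c.symm ((Φ (.inr true) q).1 * (Φ (.inr true) q).2, (Φ (.inr true) q).2) := fun q hq => by
    rw [← π₂, ← hinv, (Φ _).left_inv hq]
  have ov₁ : ∀ q ∈ (Φ (.inr false)).source,
      q ∈ (Φ (.inr true)).source ↔ (Φ (.inr false) q).2 ≠ 0 := by
    intro q hq
    rw [hsrc] at hq ⊢
    rw [hfun]
    rcases q with q | _ | h
    · exact ⟨fun h => div_ne_zero h.2 hq.2, fun h => ⟨hq.1, fun h' => h (by
        change (c q.1).2 / (c q.1).1 = 0
        rw [h', zero_div])⟩⟩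
    · exact hq.elim
    · exact Iff.rfl
  have ov₂ : ∀ q ∈ (Φ (.inr true)).source,
      q ∈ (Φ (.inr false)).source ↔ (Φ (.inr true) q).1 ≠ 0 := by
    intro q hq
    rw [hsrc] at hq ⊢
    rw [hfun]
    rcases q with q | _ | h
    · exact ⟨fun h => div_ne_zero h.2 hq.2, fun h => ⟨hq.1, fun h' => h (by
        change (c q.1).1 / (c q.1).2 = 0
        rw [h', zero_div])⟩⟩
    · exact ⟨fun h => h.elim, fun h => h rfl⟩
    · exact ⟨fun _ => inv_ne_zero hq, fun _ => trivial⟩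
  have mul_one : ∀ q ∈ (Φ (.inr false)).source ∩ (Φ (.inr true)).source,
      (Φ (.inr false) q).2 * (Φ (.inr true) q).1 = 1 := by
    rintro q ⟨h1, h2⟩
    rw [hsrc] at h1 h2
    rw [hfun, hfun]
    rcases q with q | _ | h
    · have h3 := h1.2
      have h4 := h2.2
      change (c q.1).2 / (c q.1).1 * ((c q.1).1 / (c q.1).2) = 1
      field_simp
    · exact h1.elim
    · exact mul_inv_cancel₀ h2
  have smooth : ContMDiff 𝓘(ℂ, ℂ × ℂ) 𝓘(ℂ, ℂ × ℂ) ω (blowDownMap c) := by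
    intro x
    obtain ⟨i, hi⟩ := cov x
    rw [← hsrc] at hi
    refine ContMDiffOn.contMDiffAt ?_ ((Φ i).open_source.mem_nhds hi)
    have hcs := hc ▸ (mem_coord_iff.1 hcm).2
    rcases i with d | _ | _
    · refine contMDiffOn_of_comp_symm (hΦ _) (mem_coord_iff.1 d.2).2 le_rfl ?_ ?_
      · intro q hq
        rw [hsrc] at hq
        rw [hfun]
        exact ((blowUpChart hc (.inl d)).map_source hq).1
      · intro q hq
        rw [hsrc] at hq
        rw [hfun]
        exact (d.1.left_inv hq.2).symm
    · exact contMDiffOn_of_comp_symm (hΦ _) (hcs.comp (contMDiffOn_iff_contDiffOn.2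
        (contDiff_blow₁.contDiffOn (s := univ))) fun _ _ => trivial) le_rfl
        (fun _ _ => trivial) eq₁
    · exact contMDiffOn_of_comp_symm (hΦ _) (hcs.comp (contMDiffOn_iff_contDiffOn.2
        (contDiff_blow₂.contDiffOn (s := univ))) fun _ _ => trivial) le_rfl
        (fun _ _ => trivial) eq₂
  have hinj : ∀ x y : BlowUpSet M c, blowDownMap c x = blowDownMap c y →
      blowDownMap c x ≠ c.symm 0 → x = y := by
    rintro (x | x) (y | y) h h'
    · exact congrArg _ (Subtype.ext h)
    · exact (x.2 h).elim
    · exact (h' rfl).elim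
    · exact (h' rfl).elim
  have hnone : (.inr none : BlowUpSet M c) ∈ (Φ (.inr true)).source := by rw [hsrc]; trivial
  have hsome : ∀ h, (.inr (some h) : BlowUpSet M c) ∈ (Φ (.inr false)).source := fun h => by
    rw [hsrc]; trivial
  -- The directions `some h` and `none` share the second chart unless `h = 0`. For `h = 0` the sets
  -- `|v| < 1` in the first chart and `|u| < 1` in the second are disjoint, because `v u = 1` on the
  -- overlap.
  have sep : ∀ h : ℂ, ∃ u v : Set (BlowUpSet M c), IsOpen u ∧ IsOpen v ∧ .inr (some h) ∈ u ∧
      .inr none ∈ v ∧ Disjoint u v := by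
    intro h
    by_cases h0 : h = 0
    · refine ⟨_, _, (Φ (.inr false)).isOpen_inter_preimage
        (isOpen_lt (f := fun z : ℂ × ℂ => ‖z.2‖) (g := fun _ => 1) (by fun_prop) (by fun_prop)),
        (Φ (.inr true)).isOpen_inter_preimage
        (isOpen_lt (f := fun z : ℂ × ℂ => ‖z.1‖) (g := fun _ => 1) (by fun_prop) (by fun_prop)),
        ⟨hsome h, ?_⟩, ⟨hnone, ?_⟩, disjoint_left.2 ?_⟩
      · rw [h0]
        change ‖(Φ (.inr false) _).2‖ < 1
        rw [hfun]
        exact (norm_zero (E := ℂ)).trans_lt one_pos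
      · change ‖(Φ (.inr true) _).1‖ < 1
        rw [hfun]
        exact (norm_zero (E := ℂ)).trans_lt one_pos
      · rintro q ⟨h1, h2⟩ ⟨h3, h4⟩
        have h5 := congrArg norm (mul_one q ⟨h1, h3⟩)
        rw [norm_mul, norm_one] at h5
        exact (mul_lt_one_of_nonneg_of_lt_one_left (norm_nonneg _) h2 (le_of_lt h4)).ne h5
    · refine exists_separated_of_mem_source (Φ (.inr true)) ?_ hnone fun h => by cases h
      rw [hsrc]
      exact h0
  have t2 : T2Space (BlowUpSet M c) := by
    refine ⟨fun x y hxy => ?_⟩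
    -- Points with different images are separated downstairs; otherwise both lie on the exceptional
    -- curve.
    by_cases h : blowDownMap c x = blowDownMap c y
    · have hx : blowDownMap c x = c.symm 0 := by
        by_contra h'
        exact hxy (hinj x y h h')
      have hy := h.symm.trans hx
      rcases x with x | x
      · exact (x.2 hx).elim
      rcases y with y | y
      · exact (y.2 hy).elim
      rcases x with _ | x <;> rcases y with _ | y
      · exact (hxy rfl).elim
      · obtain ⟨u, v, h1, h2, h3, h4, h5⟩ := sep y
        exact ⟨v, u, h2, h1, h4, h3, h5.symm⟩
      · exact sep x
      · exact exists_separated_of_mem_source _ (hsome x) (hsome y) hxy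
    · obtain ⟨u, v, h1, h2, h3, h4, h5⟩ := t2_separation h
      exact ⟨_, _, h1.preimage smooth.continuous, h2.preimage smooth.continuous, h3, h4,
        h5.preimage _⟩
  obtain ⟨e, he, het, hep⟩ := M.isPatch
  let M' : MarkedSurface :=
    { carrier := BlowUpSet M c
      patch := fun z => blowUpSection c (M.patch z)
      isPatch := by
        -- The patch of `M` misses the centre, so its chart away from the exceptional curve still
        -- takes all values in `ℂ²`.
        refine ⟨Φ (.inl ⟨e, he⟩), hΦ _, ?_, fun z => ?_⟩
        · rw [htgt]
          refine eq_univ_of_forall fun z => ⟨by simp [het], ?_⟩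
          simp only
          rw [hep]
          exact hp z
        · rw [hinv]
          exact congrArg (blowUpSection c) (hep z) }
  refine ⟨M', blowDownMap c, Φ (.inr false), Φ (.inr true), hcm, hc, smooth, fun z => ?_,
    ⟨blowUpSection c, fun q hq => ContMDiffAt.contMDiffWithinAt ?_, fun q hq => ?_, fun q hq => ?_⟩,
    hΦ _, hΦ _, fun q => ?_, ?_, ?_, fun q hq => ?_, fun q hq => ?_, ov₁, ov₂, mul_one⟩
  · change blowDownMap c (blowUpSection c _) = _
    rw [blowUpSection_of_ne (hp z)]
    rfl
  · obtain ⟨d, hd, hqd⟩ := exists_coord_mem (S := M) q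
    have hU : IsOpen (d.source ∩ {c.symm 0}ᶜ) := d.open_source.inter isOpen_compl_singleton
    refine ContMDiffOn.contMDiffAt (s := d.source ∩ {c.symm 0}ᶜ) ?_ (hU.mem_nhds ⟨hqd, hq⟩)
    refine contMDiffOn_of_comp_symm hd (mem_coord_iff.1 (hΦ (.inl ⟨d, hd⟩))).2 inter_subset_left
      (fun q' hq' => ?_) fun q' hq' => ?_
    · rw [htgt]
      exact ⟨d.map_source hq'.1, by rw [d.left_inv hq'.1]; exact hq'.2⟩
    · rw [hinv]
      change _ = blowUpSection c (d.symm (d q'))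
      rw [d.left_inv hq'.1]
  · rw [blowUpSection_of_ne hq]
    rfl
  · rcases q with q | q
    · exact blowUpSection_inl q
    · exact (hq rfl).elim
  · rw [hsrc, hsrc]
    rcases q with q | _ | h
    · constructor
      · rintro (h | h)
        · exact h.1
        · exact h.1
      · intro h
        by_contra! h'
        have h1 : (c q.1).1 = 0 := by
          by_contra h1
          exact h'.1 ⟨h, h1⟩
        have h2 : (c q.1).2 = 0 := by
          by_contra h2
          exact h'.2 ⟨h, h2⟩
        exact q.2 ((c.left_inv h).symm.trans (congrArg _ (Prod.ext h1 h2)))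
    · exact ⟨fun _ => c.map_target (cu 0), fun _ => Or.inr trivial⟩
    · exact ⟨fun _ => c.map_target (cu 0), fun _ => Or.inl trivial⟩
  · rw [htgt]; rfl
  · rw [htgt]; rfl
  · rw [eq₁ q hq, c.right_inv (cu _)]
  · rw [eq₂ q hq, c.right_inv (cu _)]

/-! ### Surfaces covered by affine planes -/

/-- Copies of `ℂ²` that cover a set, with holomorphic coordinate changes `f i j` on open sets
`s i j` and closed gluing relations, define a Hausdorff complex surface. -/
theorem exists_markedSurface {X ι : Type} (ψ : ι → ℂ × ℂ → X) (hψ : ∀ i, Function.Injective (ψ i))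
    (cov : ∀ x, ∃ i z, ψ i z = x) (s : ι → ι → Set (ℂ × ℂ)) (f : ι → ι → ℂ × ℂ → ℂ × ℂ)
    (hs : ∀ i j, IsOpen (s i j)) (hf : ∀ i j, ContDiffOn ℂ ω (f i j) (s i j))
    (h₁ : ∀ i j, ∀ z ∈ s i j, ψ j (f i j z) = ψ i z) (h₂ : ∀ i j z w, ψ i z = ψ j w → z ∈ s i j)
    (hc : ∀ i j, IsClosed {p : (ℂ × ℂ) × (ℂ × ℂ) | ψ i p.1 = ψ j p.2}) (i₀ : ι) :
    ∃ (M : MarkedSurface) (θ : M ≃ X) (U : ι → OpenPartialHomeomorph M (ℂ × ℂ)),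
      (∀ i, U i ∈ Coord M) ∧ (∀ i, (U i).target = univ) ∧ (∀ i z, θ ((U i).symm z) = ψ i z) ∧
      (∀ z, M.patch z = (U i₀).symm z) ∧ (∀ q, ∃ i, q ∈ (U i).source) ∧
      (∀ i j z, (U i).symm z ∈ (U j).source ↔ z ∈ s i j) ∧
      ∀ i j, ∀ z ∈ s i j, U j ((U i).symm z) = f i j z := by
  let φ : ι → PartialEquiv X (ℂ × ℂ) := fun i =>
    { toFun := Function.invFun (ψ i)
      invFun := ψ i
      source := range (ψ i)
      target := univ
      map_source' := fun _ _ => trivial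
      map_target' := fun z _ => mem_range_self z
      left_inv' := fun x hx => Function.invFun_eq hx
      right_inv' := fun z _ => Function.leftInverse_invFun (hψ i) z }
  have hsrc : ∀ i j, ((φ i).symm.trans (φ j)).source = s i j := by
    intro i j
    ext z
    rw [PartialEquiv.trans_source]
    constructor
    · rintro ⟨-, w, hw⟩
      exact h₂ i j z w hw.symm
    · exact fun hz => ⟨trivial, _, h₁ i j z hz⟩
  have hval : ∀ i j, ∀ z ∈ s i j, Function.invFun (ψ j) (ψ i z) = f i j z := fun i j z hz => by
    rw [← h₁ i j z hz, Function.leftInverse_invFun (hψ j)]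
  obtain ⟨t, cs, m, Φ, hΦ, hφ⟩ := exists_surface φ
    (fun x => by obtain ⟨i, z, h⟩ := cov x; exact ⟨i, z, h⟩)
    (fun i j => by rw [hsrc]; exact hs i j)
    fun i j => by rw [hsrc]; exact (hf i j).congr fun z hz => hval i j z hz
  have htgt : ∀ i, (Φ i).target = univ := fun i => by rw [hφ]
  have hinv : ∀ i z, (Φ i).symm z = ψ i z := fun i z =>
    congrFun (congrArg PartialEquiv.invFun (hφ i)) z
  have hfun : ∀ i x, Φ i x = Function.invFun (ψ i) x := fun i x =>
    congrFun (congrArg PartialEquiv.toFun (hφ i)) x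
  have hso : ∀ i, (Φ i).source = range (ψ i) := fun i => by rw [hφ]
  have himg : ∀ i (u : Set (ℂ × ℂ)), IsOpen u → IsOpen (ψ i '' u) := fun i u hu => by
    have h := (Φ i).symm.isOpen_image_of_subset_source hu (by simp [htgt])
    rwa [image_congr fun z _ => hinv i z] at h
  have t2 : T2Space X := by
    refine ⟨fun x y hxy => ?_⟩
    obtain ⟨i, z, rfl⟩ := cov x
    obtain ⟨j, w, rfl⟩ := cov y
    -- The complement of the gluing relation is open; the two factors of a product neighbourhood in
    -- it have disjoint images.
    obtain ⟨u, v, hu, hv, hz, hw, h⟩ := isOpen_prod_iff.1 (hc i j).isOpen_compl z w hxy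
    refine ⟨_, _, himg i u hu, himg j v hv, mem_image_of_mem _ hz, mem_image_of_mem _ hw,
      disjoint_left.2 ?_⟩
    rintro _ ⟨z', hz', rfl⟩ ⟨w', hw', h'⟩
    exact h (mk_mem_prod hz' hw') h'.symm
  refine ⟨⟨X, ψ i₀, Φ i₀, hΦ i₀, htgt i₀, hinv i₀⟩, Equiv.refl X, Φ, hΦ, htgt, hinv,
    fun z => (hinv i₀ z).symm, fun q => ?_, fun i j z => ?_, fun i j z hz => ?_⟩
  · obtain ⟨i, z, rfl⟩ := cov q
    exact ⟨i, by rw [hso]; exact mem_range_self z⟩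
  · rw [hso, hinv]
    constructor
    · rintro ⟨w, hw⟩
      exact h₂ i j z w hw.symm
    · exact fun hz => ⟨_, h₁ i j z hz⟩
  · rw [hfun, hinv, hval i j z hz]

/-! ### The projective plane -/

/-- Homogeneous coordinates of the point `affine k z`. -/
def affineVec : Fin 3 → ℂ × ℂ → Fin 3 → ℂ
  | 0, z => ![1, z.1, z.2]
  | 1, z => ![z.1, 1, z.2]
  | 2, z => ![z.2, z.1, 1]

/-- The affine coordinates of a point with given homogeneous coordinates. -/
def affineOfVec : Fin 3 → (Fin 3 → ℂ) → ℂ × ℂ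
  | 0, v => (v 1 / v 0, v 2 / v 0)
  | 1, v => (v 0 / v 1, v 2 / v 1)
  | 2, v => (v 1 / v 2, v 0 / v 2)

theorem affineVec_self (k : Fin 3) (z : ℂ × ℂ) : affineVec k z k = 1 := by
  fin_cases k <;> simp [affineVec]

theorem affineVec_ne_zero (k : Fin 3) (z : ℂ × ℂ) : affineVec k z ≠ 0 := fun h => by
  have := affineVec_self k z
  rw [h] at this
  simp at this

theorem affine_eq_mk (k : Fin 3) (z : ℂ × ℂ) :
    affine k z = .mk ℂ (affineVec k z) (affineVec_ne_zero k z) := by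
  fin_cases k <;> rfl

theorem affineVec_affineOfVec (k : Fin 3) (v : Fin 3 → ℂ) (hv : v k ≠ 0) :
    affineVec k (affineOfVec k v) = (v k)⁻¹ • v := by
  ext i
  fin_cases k <;> fin_cases i <;> simp [affineVec, affineOfVec] at hv ⊢ <;> field_simp

theorem affineOfVec_affineVec (k : Fin 3) (z : ℂ × ℂ) : affineOfVec k (affineVec k z) = z := by
  fin_cases k <;> simp [affineOfVec, affineVec]

/-- Proportionality as the vanishing of all `2 × 2` minors: a polynomial, hence closed, condition on
affine coordinates. This makes `ℙ²` Hausdorff. -/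
theorem mk_eq_mk_iff_mul {v w : Fin 3 → ℂ} (hv : v ≠ 0) (hw : w ≠ 0) :
    Projectivization.mk ℂ v hv = .mk ℂ w hw ↔ ∀ a b, v a * w b = v b * w a := by
  rw [Projectivization.mk_eq_mk_iff']
  constructor
  · rintro ⟨a, rfl⟩ i j
    simp only [Pi.smul_apply, smul_eq_mul]
    ring
  · intro h
    obtain ⟨i, hi⟩ := Function.ne_iff.1 hw
    have hi : w i ≠ 0 := hi
    refine ⟨v i / w i, funext fun j => ?_⟩
    rw [Pi.smul_apply, smul_eq_mul, div_mul_eq_mul_div, h i j, mul_div_cancel_right₀ _ hi]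

theorem contDiff_affineVec (k i : Fin 3) : ContDiff ℂ ω fun z => affineVec k z i := by
  fin_cases k <;> fin_cases i <;> simp [affineVec] <;> fun_prop

theorem contDiffOn_affineOfVec (i j : Fin 3) :
    ContDiffOn ℂ ω (fun z => affineOfVec j (affineVec i z)) {z | affineVec i z j ≠ 0} := by
  have h := fun k => (contDiff_affineVec i k).contDiffOn (s := {z | affineVec i z j ≠ 0})
  fin_cases j
  · exact ((h 1).div (h 0) fun z hz => hz).prodMk ((h 2).div (h 0) fun z hz => hz)
  · exact ((h 0).div (h 1) fun z hz => hz).prodMk ((h 2).div (h 1) fun z hz => hz)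
  · exact ((h 1).div (h 2) fun z hz => hz).prodMk ((h 0).div (h 2) fun z hz => hz)

theorem exists_projectivePlane :
    ∃ (M : MarkedSurface) (U : Fin 3 → OpenPartialHomeomorph M (ℂ × ℂ)), IsProjectivePlane M ∧
      (∀ i, U i ∈ Coord M) ∧ (∀ i, (U i).target = univ) ∧
      (∀ z, M.patch z = (U 0).symm z) ∧ (∀ q, ∃ i, q ∈ (U i).source) ∧
      (∀ i j z, (U i).symm z ∈ (U j).source ↔ affineVec i z j ≠ 0) ∧
      ∀ i j z, affineVec i z j ≠ 0 → U j ((U i).symm z) = affineOfVec j (affineVec i z) := by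
  have hiff : ∀ i j z w, affine i z = affine j w ↔
      ∀ a b, affineVec i z a * affineVec j w b = affineVec i z b * affineVec j w a := by
    intro i j z w
    rw [affine_eq_mk, affine_eq_mk, mk_eq_mk_iff_mul]
  have h₂ : ∀ i j z w, affine i z = affine j w → affineVec i z j ≠ 0 := by
    intro i j z w h h0
    rw [hiff] at h
    -- In this minor one product consists of the two entries normalised to `1`, while the other
    -- contains the entry assumed to vanish.
    have h1 := h i j
    rw [affineVec_self, affineVec_self, h0] at h1
    simp at h1
  have h₁ : ∀ i j z, affineVec i z j ≠ 0 →
      affine j (affineOfVec j (affineVec i z)) = affine i z := by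
    intro i j z hz
    rw [hiff, affineVec_affineOfVec _ _ hz]
    intro a b
    simp only [Pi.smul_apply, smul_eq_mul]
    ring
  obtain ⟨M, θ, U, hU, ht, hθ, hp, hcov, hsrc, hval⟩ := exists_markedSurface affine
    (fun i z w h => by
      rw [affine_eq_mk, affine_eq_mk, Projectivization.mk_eq_mk_iff'] at h
      obtain ⟨a, ha⟩ := h
      have ha1 := congrFun ha i
      rw [Pi.smul_apply, affineVec_self, affineVec_self, smul_eq_mul, mul_one] at ha1
      rw [← affineOfVec_affineVec i z, ← ha, ha1, one_smul, affineOfVec_affineVec])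
    (fun x => by
      induction x using Projectivization.ind with
      | h v hv =>
        obtain ⟨k, hk⟩ := Function.ne_iff.1 hv
        refine ⟨k, affineOfVec k v, ?_⟩
        rw [affine_eq_mk, Projectivization.mk_eq_mk_iff']
        exact ⟨(v k)⁻¹, (affineVec_affineOfVec k v hk).symm⟩)
    (fun i j => {z | affineVec i z j ≠ 0}) (fun i j z => affineOfVec j (affineVec i z))
    (fun i j => isOpen_ne_fun (contDiff_affineVec i j).continuous continuous_const)
    contDiffOn_affineOfVec h₁ h₂ (fun i j => by
      simp only [hiff, ofPred_forall]
      have hc := fun k l => (contDiff_affineVec k l).continuous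
      refine isClosed_iInter fun a => isClosed_iInter fun b => isClosed_eq ?_ ?_
      · exact ((hc i a).comp continuous_fst).mul ((hc j b).comp continuous_snd)
      · exact ((hc i b).comp continuous_fst).mul ((hc j a).comp continuous_snd)) 0
  refine ⟨M, U, ⟨θ, fun k => ⟨U k, hU k, ht k, fun z => ?_⟩, fun z => ?_⟩, hU, ht, hp, hcov, hsrc,
    hval⟩
  · exact ((Equiv.symm_apply_eq θ).2 (hθ k z).symm).symm
  · rw [hp, hθ]

/-! ### The product of two projective lines -/

open Classical in
/-- The two affine coordinates on the projective line `Option ℂ`. -/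
def lineParam : Bool → ℂ → Option ℂ
  | false, z => some z
  | true, z => if z = 0 then none else some z⁻¹

/-- The equation `z w = 1` replaces `w = z⁻¹` because it defines a closed set, as needed for the
Hausdorff property. -/
theorem lineParam_eq_iff (i j : Bool) (z w : ℂ) :
    lineParam i z = lineParam j w ↔ if i = j then z = w else z * w = 1 := by
  by_cases hz : z = 0 <;> by_cases hw : w = 0 <;> cases i <;> cases j <;>
    simp [lineParam, hz, hw, inv_inj] <;>
    first
    | exact fun h => hz h.symm
    | exact fun h => hw h.symm
    | (rw [mul_eq_one_iff_eq_inv₀ hw, inv_eq_iff_eq_inv])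
    | (rw [mul_eq_one_iff_eq_inv₀ hw])

/-- The coordinate change on the projective line. -/
def lineChange (i j : Bool) (z : ℂ) : ℂ := if i = j then z else z⁻¹

/-- The domain of the coordinate change on the projective line. -/
def lineDom (i j : Bool) : Set ℂ := {z | i = j ∨ z ≠ 0}

theorem lineParam_lineChange {i j : Bool} {z : ℂ} (hz : z ∈ lineDom i j) :
    lineParam j (lineChange i j z) = lineParam i z := by
  rw [lineParam_eq_iff, lineChange]
  by_cases h : i = j
  · simp [h]
  · have hz : z ≠ 0 := hz.resolve_left h
    simp [h, Ne.symm h, hz]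

theorem mem_lineDom {i j : Bool} {z w : ℂ} (h : lineParam i z = lineParam j w) :
    z ∈ lineDom i j := by
  rw [lineParam_eq_iff] at h
  by_cases hij : i = j
  · exact Or.inl hij
  · rw [if_neg hij] at h
    exact Or.inr (left_ne_zero_of_mul_eq_one h)

theorem isOpen_lineDom (i j : Bool) : IsOpen (lineDom i j) := by
  by_cases hij : i = j
  · simp [lineDom, hij]
  · simpa [lineDom, hij] using isOpen_ne

theorem contDiffOn_lineChange (i j : Bool) : ContDiffOn ℂ ω (lineChange i j) (lineDom i j) := by
  by_cases hij : i = j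
  · have : lineChange i j = fun z => z := funext fun z => by simp [lineChange, hij]
    rw [this]
    exact contDiffOn_id
  · have : lineChange i j = fun z => z⁻¹ := funext fun z => by simp [lineChange, hij]
    rw [this]
    exact contDiffOn_id.inv fun z hz => hz.resolve_left hij

theorem isClosed_lineParam (i j : Bool) :
    IsClosed {p : ℂ × ℂ | lineParam i p.1 = lineParam j p.2} := by
  simp only [lineParam_eq_iff]
  by_cases hij : i = j
  · simpa [hij] using isClosed_eq continuous_fst continuous_snd
  · simpa [hij] using isClosed_eq (continuous_fst.mul continuous_snd) continuous_const

theorem exists_lineProduct :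
    ∃ (M : MarkedSurface) (V : Bool × Bool → OpenPartialHomeomorph M (ℂ × ℂ)),
      (∀ i, V i ∈ Coord M) ∧ (∀ i, (V i).target = univ) ∧
      (∀ z, M.patch z = (V (false, false)).symm z) ∧ (∀ q, ∃ i, q ∈ (V i).source) ∧
      (∀ i j z, (V i).symm z ∈ (V j).source ↔ z.1 ∈ lineDom i.1 j.1 ∧ z.2 ∈ lineDom i.2 j.2) ∧
      ∀ i j z, z.1 ∈ lineDom i.1 j.1 → z.2 ∈ lineDom i.2 j.2 →
        V j ((V i).symm z) = (lineChange i.1 j.1 z.1, lineChange i.2 j.2 z.2) := by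
  obtain ⟨M, θ, U, hU, ht, hθ, hp, hcov, hsrc, hval⟩ := exists_markedSurface
    (fun (i : Bool × Bool) (z : ℂ × ℂ) => (lineParam i.1 z.1, lineParam i.2 z.2))
    (fun i z w h => by
      have h1 := congrArg Prod.fst h
      have h2 := congrArg Prod.snd h
      simp only [lineParam_eq_iff, if_true] at h1 h2
      exact Prod.ext h1 h2)
    (fun x => by
      have : ∀ o : Option ℂ, ∃ i z, lineParam i z = o := by
        rintro (_ | z)
        · exact ⟨true, 0, if_pos rfl⟩
        · exact ⟨false, z, rfl⟩
      obtain ⟨i, z, hz⟩ := this x.1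
      obtain ⟨j, w, hw⟩ := this x.2
      exact ⟨(i, j), (z, w), Prod.ext hz hw⟩)
    (fun i j => lineDom i.1 j.1 ×ˢ lineDom i.2 j.2)
    (fun i j z => (lineChange i.1 j.1 z.1, lineChange i.2 j.2 z.2))
    (fun i j => (isOpen_lineDom _ _).prod (isOpen_lineDom _ _))
    (fun i j => ((contDiffOn_lineChange _ _).comp contDiffOn_fst fun z hz => hz.1).prodMk
      ((contDiffOn_lineChange _ _).comp contDiffOn_snd fun z hz => hz.2))
    (fun i j z hz => Prod.ext (lineParam_lineChange hz.1) (lineParam_lineChange hz.2))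
    (fun i j z w h => ⟨mem_lineDom (congrArg Prod.fst h), mem_lineDom (congrArg Prod.snd h)⟩)
    (fun i j => by
      simp only [Prod.mk.injEq, ofPred_and]
      exact ((isClosed_lineParam _ _).preimage
        (f := fun p : (ℂ × ℂ) × (ℂ × ℂ) => (p.1.1, p.2.1)) (by fun_prop)).inter
        ((isClosed_lineParam _ _).preimage
        (f := fun p : (ℂ × ℂ) × (ℂ × ℂ) => (p.1.2, p.2.2)) (by fun_prop))) (false, false)
  exact ⟨M, U, hU, ht, hp, hcov, fun i j z => hsrc i j z, fun i j z h h' => hval i j z ⟨h, h'⟩⟩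

/-! ### Lifting coordinate systems, extending maps -/

/-- A coordinate system whose domain avoids the centre lifts to the blow-up. -/
theorem IsStdBlowUp.exists_lift {M' M : MarkedSurface} {c : OpenPartialHomeomorph M (ℂ × ℂ)}
    {π : M' → M} {e₁ e₂ : OpenPartialHomeomorph M' (ℂ × ℂ)} (h : IsStdBlowUp M' M c π e₁ e₂)
    {d : OpenPartialHomeomorph M (ℂ × ℂ)} (hd : d ∈ Coord M) (hp : c.symm 0 ∉ d.source) :
    ∃ d' ∈ Coord M', d'.source = π ⁻¹' d.source ∧ d'.target = d.target ∧
      (∀ q, d' q = d (π q)) ∧ ∀ z ∈ d.target, π (d'.symm z) = d.symm z := by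
  obtain ⟨τ, hτ, h₁, h₂⟩ := h.sect
  have hne : ∀ q ∈ d.source, q ≠ c.symm 0 := fun q hq h => hp (h ▸ hq)
  have cF : ContMDiffOn 𝓘(ℂ, ℂ × ℂ) 𝓘(ℂ, ℂ × ℂ) ω (fun q => d (π q)) (π ⁻¹' d.source) :=
    (mem_coord_iff.1 hd).1.comp h.smooth.contMDiffOn fun _ hq => hq
  have cG : ContMDiffOn 𝓘(ℂ, ℂ × ℂ) 𝓘(ℂ, ℂ × ℂ) ω (fun z => τ (d.symm z)) d.target :=
    hτ.comp (mem_coord_iff.1 hd).2 fun z hz => hne _ (d.map_target hz)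
  let d' : OpenPartialHomeomorph M' (ℂ × ℂ) :=
    { toFun := fun q => d (π q)
      invFun := fun z => τ (d.symm z)
      source := π ⁻¹' d.source
      target := d.target
      map_source' := fun q hq => d.map_source hq
      map_target' := fun z hz => by
        rw [mem_preimage, h₁ _ (hne _ (d.map_target hz))]
        exact d.map_target hz
      left_inv' := fun q hq => by rw [d.left_inv hq, h₂ _ (hne _ hq)]
      right_inv' := fun z hz => by rw [h₁ _ (hne _ (d.map_target hz)), d.right_inv hz]
      open_source := d.open_source.preimage h.smooth.continuous
      open_target := d.open_target
      continuousOn_toFun := cF.continuousOn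
      continuousOn_invFun := cG.continuousOn }
  exact ⟨d', mem_coord_iff.2 ⟨cF, cG⟩, rfl, rfl, fun _ => rfl, fun z hz =>
    h₁ _ (hne _ (d.map_target hz))⟩

/-- The complement of the two axes is dense in `ℂ²`, so it is enough that the patch covers each
chart off its axes. -/
theorem denseRange_patch_of_charts {M : MarkedSurface}
    (h : ∀ q : M, ∃ e : OpenPartialHomeomorph M (ℂ × ℂ), q ∈ e.source ∧ e.target = univ ∧
      ∀ z : ℂ × ℂ, z.1 ≠ 0 → z.2 ≠ 0 → e.symm z ∈ range M.patch) : DenseRange M.patch := by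
  intro q
  obtain ⟨e, hq, ht, hz⟩ := h q
  have hd : Dense ({0}ᶜ ×ˢ {0}ᶜ : Set (ℂ × ℂ)) := (dense_compl_singleton 0).prod
    (dense_compl_singleton 0)
  have hc : Continuous e.symm := by
    have := e.continuousOn_symm
    rwa [ht, continuousOn_univ] at this
  have h1 := image_closure_subset_closure_image hc (mem_image_of_mem e.symm (hd (e q)))
  rw [e.left_inv hq] at h1
  refine closure_mono ?_ h1
  rintro _ ⟨z, hz', rfl⟩
  exact hz z hz'.1 hz'.2

/-- Maps on coordinate domains that respect the distinguished patches agree on overlaps. -/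
theorem exists_extension {M N : MarkedSurface} (hM : DenseRange M.patch) {ι : Type}
    (e : ι → OpenPartialHomeomorph M (ℂ × ℂ)) (f : ι → ℂ × ℂ → N)
    (hf : ∀ i, ContinuousOn (f i) (e i).target)
    (hp : ∀ i z, M.patch z ∈ (e i).source → f i (e i (M.patch z)) = N.patch z) :
    ∃ F : M → N, ∀ i, ∀ q ∈ (e i).source, F q = f i (e i q) := by
  classical
  have key : ∀ i j, ∀ q ∈ (e i).source, q ∈ (e j).source → f i (e i q) = f j (e j q) := by
    intro i j q hi hj
    have hU : IsOpen ((e i).source ∩ (e j).source) := (e i).open_source.inter (e j).open_source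
    have hc : ∀ k, ContinuousOn (fun q => f k (e k q)) (e k).source := fun k =>
      (hf k).comp (e k).continuousOn fun q hq => (e k).map_source hq
    -- Points of the patch inside the overlap accumulate at `q`. There both maps equal `N.patch`,
    -- and since `N` is Hausdorff the equality passes to `q`.
    have hd : q ∈ closure ((e i).source ∩ (e j).source ∩ range M.patch) :=
      hM.open_subset_closure_inter hU ⟨hi, hj⟩
    by_contra hne
    obtain ⟨u, v, hu, hv, h1, h2, h3⟩ := t2_separation hne
    have h4 := (((hc i).continuousAt ((e i).open_source.mem_nhds hi)).preimage_mem_nhds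
      (hu.mem_nhds h1))
    have h5 := (((hc j).continuousAt ((e j).open_source.mem_nhds hj)).preimage_mem_nhds
      (hv.mem_nhds h2))
    obtain ⟨q', ⟨h6, h7⟩, ⟨h8, h9⟩, z, rfl⟩ := mem_closure_iff_nhds.1 hd _ (inter_mem h4 h5)
    refine disjoint_left.1 h3 h6 ?_
    change f i (e i (M.patch z)) ∈ v
    rw [hp i z h8, ← hp j z h9]
    exact h7
  -- Outside all coordinate domains the value is arbitrary.
  let F : M → N := fun q =>
    if h : ∃ i, q ∈ (e i).source then f h.choose (e h.choose q) else N.patch 0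
  refine ⟨F, fun i q hq => ?_⟩
  have h : ∃ i, q ∈ (e i).source := ⟨i, hq⟩
  change (if h : _ then _ else _) = _
  rw [dif_pos h]
  exact key _ _ q h.choose_spec hq

/-! ### From the projective plane to the product of two lines -/

theorem ne_of_mem_of_notMem' {α : Type} {s : Set α} {x y : α} (hx : x ∈ s) (hy : y ∉ s) : x ≠ y :=
  fun h => hy (h ▸ hx)

/-- The blow-up of `ℙ²` at `[0 : 1 : 0]` and `[0 : 0 : 1]` is the blow-up of a product of two
projective lines at one point. -/
theorem exists_planeToLineProduct {γ₁ γ₂ δ : ℂ → ℂ × ℂ}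
    (h₁ : ∀ᶠ s in 𝓝[≠] 0, (γ₁ s).1 ≠ 0) (h₁x : Tendsto (fun s => (γ₁ s).1⁻¹) (𝓝[≠] 0) (𝓝 0))
    (h₁y : Tendsto (fun s => (γ₁ s).2) (𝓝[≠] 0) (𝓝 0))
    (h₂ : ∀ᶠ s in 𝓝[≠] 0, (γ₂ s).2 ≠ 0) (h₂x : Tendsto (fun s => (γ₂ s).1) (𝓝[≠] 0) (𝓝 0))
    (h₂y : Tendsto (fun s => (γ₂ s).2⁻¹) (𝓝[≠] 0) (𝓝 0))
    (hδ : ∀ s, s ≠ 0 → δ s = (1 / s, 1 / s)) :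
    ∃ (M₀ M₁ M₂ M₃ : MarkedSurface) (V : Bool × Bool → OpenPartialHomeomorph M₃ (ℂ × ℂ)),
      IsProjectivePlane M₀ ∧ IsBlowUpAlong γ₁ M₁ M₀ ∧ IsBlowUpAlong γ₂ M₂ M₁ ∧
      IsBlowUpAlong δ M₂ M₃ ∧ DenseRange M₃.patch ∧
      (∀ i, V i ∈ Coord M₃) ∧ (∀ i, (V i).target = univ) ∧
      (∀ z, M₃.patch z = (V (false, false)).symm z) ∧ (∀ q, ∃ i, q ∈ (V i).source) ∧
      (∀ i j z, (V i).symm z ∈ (V j).source ↔ z.1 ∈ lineDom i.1 j.1 ∧ z.2 ∈ lineDom i.2 j.2) ∧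
      ∀ i j z, z.1 ∈ lineDom i.1 j.1 → z.2 ∈ lineDom i.2 j.2 →
        V j ((V i).symm z) = (lineChange i.1 j.1 z.1, lineChange i.2 j.2 z.2) := by
  obtain ⟨M₀, U, hM₀, hU, hUt, hU0, hUc, hUs, hUv⟩ := exists_projectivePlane
  have hUu : ∀ i z, z ∈ (U i).target := fun i z => by simp [hUt]
  have hpat₀ : ∀ z, M₀.patch z ∈ (U 0).source := fun z => by
    rw [hU0]; exact (U 0).map_target (hUu _ _)
  have hU1 : ∀ z, M₀.patch z ∈ (U 1).source ↔ z.1 ≠ 0 := fun z => by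
    rw [hU0, hUs]; rfl
  have hU2 : ∀ z, M₀.patch z ∈ (U 2).source ↔ z.2 ≠ 0 := fun z => by
    rw [hU0, hUs]; rfl
  have hU1v : ∀ z : ℂ × ℂ, z.1 ≠ 0 → U 1 (M₀.patch z) = (z.1⁻¹, z.2 / z.1) := fun z hz => by
    rw [hU0, hUv 0 1 z hz]
    exact Prod.ext (one_div _) rfl
  have hU2v : ∀ z : ℂ × ℂ, z.2 ≠ 0 → U 2 (M₀.patch z) = (z.1 / z.2, z.2⁻¹) := fun z hz => by
    rw [hU0, hUv 0 2 z hz]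
    exact Prod.ext rfl (one_div _)
  have hp1U0 : (U 1).symm 0 ∉ (U 0).source := by rw [hUs]; simp [affineVec]
  have hp1U2 : (U 1).symm 0 ∉ (U 2).source := by rw [hUs]; simp [affineVec]
  have hp2U0 : (U 2).symm 0 ∉ (U 0).source := by rw [hUs]; simp [affineVec]
  have hp2U1 : (U 2).symm 0 ∉ (U 1).source := by rw [hUs]; simp [affineVec]
  -- In terms of `x, y` the new charts are `b = (x⁻¹, y)` and `g = (y⁻¹, y / x)`. The strict
  -- transform of the line at infinity is the axis `y⁻¹ = 0` of `g` and does not meet `b`.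
  obtain ⟨M₁, π₁, b, g, H₁⟩ := exists_isStdBlowUp M₀ (hU 1) (hUt 1) fun z =>
    ne_of_mem_of_notMem' (hpat₀ z) hp1U0
  obtain ⟨U0', hU0', s0', t0', f0', i0'⟩ := H₁.exists_lift (hU 0) hp1U0
  obtain ⟨U2', hU2', s2', t2', f2', i2'⟩ := H₁.exists_lift (hU 2) hp1U2
  rw [hUt] at t0' t2'
  have hπp2 : π₁ (U2'.symm 0) = (U 2).symm 0 := i2' 0 (hUu _ _)
  -- Here `g' = (x / y, x⁻¹)` and `cc = (x, y⁻¹)`; the strict transform of the line at infinity is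
  -- the axis `x⁻¹ = 0` of `g'`.
  obtain ⟨M₂, π₂, g', cc, H₂⟩ := exists_isStdBlowUp M₁ hU2' t2' fun z h => by
    have := congrArg π₁ h
    rw [H₁.patch, hπp2] at this
    exact ne_of_mem_of_notMem' (hpat₀ z) hp2U0 this
  have hp2b : U2'.symm 0 ∉ b.source := fun h => hp2U1 (by
    rw [← hπp2]; exact (H₁.source _).1 (Or.inl h))
  have hp2g : U2'.symm 0 ∉ g.source := fun h => hp2U1 (by
    rw [← hπp2]; exact (H₁.source _).1 (Or.inr h))
  have hp2a : U2'.symm 0 ∉ U0'.source := fun h => hp2U0 (by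
    rw [s0'] at h; rw [← hπp2]; exact h)
  obtain ⟨A, hA, sA, tA, fA, iA⟩ := H₂.exists_lift hU0' hp2a
  obtain ⟨Bc, hBc, sB, tB, fB, iB⟩ := H₂.exists_lift H₁.mem₁ hp2b
  obtain ⟨G, hG, sG, tG, fG, iG⟩ := H₂.exists_lift H₁.mem₂ hp2g
  rw [t0'] at tA
  rw [H₁.target₁] at tB
  rw [H₁.target₂] at tG
  -- the distinguished patch in the charts of `M₂`
  have pA : ∀ z, A (M₂.patch z) = z := fun z => by
    rw [fA, f0', H₂.patch, H₁.patch, hU0, (U 0).right_inv (hUu _ _)]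
  have pAs : ∀ z, M₂.patch z ∈ A.source := fun z => by
    rw [sA, mem_preimage, H₂.patch, s0', mem_preimage, H₁.patch]
    exact hpat₀ z
  have pb : ∀ z, M₁.patch z ∈ b.source → z.1 ≠ 0 ∧ b (M₁.patch z) = (z.1⁻¹, z.2) := fun z hz => by
    have h1 : z.1 ≠ 0 := by
      rw [← hU1, ← H₁.patch]; exact (H₁.source _).1 (Or.inl hz)
    have h2 := H₁.eq₁ _ hz
    rw [H₁.patch, hU1v z h1, Prod.mk.injEq] at h2
    refine ⟨h1, Prod.ext h2.1.symm ?_⟩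
    have h3 := h2.2
    rw [← h2.1] at h3
    field_simp at h3
    exact h3.symm
  have pg : ∀ z, M₁.patch z ∈ g.source → z.1 ≠ 0 ∧ z.2 ≠ 0 ∧
      g (M₁.patch z) = (z.2⁻¹, z.2 / z.1) := fun z hz => by
    have h1 : z.1 ≠ 0 := by
      rw [← hU1, ← H₁.patch]; exact (H₁.source _).1 (Or.inr hz)
    have h2 := H₁.eq₂ _ hz
    rw [H₁.patch, hU1v z h1, Prod.mk.injEq] at h2
    have h3 := h2.1
    rw [← h2.2] at h3
    have h4 : z.2 ≠ 0 := fun h4 => by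
      rw [h4, zero_div, mul_zero] at h3
      exact inv_ne_zero h1 h3
    refine ⟨h1, h4, Prod.ext ?_ h2.2.symm⟩
    field_simp at h3 ⊢
    exact h3.symm
  have pg' : ∀ z, M₂.patch z ∈ g'.source → z.1 ≠ 0 ∧ z.2 ≠ 0 ∧
      g' (M₂.patch z) = (z.1 / z.2, z.1⁻¹) := fun z hz => by
    have h1 : z.2 ≠ 0 := by
      rw [← hU2, ← H₁.patch, ← mem_preimage, ← s2', ← H₂.patch]; exact (H₂.source _).1 (Or.inl hz)
    have h2 := H₂.eq₁ _ hz
    rw [f2', H₂.patch, H₁.patch, hU2v z h1, Prod.mk.injEq] at h2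
    have h3 := h2.2
    rw [← h2.1] at h3
    have h4 : z.1 ≠ 0 := fun h4 => by
      rw [h4, zero_div, zero_mul] at h3
      exact inv_ne_zero h1 h3
    refine ⟨h4, h1, Prod.ext h2.1.symm ?_⟩
    field_simp at h3 ⊢
    exact h3.symm
  have pc : ∀ z, M₂.patch z ∈ cc.source → z.2 ≠ 0 ∧ cc (M₂.patch z) = (z.1, z.2⁻¹) := fun z hz => by
    have h1 : z.2 ≠ 0 := by
      rw [← hU2, ← H₁.patch, ← mem_preimage, ← s2', ← H₂.patch]; exact (H₂.source _).1 (Or.inr hz)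
    have h2 := H₂.eq₂ _ hz
    rw [f2', H₂.patch, H₁.patch, hU2v z h1, Prod.mk.injEq] at h2
    refine ⟨h1, Prod.ext ?_ h2.2.symm⟩
    have h3 := h2.1
    rw [← h2.2] at h3
    field_simp at h3
    exact h3.symm
  have cov₂ : ∀ q, q ∈ A.source ∨ q ∈ Bc.source ∨ q ∈ cc.source ∨ q ∈ G.source ∨
      q ∈ g'.source := by
    intro q
    rw [sA, sB, sG]
    obtain ⟨i, hi⟩ := hUc (π₁ (π₂ q))
    fin_cases i
    · left; rw [mem_preimage, s0']; exact hi
    · rcases (H₁.source _).2 hi with h | h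
      · exact Or.inr (Or.inl h)
      · exact Or.inr (Or.inr (Or.inr (Or.inl h)))
    · have : π₂ q ∈ U2'.source := by rw [s2']; exact hi
      rcases (H₂.source _).2 this with h | h
      · exact Or.inr (Or.inr (Or.inr (Or.inr h)))
      · exact Or.inr (Or.inr (Or.inl h))
  have g_mem : ∀ z : ℂ × ℂ, z.1 ≠ 0 → z.2 ≠ 0 → M₂.patch z ∈ G.source := by
    intro z h1 h2
    rw [sG, mem_preimage, H₂.patch]
    have h3 : π₁ (M₁.patch z) ∈ (U 1).source := by rw [H₁.patch]; exact (hU1 z).2 h1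
    rcases (H₁.source _).2 h3 with h | h
    · rw [H₁.overlap₁ _ h, (pb z h).2]
      exact h2
    · exact h
  -- the two charts near the contracted curve
  have ov₁ : ∀ q ∈ g'.source, q ∈ G.source ↔ (g' q).1 ≠ 0 := by
    intro q hq
    have h1 := H₂.eq₁ q hq
    have h2 : π₂ q ∈ U2'.source := (H₂.source q).1 (Or.inl hq)
    rw [sG, mem_preimage]
    constructor
    · intro h3 h4
      rw [h4, zero_mul] at h1
      refine hp2g ?_
      rw [← Prod.mk_zero_zero, ← h1, U2'.left_inv h2]
      exact h3
    · intro h3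
      have h2' : π₁ (π₂ q) ∈ (U 2).source := by rw [s2'] at h2; exact h2
      rw [f2'] at h1
      have h4 : affineVec 2 ((g' q).1, (g' q).1 * (g' q).2) 1 ≠ 0 := h3
      have h5 := (hUs 2 1 _).2 h4
      have h6 := hUv 2 1 _ h4
      rw [← h1, (U 2).left_inv h2'] at h5 h6
      rcases (H₁.source _).2 h5 with h | h
      · rw [H₁.overlap₁ _ h]
        intro h7
        have h8 := H₁.eq₁ _ h
        rw [h6, h7, mul_zero] at h8
        have h9 := congrArg Prod.snd h8
        simp only [affineOfVec, affineVec, h1] at h9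
        exact one_div_ne_zero h3 h9
      · exact h
  have mul1 : ∀ q ∈ g'.source, q ∈ G.source → (g' q).1 * (G q).2 = 1 := by
    intro q hq hq'
    have h1 := H₂.eq₁ q hq
    have h3 := (ov₁ q hq).1 hq'
    have h2 : π₂ q ∈ U2'.source := (H₂.source q).1 (Or.inl hq)
    have h2' : π₁ (π₂ q) ∈ (U 2).source := by rw [s2'] at h2; exact h2
    rw [f2'] at h1
    have h6 := hUv 2 1 ((g' q).1, (g' q).1 * (g' q).2) h3
    rw [← h1, (U 2).left_inv h2'] at h6
    rw [sG, mem_preimage] at hq'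
    have h8 := H₁.eq₂ _ hq'
    rw [h6] at h8
    have h9 := congrArg Prod.snd h8
    simp only [affineOfVec, affineVec, h1] at h9
    rw [fG, ← h9]
    exact mul_one_div_cancel h3
  have ov₂ : ∀ q ∈ G.source, q ∈ g'.source ↔ (G q).2 ≠ 0 := by
    intro q hq
    constructor
    · intro h h'
      have := mul1 q h hq
      rw [h', mul_zero] at this
      exact zero_ne_one this
    · intro h
      rw [sG, mem_preimage] at hq
      have h1 := H₁.eq₂ _ hq
      have h2 : π₁ (π₂ q) ∈ (U 1).source := (H₁.source _).1 (Or.inr hq)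
      rw [fG] at h
      have h4 : affineVec 1 ((g (π₂ q)).1 * (g (π₂ q)).2, (g (π₂ q)).2) 2 ≠ 0 := h
      have h5 := (hUs 1 2 _).2 h4
      have h6 := hUv 1 2 _ h4
      rw [← h1, (U 1).left_inv h2] at h5 h6
      have h7 : π₂ q ∈ U2'.source := by rw [s2']; exact h5
      rcases (H₂.source _).2 h7 with h8 | h8
      · exact h8
      · rw [H₂.overlap₂ _ h8]
        intro h9
        have h10 := H₂.eq₂ _ h8
        rw [f2', h6, h9, zero_mul] at h10
        have h11 := congrArg Prod.fst h10
        simp only [affineOfVec, affineVec, h1] at h11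
        exact one_div_ne_zero h h11
  have memA : ∀ q i z, π₁ (π₂ q) = (U i).symm z → affineVec i z 0 ≠ 0 → q ∈ A.source := by
    intro q i z h h'
    rw [sA, mem_preimage, s0', mem_preimage, h, hUs]
    exact h'
  have rangeA : ∀ q ∈ A.source, q ∈ range M₂.patch := fun q hq =>
    ⟨A q, A.injOn (pAs _) hq (pA _)⟩
  have πB : ∀ q ∈ Bc.source, π₁ (π₂ q) = (U 1).symm ((Bc q).1, (Bc q).1 * (Bc q).2) := by
    intro q hq
    rw [sB] at hq
    rw [fB, ← H₁.eq₁ _ hq, (U 1).left_inv ((H₁.source _).1 (Or.inl hq))]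
  have πG : ∀ q ∈ G.source, π₁ (π₂ q) = (U 1).symm ((G q).1 * (G q).2, (G q).2) := by
    intro q hq
    rw [sG] at hq
    rw [fG, ← H₁.eq₂ _ hq, (U 1).left_inv ((H₁.source _).1 (Or.inr hq))]
  have U2s : ∀ q, π₂ q ∈ U2'.source → π₁ (π₂ q) ∈ (U 2).source := fun q h => by
    rw [s2'] at h; exact h
  have πg' : ∀ q ∈ g'.source, π₁ (π₂ q) = (U 2).symm ((g' q).1, (g' q).1 * (g' q).2) := by
    intro q hq
    rw [← H₂.eq₁ _ hq, f2', (U 2).left_inv (U2s q ((H₂.source _).1 (Or.inl hq)))]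
  have πc : ∀ q ∈ cc.source, π₁ (π₂ q) = (U 2).symm ((cc q).1 * (cc q).2, (cc q).2) := by
    intro q hq
    rw [← H₂.eq₂ _ hq, f2', (U 2).left_inv (U2s q ((H₂.source _).1 (Or.inr hq)))]
  have dense₂ : DenseRange M₂.patch := by
    have main : ∀ e : OpenPartialHomeomorph M₂ (ℂ × ℂ), e.target = univ →
        (∀ q ∈ e.source, (e q).1 ≠ 0 → (e q).2 ≠ 0 → q ∈ A.source) →
        ∀ z : ℂ × ℂ, z.1 ≠ 0 → z.2 ≠ 0 → e.symm z ∈ range M₂.patch := by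
      intro e he h z h1 h2
      have hz : z ∈ e.target := by simp [he]
      exact rangeA _ (h _ (e.map_target hz) (by rwa [e.right_inv hz]) (by rwa [e.right_inv hz]))
    refine denseRange_patch_of_charts fun q => ?_
    rcases cov₂ q with h | h | h | h | h
    · exact ⟨A, h, tA, main A tA fun q hq _ _ => hq⟩
    · exact ⟨Bc, h, tB, main Bc tB fun q hq h1 _ => memA q 1 _ (πB q hq) h1⟩
    · exact ⟨cc, h, H₂.target₂, main cc H₂.target₂ fun q hq _ h2 => memA q 2 _ (πc q hq) h2⟩
    · exact ⟨G, h, tG, main G tG fun q hq h1 h2 => memA q 1 _ (πG q hq) (mul_ne_zero h1 h2)⟩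
    · exact ⟨g', h, H₂.target₁, main g' H₂.target₁ fun q hq h1 h2 =>
        memA q 2 _ (πg' q hq) (mul_ne_zero h1 h2)⟩
  obtain ⟨M₃, V, hV, hVt, hV0, hVc, hVs, hVv⟩ := exists_lineProduct
  have hVu : ∀ i z, z ∈ (V i).target := fun i z => by simp [hVt]
  have hVcs : ∀ i, ContMDiffOn 𝓘(ℂ, ℂ × ℂ) 𝓘(ℂ, ℂ × ℂ) ω (V i).symm univ := fun i =>
    hVt i ▸ (mem_coord_iff.1 (hV i)).2
  have VV : ∀ i j z, z.1 ∈ lineDom i.1 j.1 → z.2 ∈ lineDom i.2 j.2 →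
      (V i).symm z = (V j).symm (lineChange i.1 j.1 z.1, lineChange i.2 j.2 z.2) := by
    intro i j z h1 h2
    rw [← hVv i j z h1 h2, (V j).left_inv ((hVs i j z).2 ⟨h1, h2⟩)]
  have patB : ∀ z : ℂ × ℂ, z.1 ≠ 0 → M₃.patch z = (V (true, false)).symm (z.1⁻¹, z.2) :=
    fun z hz => (hV0 z).trans (VV _ (true, false) z (Or.inr hz) (Or.inl rfl))
  have patC : ∀ z : ℂ × ℂ, z.2 ≠ 0 → M₃.patch z = (V (false, true)).symm (z.1, z.2⁻¹) :=
    fun z hz => (hV0 z).trans (VV _ (false, true) z (Or.inl rfl) (Or.inr hz))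
  have patD : ∀ z : ℂ × ℂ, z.1 ≠ 0 → z.2 ≠ 0 →
      M₃.patch z = (V (true, true)).symm (z.1⁻¹, z.2⁻¹) :=
    fun z hz hz' => (hV0 z).trans (VV _ (true, true) z (Or.inr hz) (Or.inr hz'))
  have dense₃ : DenseRange M₃.patch := by
    refine denseRange_patch_of_charts fun q => ?_
    obtain ⟨i, hi⟩ := hVc q
    refine ⟨V i, hi, hVt i, fun z h1 h2 => ⟨_, (hV0 _).trans
      (VV i (false, false) z (Or.inr h1) (Or.inr h2)).symm⟩⟩
  -- The contraction sends every point to its coordinates `x^{±1}, y^{±1}`. In `G = (y⁻¹, y / x)`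
  -- and `g' = (x / y, x⁻¹)` these are `(x⁻¹, y⁻¹)`, written as monomials that vanish together
  -- exactly on the contracted line.
  obtain ⟨π, hπ⟩ := exists_extension dense₂ (N := M₃) ![A, Bc, cc, G, g']
    ![(V (false, false)).symm, (V (true, false)).symm, (V (false, true)).symm,
      fun w => (V (true, true)).symm (w.1 * w.2, w.1),
      fun w => (V (true, true)).symm (w.2, w.1 * w.2)] (fun i => by
      have h := fun i => (hVcs i).continuousOn
      fin_cases i
      · exact (h _).mono (subset_univ _)
      · exact (h _).mono (subset_univ _)
      · exact (h _).mono (subset_univ _)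
      · exact (h _).comp (by fun_prop) fun _ _ => trivial
      · exact (h _).comp (by fun_prop) fun _ _ => trivial) (fun i z hz => by
      fin_cases i
      · change (V _).symm (A (M₂.patch z)) = _
        rw [pA, hV0]
      · change (V _).symm (Bc (M₂.patch z)) = _
        replace hz : M₂.patch z ∈ Bc.source := hz
        rw [sB, mem_preimage, H₂.patch] at hz
        rw [fB, H₂.patch, (pb z hz).2, patB z (pb z hz).1]
      · change (V _).symm (cc (M₂.patch z)) = _
        rw [(pc z hz).2, patC z (pc z hz).1]
      · change (V _).symm ((G (M₂.patch z)).1 * (G (M₂.patch z)).2, (G (M₂.patch z)).1) = _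
        replace hz : M₂.patch z ∈ G.source := hz
        rw [sG, mem_preimage, H₂.patch] at hz
        obtain ⟨h1, h2, h3⟩ := pg z hz
        rw [fG, H₂.patch, h3, patD z h1 h2]
        congr 2
        field_simp
      · change (V _).symm ((g' (M₂.patch z)).2, (g' (M₂.patch z)).1 * (g' (M₂.patch z)).2) = _
        obtain ⟨h1, h2, h3⟩ := pg' z hz
        rw [h3, patD z h1 h2]
        congr 2
        field_simp)
  have hA' : ∀ q ∈ A.source, π q = (V (false, false)).symm (A q) := hπ 0
  have hB' : ∀ q ∈ Bc.source, π q = (V (true, false)).symm (Bc q) := hπ 1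
  have hC' : ∀ q ∈ cc.source, π q = (V (false, true)).symm (cc q) := hπ 2
  have hG' : ∀ q ∈ G.source, π q = (V (true, true)).symm ((G q).1 * (G q).2, (G q).1) := hπ 3
  have hg' : ∀ q ∈ g'.source, π q = (V (true, true)).symm ((g' q).2, (g' q).1 * (g' q).2) := hπ 4
  have smooth : ContMDiff 𝓘(ℂ, ℂ × ℂ) 𝓘(ℂ, ℂ × ℂ) ω π := by
    intro q
    rcases cov₂ q with h | h | h | h | h
    · exact (contMDiffOn_of_comp_symm hA (hVcs _) le_rfl (fun _ _ => trivial) hA').contMDiffAt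
        (A.open_source.mem_nhds h)
    · exact (contMDiffOn_of_comp_symm hBc (hVcs _) le_rfl (fun _ _ => trivial) hB').contMDiffAt
        (Bc.open_source.mem_nhds h)
    · exact (contMDiffOn_of_comp_symm H₂.mem₂ (hVcs _) le_rfl (fun _ _ => trivial)
        hC').contMDiffAt (cc.open_source.mem_nhds h)
    · have h1 : ContDiff ℂ ω fun w : ℂ × ℂ => (w.1 * w.2, w.1) := by fun_prop
      exact (contMDiffOn_of_comp_symm hG ((hVcs _).comp (contMDiffOn_iff_contDiffOn.2
        (h1.contDiffOn (s := univ))) fun _ _ => trivial) le_rfl (fun _ _ => trivial)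
        hG').contMDiffAt (G.open_source.mem_nhds h)
    · have h1 : ContDiff ℂ ω fun w : ℂ × ℂ => (w.2, w.1 * w.2) := by fun_prop
      exact (contMDiffOn_of_comp_symm H₂.mem₁ ((hVcs _).comp (contMDiffOn_iff_contDiffOn.2
        (h1.contDiffOn (s := univ))) fun _ _ => trivial) le_rfl (fun _ _ => trivial)
        hg').contMDiffAt (g'.open_source.mem_nhds h)
  have hπpat : ∀ z, π (M₂.patch z) = M₃.patch z := fun z => by
    rw [hA' _ (pAs z), pA, hV0]
  -- the inverse
  obtain ⟨D₁, hD₁, sD₁, tD₁, fD₁, iD₁⟩ := exists_coord_comp (hV (true, true)) (hVt _) (f := id)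
    (g := id) (s := {z | z.1 ≠ 0}) (t := {z | z.1 ≠ 0}) (isOpen_ne_fun continuous_fst
    continuous_const) (isOpen_ne_fun continuous_fst continuous_const) (fun _ h => h)
    (fun _ h => h) (fun _ _ => rfl) (fun _ _ => rfl) contDiffOn_id contDiffOn_id
  obtain ⟨D₂, hD₂, sD₂, tD₂, fD₂, iD₂⟩ := exists_coord_comp (hV (true, true)) (hVt _) (f := id)
    (g := id) (s := {z | z.2 ≠ 0}) (t := {z | z.2 ≠ 0}) (isOpen_ne_fun continuous_snd
    continuous_const) (isOpen_ne_fun continuous_snd continuous_const) (fun _ h => h)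
    (fun _ h => h) (fun _ _ => rfl) (fun _ _ => rfl) contDiffOn_id contDiffOn_id
  have cs : ∀ e ∈ Coord M₂, e.target = univ →
      ContMDiffOn 𝓘(ℂ, ℂ × ℂ) 𝓘(ℂ, ℂ × ℂ) ω e.symm univ := fun e he h =>
    h ▸ (mem_coord_iff.1 he).2
  have c₁ : ContMDiffOn 𝓘(ℂ, ℂ × ℂ) 𝓘(ℂ, ℂ × ℂ) ω (fun w : ℂ × ℂ => g'.symm (w.2 / w.1, w.1))
      {z | z.1 ≠ 0} := (cs g' H₂.mem₁ H₂.target₁).comp (contMDiffOn_iff_contDiffOn.2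
        ((contDiffOn_snd.div contDiffOn_fst fun _ h => h).prodMk contDiffOn_fst))
        fun _ _ => trivial
  have c₂ : ContMDiffOn 𝓘(ℂ, ℂ × ℂ) 𝓘(ℂ, ℂ × ℂ) ω (fun w : ℂ × ℂ => G.symm (w.2, w.1 / w.2))
      {z | z.2 ≠ 0} := (cs G hG tG).comp (contMDiffOn_iff_contDiffOn.2
        (contDiffOn_snd.prodMk (contDiffOn_fst.div contDiffOn_snd fun _ h => h)))
        fun _ _ => trivial
  have b_mem : ∀ z : ℂ × ℂ, z.1 ≠ 0 → M₂.patch z ∈ Bc.source := by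
    intro z h1
    rw [sB, mem_preimage, H₂.patch]
    have h3 : π₁ (M₁.patch z) ∈ (U 1).source := by rw [H₁.patch]; exact (hU1 z).2 h1
    rcases (H₁.source _).2 h3 with h | h
    · exact h
    · obtain ⟨h4, h5, h6⟩ := pg z h
      rw [H₁.overlap₂ _ h, h6]
      exact inv_ne_zero h5
  have c_mem : ∀ z : ℂ × ℂ, z.2 ≠ 0 → M₂.patch z ∈ cc.source := by
    intro z h1
    have h3 : π₂ (M₂.patch z) ∈ U2'.source := by
      rw [H₂.patch, s2', mem_preimage, H₁.patch]; exact (hU2 z).2 h1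
    rcases (H₂.source _).2 h3 with h | h
    · obtain ⟨h4, h5, h6⟩ := pg' z h
      rw [H₂.overlap₁ _ h, h6]
      exact inv_ne_zero h4
    · exact h
  have G_val : ∀ z : ℂ × ℂ, z.1 ≠ 0 → z.2 ≠ 0 → G (M₂.patch z) = (z.2⁻¹, z.2 / z.1) := by
    intro z h1 h2
    have := g_mem z h1 h2
    rw [sG, mem_preimage, H₂.patch] at this
    rw [fG, H₂.patch, (pg z this).2.2]
  have g'_mem : ∀ z : ℂ × ℂ, z.1 ≠ 0 → z.2 ≠ 0 → M₂.patch z ∈ g'.source := by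
    intro z h1 h2
    rw [ov₂ _ (g_mem z h1 h2), G_val z h1 h2]
    exact div_ne_zero h2 h1
  have V3 : ∀ z, V (false, false) (M₃.patch z) = z := fun z => by
    rw [hV0, (V _).right_inv (hVu _ _)]
  have memV : ∀ j z, M₃.patch z ∈ (V j).source ↔ z.1 ∈ lineDom false j.1 ∧
      z.2 ∈ lineDom false j.2 := fun j z => by rw [hV0, hVs]
  have lne : ∀ {z : ℂ}, z ∈ lineDom false true → z ≠ 0 := fun h =>
    h.resolve_left Bool.false_ne_true
  have lne' : ∀ {z : ℂ}, z ∈ lineDom true false → z ≠ 0 := fun h =>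
    h.resolve_left Bool.false_ne_true.symm
  -- Away from the origin of `(x⁻¹, y⁻¹)` one of the two coordinates is nonzero, which is the domain
  -- of `D₁` or `D₂`; dividing by it recovers `x / y` or `y / x`.
  obtain ⟨τ, hτ⟩ := exists_extension dense₃ (N := M₂)
    ![V (false, false), V (true, false), V (false, true), D₁, D₂]
    ![A.symm, Bc.symm, cc.symm, fun w => g'.symm (w.2 / w.1, w.1),
      fun w => G.symm (w.2, w.1 / w.2)] (fun i => by
      fin_cases i
      · exact (cs A hA tA).continuousOn.mono (subset_univ _)
      · exact (cs Bc hBc tB).continuousOn.mono (subset_univ _)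
      · exact (cs cc H₂.mem₂ H₂.target₂).continuousOn.mono (subset_univ _)
      · exact tD₁.symm ▸ c₁.continuousOn
      · exact tD₂.symm ▸ c₂.continuousOn) (fun i z hz => by
      fin_cases i
      · change A.symm (V (false, false) (M₃.patch z)) = _
        rw [V3, ← pA z, A.left_inv (pAs z), pA]
      · change Bc.symm (V (true, false) (M₃.patch z)) = _
        have h1 := lne ((memV (true, false) z).1 hz).1
        have h2 := b_mem z h1
        rw [patB z h1, (V _).right_inv (hVu _ _), ← Bc.left_inv h2, fB, H₂.patch, (pb z _).2]
        rw [sB, mem_preimage, H₂.patch] at h2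
        exact h2
      · change cc.symm (V (false, true) (M₃.patch z)) = _
        have h1 := lne ((memV (false, true) z).1 hz).2
        have h2 := c_mem z h1
        rw [patC z h1, (V _).right_inv (hVu _ _), ← cc.left_inv h2, (pc z h2).2]
      · change g'.symm ((D₁ (M₃.patch z)).2 / (D₁ (M₃.patch z)).1, (D₁ (M₃.patch z)).1) = _
        have h := (memV (true, true) z).1 ((sD₁ _).1 hz).1
        have h1 := lne h.1
        have h2 := lne h.2
        have h3 := g'_mem z h1 h2
        rw [fD₁, patD z h1 h2, (V _).right_inv (hVu _ _), ← g'.left_inv h3, (pg' z h3).2.2]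
        congr 2
        simp only [id]
        field_simp
      · change G.symm ((D₂ (M₃.patch z)).2, (D₂ (M₃.patch z)).1 / (D₂ (M₃.patch z)).2) = _
        have h := (memV (true, true) z).1 ((sD₂ _).1 hz).1
        have h1 := lne h.1
        have h2 := lne h.2
        rw [fD₂, patD z h1 h2, (V _).right_inv (hVu _ _), ← G.left_inv (g_mem z h1 h2),
          G_val z h1 h2]
        congr 2
        simp only [id]
        field_simp)
  have τA : ∀ q ∈ (V (false, false)).source, τ q = A.symm (V (false, false) q) := hτ 0
  have τB : ∀ q ∈ (V (true, false)).source, τ q = Bc.symm (V (true, false) q) := hτ 1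
  have τC : ∀ q ∈ (V (false, true)).source, τ q = cc.symm (V (false, true) q) := hτ 2
  have τ1 : ∀ q ∈ D₁.source, τ q = g'.symm ((D₁ q).2 / (D₁ q).1, (D₁ q).1) := hτ 3
  have τ2 : ∀ q ∈ D₂.source, τ q = G.symm ((D₂ q).2, (D₂ q).1 / (D₂ q).2) := hτ 4
  have cov₃ : ∀ q, q ≠ (V (true, true)).symm 0 → q ∈ (V (false, false)).source ∨
      q ∈ (V (true, false)).source ∨ q ∈ (V (false, true)).source ∨ q ∈ D₁.source ∨
      q ∈ D₂.source := by
    intro q hq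
    obtain ⟨⟨i, j⟩, h⟩ := hVc q
    cases i <;> cases j
    · exact Or.inl h
    · exact Or.inr (Or.inr (Or.inl h))
    · exact Or.inr (Or.inl h)
    · by_cases h1 : (V (true, true) q).1 = 0
      · refine Or.inr (Or.inr (Or.inr (Or.inr ((sD₂ q).2 ⟨h, fun h2 => hq ?_⟩))))
        rw [← (V (true, true)).left_inv h]
        exact congrArg _ (Prod.ext h1 h2)
      · exact Or.inr (Or.inr (Or.inr (Or.inl ((sD₁ q).2 ⟨h, h1⟩))))
  have smoothτ : ContMDiffOn 𝓘(ℂ, ℂ × ℂ) 𝓘(ℂ, ℂ × ℂ) ω τ {(V (true, true)).symm 0}ᶜ := by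
    intro q hq
    refine ContMDiffAt.contMDiffWithinAt ?_
    rcases cov₃ q hq with h | h | h | h | h
    · exact (contMDiffOn_of_comp_symm (hV _) (cs A hA tA) le_rfl (fun _ _ => trivial)
        τA).contMDiffAt ((V _).open_source.mem_nhds h)
    · exact (contMDiffOn_of_comp_symm (hV _) (cs Bc hBc tB) le_rfl (fun _ _ => trivial)
        τB).contMDiffAt ((V _).open_source.mem_nhds h)
    · exact (contMDiffOn_of_comp_symm (hV _) (cs cc H₂.mem₂ H₂.target₂) le_rfl
        (fun _ _ => trivial) τC).contMDiffAt ((V _).open_source.mem_nhds h)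
    · exact (contMDiffOn_of_comp_symm hD₁ c₁ le_rfl (fun q hq => tD₁ ▸ D₁.map_source hq)
        τ1).contMDiffAt (D₁.open_source.mem_nhds h)
    · exact (contMDiffOn_of_comp_symm hD₂ c₂ le_rfl (fun q hq => tD₂ ▸ D₂.map_source hq)
        τ2).contMDiffAt (D₂.open_source.mem_nhds h)
  have uA : ∀ z, z ∈ A.target := fun z => by simp [tA]
  have uB : ∀ z, z ∈ Bc.target := fun z => by simp [tB]
  have uC : ∀ z, z ∈ cc.target := fun z => by simp [H₂.target₂]
  have uG : ∀ z, z ∈ G.target := fun z => by simp [tG]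
  have ug' : ∀ z, z ∈ g'.target := fun z => by simp [H₂.target₁]
  have πτ : ∀ q, q ≠ (V (true, true)).symm 0 → π (τ q) = q := by
    intro q hq
    rcases cov₃ q hq with h | h | h | h | h
    · rw [τA q h, hA' _ (A.map_target (uA _)), A.right_inv (uA _), (V _).left_inv h]
    · rw [τB q h, hB' _ (Bc.map_target (uB _)), Bc.right_inv (uB _), (V _).left_inv h]
    · rw [τC q h, hC' _ (cc.map_target (uC _)), cc.right_inv (uC _), (V _).left_inv h]
    · rw [τ1 q h, hg' _ (g'.map_target (ug' _)), g'.right_inv (ug' _)]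
      obtain ⟨h1, h2⟩ := (sD₁ q).1 h
      have h2 : (V (true, true) q).1 ≠ 0 := h2
      rw [fD₁]
      simp only [id]
      rw [div_mul_cancel₀ _ h2, Prod.mk.eta, (V _).left_inv h1]
    · rw [τ2 q h, hG' _ (G.map_target (uG _)), G.right_inv (uG _)]
      obtain ⟨h1, h2⟩ := (sD₂ q).1 h
      have h2 : (V (true, true) q).2 ≠ 0 := h2
      rw [fD₂]
      simp only [id]
      rw [mul_div_cancel₀ _ h2, Prod.mk.eta, (V _).left_inv h1]
  have Vm : ∀ i z, (V i).symm z ∈ (V i).source := fun i z => (V i).map_target (hVu i z)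
  have Vr : ∀ i z, V i ((V i).symm z) = z := fun i z => (V i).right_inv (hVu i z)
  have τπ : ∀ q', π q' ≠ (V (true, true)).symm 0 → τ (π q') = q' := by
    intro q' hq'
    rcases cov₂ q' with h | h | h | h | h
    · rw [hA' q' h, τA _ (Vm _ _), Vr, A.left_inv h]
    · rw [hB' q' h, τB _ (Vm _ _), Vr, Bc.left_inv h]
    · rw [hC' q' h, τC _ (Vm _ _), Vr, cc.left_inv h]
    · rw [hG' q' h] at hq' ⊢
      have h1 : (G q').1 ≠ 0 := fun h1 => hq' (by rw [h1, zero_mul]; rfl)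
      rw [τ2 _ ((sD₂ _).2 ⟨Vm _ _, by rw [Vr]; exact h1⟩), fD₂, Vr]
      simp only [id]
      rw [mul_div_cancel_left₀ _ h1, Prod.mk.eta, G.left_inv h]
    · rw [hg' q' h] at hq' ⊢
      have h1 : (g' q').2 ≠ 0 := fun h1 => hq' (by rw [h1, mul_zero]; rfl)
      rw [τ1 _ ((sD₁ _).2 ⟨Vm _ _, by rw [Vr]; exact h1⟩), fD₁, Vr]
      simp only [id]
      rw [mul_div_cancel_right₀ _ h1, Prod.mk.eta, g'.left_inv h]
  -- The standard charts of the blow-up at the origin of `(x⁻¹, y⁻¹)` are `(x⁻¹, x / y)` and `(y /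
  -- x, y⁻¹)`, that is, `g'` and `G` with their entries exchanged.
  have cswap : ContDiffOn ℂ ω (fun z : ℂ × ℂ => (z.2, z.1)) univ :=
    (contDiff_snd.prodMk contDiff_fst).contDiffOn
  obtain ⟨e₁, he₁, s₁, t₁, f₁, -⟩ := exists_coord_comp H₂.mem₁ H₂.target₁ (s := univ) (t := univ)
    (f := fun z => (z.2, z.1)) (g := fun z => (z.2, z.1)) isOpen_univ isOpen_univ
    (fun _ _ => trivial) (fun _ _ => trivial) (fun _ _ => rfl) (fun _ _ => rfl) cswap cswap
  obtain ⟨e₂, he₂, s₂, t₂, f₂, -⟩ := exists_coord_comp hG tG (s := univ) (t := univ)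
    (f := fun z => (z.2, z.1)) (g := fun z => (z.2, z.1)) isOpen_univ isOpen_univ
    (fun _ _ => trivial) (fun _ _ => trivial) (fun _ _ => rfl) (fun _ _ => rfl) cswap cswap
  have s₁ : ∀ q, q ∈ e₁.source ↔ q ∈ g'.source := fun q => (s₁ q).trans (and_iff_left trivial)
  have s₂ : ∀ q, q ∈ e₂.source ↔ q ∈ G.source := fun q => (s₂ q).trans (and_iff_left trivial)
  have H₃ : IsStdBlowUp M₂ M₃ (V (true, true)) π e₁ e₂ := by
    refine ⟨hV _, hVt _, smooth, hπpat, ⟨τ, smoothτ, πτ, τπ⟩, he₁, he₂, fun q => ?_, t₁, t₂,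
      fun q hq => ?_, fun q hq => ?_, fun q hq => ?_, fun q hq => ?_, ?_⟩
    · rw [s₁, s₂]
      constructor
      · rintro (h | h)
        · rw [hg' q h]; exact Vm _ _
        · rw [hG' q h]; exact Vm _ _
      · intro h
        rcases cov₂ q with h1 | h1 | h1 | h1 | h1
        · rw [hA' q h1, hVs] at h
          obtain ⟨z, rfl⟩ := rangeA q h1
          rw [pA] at h
          exact Or.inr (g_mem z (lne h.1) (lne h.2))
        · rw [hB' q h1, hVs] at h
          right
          have h2 := lne h.2
          rw [fB] at h2
          rw [sB] at h1
          rw [sG, mem_preimage, H₁.overlap₁ _ h1]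
          exact h2
        · rw [hC' q h1, hVs] at h
          left
          rw [H₂.overlap₂ _ h1]
          exact lne h.1
        · exact Or.inr h1
        · exact Or.inl h1
    · rw [hg' q ((s₁ q).1 hq), Vr, f₁]
      exact Prod.ext rfl (mul_comm _ _)
    · rw [hG' q ((s₂ q).1 hq), Vr, f₂]
      exact Prod.ext (mul_comm _ _) rfl
    · rw [f₁, s₂]
      exact ov₁ q ((s₁ q).1 hq)
    · rw [f₂, s₁]
      exact ov₂ q ((s₂ q).1 hq)
    · rintro q ⟨h, h'⟩
      rw [f₁, f₂]
      exact mul1 q ((s₁ q).1 h) ((s₂ q).1 h')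
  -- limits of the curves
  have cont : ∀ {S : MarkedSurface} (e : OpenPartialHomeomorph S (ℂ × ℂ)), e.target = univ →
      ∀ {φ : ℂ → ℂ × ℂ}, Tendsto φ (𝓝[≠] 0) (𝓝 0) →
      Tendsto (fun s => e.symm (φ s)) (𝓝[≠] 0) (𝓝 (e.symm 0)) := fun e he φ hφ =>
    (e.symm.continuousAt (by simp [he])).tendsto.comp hφ
  refine ⟨M₀, M₁, M₂, M₃, V, hM₀, ⟨_, ?_, H₁.isBlowUp⟩, ⟨_, ?_, H₂.isBlowUp⟩, ⟨_, ?_, H₃.isBlowUp⟩,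
    dense₃, hV, hVt, hV0, hVc, hVs, hVv⟩
  · have h3 := cont (U 1) (hUt 1) (h₁x.prodMk_nhds (by simpa using h₁y.mul h₁x))
    refine h3.congr' (h₁.mono fun s hs => ?_)
    rw [← div_eq_mul_inv, ← hU1v _ hs, (U 1).left_inv ((hU1 _).2 hs)]
  · have h3 := cont U2' t2' (Tendsto.prodMk_nhds (by simpa using h₂x.mul h₂y) h₂y)
    refine h3.congr' (h₂.mono fun s hs => ?_)
    rw [← div_eq_mul_inv, ← hU2v _ hs, ← H₁.patch, ← f2', U2'.left_inv]
    rw [s2', mem_preimage, H₁.patch]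
    exact (hU2 _).2 hs
  · have h3 := cont (V (true, true)) (hVt _) (φ := fun s => (s, s))
      ((tendsto_id'.2 nhdsWithin_le_nhds).prodMk_nhds (tendsto_id'.2 nhdsWithin_le_nhds))
    refine h3.congr' (eventually_mem_nhdsWithin.mono fun s hs => ?_)
    have hs : s ≠ 0 := hs
    change _ = M₃.patch (δ s)
    rw [hδ s hs, patD _ (one_div_ne_zero hs) (one_div_ne_zero hs)]
    simp

/-! ### Modifications over a set of points -/

/-- A map of marked surfaces over which coordinate systems avoiding `Z` lift. -/
structure IsModif {S' S : MarkedSurface} (π : S' → S) (Z : Set S) : Prop where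
  patch : ∀ z, π (S'.patch z) = S.patch z
  inj : ∀ q q', π q = π q' → π q ∉ Z → q = q'
  lift : ∀ d ∈ Coord S, (∀ p ∈ Z, p ∉ d.source) → ∃ d' ∈ Coord S', d'.source = π ⁻¹' d.source ∧
    d'.target = d.target ∧ ∀ q, d' q = d (π q)
  dense : DenseRange S.patch → DenseRange S'.patch

theorem isModif_id (S : MarkedSurface) (Z : Set S) : IsModif (fun q : S => q) Z :=
  ⟨fun _ => rfl, fun _ _ h _ => h, fun d hd _ => ⟨d, hd, rfl, rfl, fun _ => rfl⟩, fun h => h⟩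

theorem IsModif.comp {S'' S' S : MarkedSurface} {π : S' → S} {π' : S'' → S'} {Z W : Set S}
    {Z' : Set S'} (h : IsModif π Z) (h' : IsModif π' Z') (hZ : Z ⊆ W) (hZ' : MapsTo π Z' W) :
    IsModif (fun q => π (π' q)) W where
  patch z := by rw [h'.patch, h.patch]
  inj q q' hq hW := h'.inj _ _ (h.inj _ _ hq fun hZq => hW (hZ hZq)) fun hZq => hW (hZ' hZq)
  lift d hd hW := by
    obtain ⟨d', hd', h1, h2, h3⟩ := h.lift d hd fun p hp => hW p (hZ hp)
    obtain ⟨d'', hd'', h1', h2', h3'⟩ := h'.lift d' hd' fun p hp => by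
      rw [h1]; exact hW _ (hZ' hp)
    exact ⟨d'', hd'', by rw [h1', h1]; rfl, h2'.trans h2, fun q => by rw [h3', h3]⟩
  dense hd := h'.dense (h.dense hd)

theorem IsStdBlowUp.isModif {M' M : MarkedSurface} {c : OpenPartialHomeomorph M (ℂ × ℂ)}
    {π : M' → M} {e₁ e₂ : OpenPartialHomeomorph M' (ℂ × ℂ)} (h : IsStdBlowUp M' M c π e₁ e₂) :
    IsModif π {c.symm 0} where
  patch := h.patch
  inj q q' hq hZ := by
    obtain ⟨τ, -, -, h2⟩ := h.sect
    rw [← h2 q hZ, hq, h2 q' (hq ▸ hZ)]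
  lift d hd hZ := by
    obtain ⟨d', hd', h1, h2, h3, -⟩ := h.exists_lift hd (hZ _ rfl)
    exact ⟨d', hd', h1, h2, h3⟩
  -- The exceptional curve has no interior: its complement is dense in both blow-up charts. Off it
  -- the projection is a homeomorphism, so density of the patch lifts.
  dense hM := by
    obtain ⟨τ, hτ, h1, h2⟩ := h.sect
    have hc0 : ∀ q, π q = c.symm 0 → c (π q) = 0 := fun q hq => by
      rw [hq, c.right_inv (by simp [h.c_target])]
    have aux : ∀ (e : OpenPartialHomeomorph M' (ℂ × ℂ)) (g : ℂ × ℂ → ℂ),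
        Dense {z | g z ≠ 0} → (∀ q ∈ e.source, g (e q) ≠ 0 → c (π q) ≠ 0) → e.target = univ →
        ∀ q ∈ e.source, ∀ U ∈ 𝓝 q, ∃ q' ∈ U, π q' ≠ c.symm 0 := by
      intro e g hg he ht q hq U hU
      have hm : e.symm ⁻¹' U ∈ 𝓝 (e q) := by
        refine (e.symm.continuousAt (by simp [ht])).preimage_mem_nhds ?_
        rw [e.left_inv hq]
        exact hU
      obtain ⟨z, hz, hz'⟩ := mem_closure_iff_nhds.1 (hg (e q)) _ hm
      have hzt : z ∈ e.target := by simp [ht]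
      refine ⟨e.symm z, hz, fun h0 => he _ (e.map_target hzt) ?_ (hc0 _ h0)⟩
      rw [e.right_inv hzt]
      exact hz'
    have d₁ : Dense {z : ℂ × ℂ | z.1 ≠ 0} :=
      (dense_compl_singleton (0 : ℂ)).preimage isOpenMap_fst
    have d₂ : Dense {z : ℂ × ℂ | z.2 ≠ 0} :=
      (dense_compl_singleton (0 : ℂ)).preimage isOpenMap_snd
    have key : ∀ q, ∀ U ∈ 𝓝 q, ∃ q' ∈ U, π q' ≠ c.symm 0 := by
      intro q U hU
      by_cases hq : π q = c.symm 0
      · have : π q ∈ c.source := hq ▸ c.map_target (by simp [h.c_target])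
        rcases (h.source q).2 this with h3 | h3
        · refine aux e₁ Prod.fst d₁ (fun q hq hq' h0 => hq' ?_) h.target₁ q h3 U hU
          rw [h.eq₁ q hq] at h0
          exact congrArg Prod.fst h0
        · refine aux e₂ Prod.snd d₂ (fun q hq hq' h0 => hq' ?_) h.target₂ q h3 U hU
          rw [h.eq₂ q hq] at h0
          exact congrArg Prod.snd h0
      · exact ⟨q, mem_of_mem_nhds hU, hq⟩
    intro q
    refine mem_closure_iff.2 fun U hU hqU => ?_
    obtain ⟨q', hq', hne⟩ := key q U (hU.mem_nhds hqU)
    have hV : IsOpen ({c.symm 0}ᶜ ∩ τ ⁻¹' U) :=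
      hτ.continuousOn.isOpen_inter_preimage isOpen_compl_singleton hU
    obtain ⟨_, ⟨h3, h4⟩, z, rfl⟩ := mem_closure_iff.1 (hM (π q')) _ hV
      ⟨hne, by rw [mem_preimage, h2 _ hne]; exact hq'⟩
    rw [← h.patch] at h3 h4
    exact ⟨_, by rwa [mem_preimage, h2 _ h3] at h4, z, rfl⟩

/-! ### Blowing up repeatedly along a smooth curve -/

/-- The coordinate systems on the surface obtained by blowing up `n` times the end point of the
curve `F = (0, y)`, where `F` gives coordinates on `O` before the blow-ups. With `F = (X, y)`,
they are `b k = (X / y ^ k, y ^ (k + 1) / X)` for `k < n` and `cn = (X / y ^ n, y)`. -/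
structure IsTower (S : MarkedSurface) (O : Set S) (F : S → ℂ × ℂ) (n : ℕ)
    (b : ℕ → OpenPartialHomeomorph S (ℂ × ℂ)) (cn : OpenPartialHomeomorph S (ℂ × ℂ)) : Prop where
  cn_mem : cn ∈ Coord S
  cn_target : cn.target = univ
  b_mem : ∀ k < n, b k ∈ Coord S
  b_target : ∀ k < n, (b k).target = univ
  cn_sub : ∀ q ∈ cn.source, q ∈ O
  cn_eq : ∀ q ∈ cn.source, F q = ((cn q).1 * (cn q).2 ^ n, (cn q).2)
  b_sub : ∀ k < n, ∀ q ∈ (b k).source, q ∈ O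
  b_eq : ∀ k < n, ∀ q ∈ (b k).source,
    F q = ((b k q).1 * ((b k q).1 * (b k q).2) ^ k, (b k q).1 * (b k q).2)
  mem_cn : ∀ q ∈ O, (F q).2 ≠ 0 → q ∈ cn.source
  cover : ∀ q ∈ O, F q = 0 → (q ∈ cn.source ∧ cn q = 0) ∨
    ∃ k < n, q ∈ (b k).source ∧ (b k q).1 = 0
  b_succ : ∀ k, k + 1 < n → ∀ q ∈ (b k).source, q ∈ (b (k + 1)).source ↔ (b k q).2 ≠ 0
  b_succ_eq : ∀ k, k + 1 < n → ∀ q ∈ (b k).source, (b k q).2 ≠ 0 →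
    b (k + 1) q = ((b k q).2⁻¹, (b k q).1 * (b k q).2 ^ 2)
  succ_b : ∀ k, k + 1 < n → ∀ q ∈ (b (k + 1)).source, q ∈ (b k).source ↔ (b (k + 1) q).1 ≠ 0
  b_far : ∀ k l, k + 2 ≤ l → l < n → ∀ q ∈ (b k).source, q ∈ (b l).source → F q ≠ 0
  b_cn : ∀ k, k + 1 = n → ∀ q ∈ (b k).source, q ∈ cn.source ↔ (b k q).2 ≠ 0
  b_cn_eq : ∀ k, k + 1 = n → ∀ q ∈ (b k).source, (b k q).2 ≠ 0 →
    cn q = ((b k q).2⁻¹, (b k q).1 * (b k q).2)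
  cn_b : ∀ k, k + 1 = n → ∀ q ∈ cn.source, q ∈ (b k).source ↔ (cn q).1 ≠ 0
  far_cn : ∀ k, k + 2 ≤ n → ∀ q ∈ (b k).source, q ∈ cn.source → F q ≠ 0

/-- Before the first blow-up there is no index `k < 0`, so the family of charts `b` is only a
filler. -/
theorem isTower_zero {S : MarkedSurface} {c : OpenPartialHomeomorph S (ℂ × ℂ)} (hc : c ∈ Coord S)
    (ht : c.target = univ) : IsTower S c.source c 0 (fun _ => c) c where
  cn_mem := hc
  cn_target := ht
  b_mem k h := by omega
  b_target k h := by omega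
  cn_sub q h := h
  cn_eq q h := by simp
  b_sub k h := by omega
  b_eq k h := by omega
  mem_cn q h _ := h
  cover q h h' := Or.inl ⟨h, h'⟩
  b_succ k h := by omega
  b_succ_eq k h := by omega
  succ_b k h := by omega
  b_far k l h h' := by omega
  b_cn k h := by omega
  b_cn_eq k h := by omega
  cn_b k h := by omega
  far_cn k h := by omega

/-- The coordinate systems of a tower lift along modifications elsewhere. -/
theorem IsTower.lift {S' S : MarkedSurface} {O : Set S} {F : S → ℂ × ℂ} {n : ℕ}
    {b : ℕ → OpenPartialHomeomorph S (ℂ × ℂ)} {cn : OpenPartialHomeomorph S (ℂ × ℂ)}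
    (h : IsTower S O F n b cn) {ρ : S' → S} {Z : Set S} (hρ : IsModif ρ Z)
    (hZ : ∀ p ∈ Z, p ∉ O) :
    ∃ b' cn', IsTower S' (ρ ⁻¹' O) (fun q => F (ρ q)) n b' cn' := by
  obtain ⟨cn', m0, s0, t0, f0⟩ := hρ.lift cn h.cn_mem fun p hp hq => hZ p hp (h.cn_sub p hq)
  have : ∀ k, ∃ b' : OpenPartialHomeomorph S' (ℂ × ℂ), k < n → b' ∈ Coord S' ∧
      b'.source = ρ ⁻¹' (b k).source ∧ b'.target = (b k).target ∧ ∀ q, b' q = b k (ρ q) := by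
    intro k
    by_cases hk : k < n
    · obtain ⟨b', h1, h2⟩ := hρ.lift (b k) (h.b_mem k hk) fun p hp hq =>
        hZ p hp (h.b_sub k hk p hq)
      exact ⟨b', fun _ => ⟨h1, h2⟩⟩
    · exact ⟨cn', fun h => (hk h).elim⟩
  choose b' hb' using this
  have m := fun k hk => (hb' k hk).1
  have s := fun k hk => (hb' k hk).2.1
  have t := fun k hk => (hb' k hk).2.2.1
  have f := fun k hk => (hb' k hk).2.2.2
  have ms : ∀ k, k < n → ∀ q, q ∈ (b' k).source ↔ ρ q ∈ (b k).source := fun k hk q => by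
    rw [s k hk]; rfl
  have ms0 : ∀ q, q ∈ cn'.source ↔ ρ q ∈ cn.source := fun q => by rw [s0]; rfl
  refine ⟨b', cn', ⟨m0, t0.trans h.cn_target, m, fun k hk => (t k hk).trans (h.b_target k hk),
    fun q hq => h.cn_sub _ ((ms0 q).1 hq), fun q hq => ?_,
    fun k hk q hq => h.b_sub k hk _ ((ms k hk q).1 hq), fun k hk q hq => ?_,
    fun q hq hq' => (ms0 q).2 (h.mem_cn _ hq hq'), fun q hq hq' => ?_, fun k hk q hq => ?_,
    fun k hk q hq hq' => ?_, fun k hk q hq => ?_, fun k l hk hl q hq hq' => ?_,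
    fun k hk q hq => ?_, fun k hk q hq hq' => ?_, fun k hk q hq => ?_, fun k hk q hq hq' => ?_⟩⟩
  · rw [f0]; exact h.cn_eq _ ((ms0 q).1 hq)
  · rw [f k hk]; exact h.b_eq k hk _ ((ms k hk q).1 hq)
  · rcases h.cover _ hq hq' with ⟨h1, h2⟩ | ⟨k, hk, h1, h2⟩
    · exact Or.inl ⟨(ms0 q).2 h1, by rw [f0, h2]⟩
    · exact Or.inr ⟨k, hk, (ms k hk q).2 h1, by rw [f k hk, h2]⟩
  · rw [ms _ hk, f k (by omega)]
    exact h.b_succ k hk _ ((ms k (by omega) q).1 hq)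
  · rw [f k (by omega)] at hq' ⊢
    rw [f _ hk]
    exact h.b_succ_eq k hk _ ((ms k (by omega) q).1 hq) hq'
  · rw [ms k (by omega), f _ hk]
    exact h.succ_b k hk _ ((ms _ hk q).1 hq)
  · exact h.b_far k l hk hl _ ((ms k (by omega) q).1 hq) ((ms l hl q).1 hq')
  · rw [ms0, f k (by omega)]
    exact h.b_cn k hk _ ((ms k (by omega) q).1 hq)
  · rw [f k (by omega)] at hq' ⊢
    rw [f0]
    exact h.b_cn_eq k hk _ ((ms k (by omega) q).1 hq) hq'
  · rw [ms k (by omega), f0]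
    exact h.cn_b k hk _ ((ms0 q).1 hq)
  · exact h.far_cn k hk _ ((ms k (by omega) q).1 hq) ((ms0 q).1 hq')

theorem IsTower.cn_zero {S : MarkedSurface} {O : Set S} {F : S → ℂ × ℂ} {n : ℕ}
    {b : ℕ → OpenPartialHomeomorph S (ℂ × ℂ)} {cn : OpenPartialHomeomorph S (ℂ × ℂ)}
    (h : IsTower S O F n b cn) : cn.symm 0 ∈ O ∧ F (cn.symm 0) = 0 := by
  have h0 : (0 : ℂ × ℂ) ∈ cn.target := by simp [h.cn_target]
  refine ⟨h.cn_sub _ (cn.map_target h0), ?_⟩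
  rw [h.cn_eq _ (cn.map_target h0), cn.right_inv h0]
  simp

/-- One more blow-up. -/
theorem IsTower.step {S' S : MarkedSurface} {O : Set S} {F : S → ℂ × ℂ} {n : ℕ}
    {b : ℕ → OpenPartialHomeomorph S (ℂ × ℂ)} {cn : OpenPartialHomeomorph S (ℂ × ℂ)}
    (h : IsTower S O F n b cn) {π : S' → S} {e₁ e₂ : OpenPartialHomeomorph S' (ℂ × ℂ)}
    (H : IsStdBlowUp S' S cn π e₁ e₂) :
    ∃ b', IsTower S' (π ⁻¹' O) (fun q => F (π q)) (n + 1) b' e₂ := by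
  classical
  have h0 : (0 : ℂ × ℂ) ∈ cn.target := by simp [h.cn_target]
  -- The next centre avoids all charts `b k`, which therefore lift. Only the last of them meets `cn`
  -- over the origin of `F`, and there only where the first coordinate of `cn` is nonzero.
  have hpb : ∀ k < n, cn.symm 0 ∉ (b k).source := by
    intro k hk hq
    rcases Nat.lt_or_ge (k + 1) n with h1 | h1
    · exact h.far_cn k h1 _ hq (cn.map_target h0) h.cn_zero.2
    · have := (h.cn_b k (by omega) _ (cn.map_target h0)).1 hq
      rw [cn.right_inv h0] at this
      exact this rfl
  -- The old charts are lifted, and the new one, of index `n`, is the first blow-up chart; for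
  -- larger indices it is a filler.
  have : ∀ k, ∃ b' : OpenPartialHomeomorph S' (ℂ × ℂ), (k < n → b' ∈ Coord S' ∧
      b'.source = π ⁻¹' (b k).source ∧ b'.target = (b k).target ∧ ∀ q, b' q = b k (π q)) ∧
      (k = n → b' = e₁) := by
    intro k
    by_cases hk : k < n
    · obtain ⟨b', h1, h2⟩ := H.isModif.lift (b k) (h.b_mem k hk) fun p hp hq => by
        rw [mem_singleton_iff.1 hp] at hq
        exact hpb k hk hq
      exact ⟨b', fun _ => ⟨h1, h2⟩, fun h => by omega⟩
    · exact ⟨e₁, fun h => (hk h).elim, fun _ => rfl⟩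
  choose b' hb' using this
  have m := fun k hk => ((hb' k).1 hk).1
  have s := fun k hk => ((hb' k).1 hk).2.1
  have t := fun k hk => ((hb' k).1 hk).2.2.1
  have f := fun k hk => ((hb' k).1 hk).2.2.2
  have bn : b' n = e₁ := (hb' n).2 rfl
  have ms : ∀ k, k < n → ∀ q, q ∈ (b' k).source ↔ π q ∈ (b k).source := fun k hk q => by
    rw [s k hk]; rfl
  have sub₁ : ∀ q ∈ e₁.source, π q ∈ cn.source := fun q hq => (H.source q).1 (Or.inl hq)
  have sub₂ : ∀ q ∈ e₂.source, π q ∈ cn.source := fun q hq => (H.source q).1 (Or.inr hq)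
  have split : ∀ {k}, k < n + 1 → k < n ∨ k = n := fun hk => by omega
  have mem₁ : ∀ q, π q ∈ cn.source → (cn (π q)).1 ≠ 0 → q ∈ e₁.source := by
    intro q hq hq'
    rcases (H.source q).2 hq with h1 | h1
    · exact h1
    · rw [H.eq₂ q h1] at hq'
      rw [H.overlap₂ q h1]
      exact left_ne_zero_of_mul hq'
  have mem₂ : ∀ q, π q ∈ cn.source → (cn (π q)).2 ≠ 0 → q ∈ e₂.source := by
    intro q hq hq'
    rcases (H.source q).2 hq with h1 | h1
    · rw [H.eq₁ q h1] at hq'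
      rw [H.overlap₁ q h1]
      exact right_ne_zero_of_mul hq'
    · exact h1
  refine ⟨b', ⟨H.mem₂, H.target₂, fun k hk => ?_, fun k hk => ?_,
    fun q hq => h.cn_sub _ (sub₂ q hq), fun q hq => ?_,
    fun k hk q hq => ?_, fun k hk q hq => ?_,
    fun q hq hq' => ?_, fun q hq hq' => ?_, fun k hk q hq => ?_,
    fun k hk q hq hq' => ?_, fun k hk q hq => ?_, fun k l hk hl q hq hq' => ?_,
    fun k hk q hq => ?_, fun k hk q hq hq' => ?_, fun k hk q hq => ?_, fun k hk q hq hq' => ?_⟩⟩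
  · rcases split hk with hk | rfl
    · exact m k hk
    · rw [bn]; exact H.mem₁
  · rcases split hk with hk | rfl
    · rw [t k hk, h.b_target k hk]
    · rw [bn]; exact H.target₁
  · have h1 := h.cn_eq _ (sub₂ q hq)
    rw [H.eq₂ q hq] at h1
    rw [h1, pow_succ']
    simp only [mul_assoc]
  · rcases split hk with hk | rfl
    · exact h.b_sub k hk _ ((ms k hk q).1 hq)
    · rw [bn] at hq
      exact h.cn_sub _ (sub₁ q hq)
  · rcases split hk with hk | rfl
    · rw [f k hk]
      exact h.b_eq k hk _ ((ms k hk q).1 hq)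
    · rw [bn] at hq ⊢
      have h1 := h.cn_eq _ (sub₁ q hq)
      rw [H.eq₁ q hq] at h1
      exact h1
  · have h1 := h.mem_cn _ hq hq'
    refine mem₂ q h1 ?_
    rw [h.cn_eq _ h1] at hq'
    exact hq'
  · rcases h.cover _ hq hq' with ⟨h1, h2⟩ | ⟨k, hk, h1, h2⟩
    · by_cases h3 : q ∈ e₁.source
      · refine Or.inr ⟨n, by omega, bn ▸ h3, ?_⟩
        rw [H.eq₁ q h3] at h2
        rw [bn]
        exact congrArg Prod.fst h2
      · have h4 := ((H.source q).2 h1).resolve_left h3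
        refine Or.inl ⟨h4, ?_⟩
        rw [H.eq₂ q h4] at h2
        have h5 := (H.overlap₂ q h4).not.1 h3
        exact Prod.ext (not_not.1 h5) (Prod.ext_iff.1 h2).2
    · exact Or.inr ⟨k, by omega, (ms k hk q).2 h1, by rw [f k hk, h2]⟩
  · have hk' : k < n := by omega
    rw [f k hk']
    have hq' := (ms k hk' q).1 hq
    rcases split hk with hk | hk
    · rw [ms _ hk]
      exact h.b_succ k hk _ hq'
    · rw [hk, bn, ← h.b_cn k hk _ hq']
      refine ⟨sub₁ q, fun h1 => mem₁ q h1 ?_⟩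
      have h2 := (h.b_cn k hk _ hq').1 h1
      rw [h.b_cn_eq k hk _ hq' h2]
      exact inv_ne_zero h2
  · have hk' : k < n := by omega
    have hqb := (ms k hk' q).1 hq
    rw [f k hk'] at hq' ⊢
    rcases split hk with hk | hk
    · rw [f _ hk]
      exact h.b_succ_eq k hk _ hqb hq'
    · have h1 := (h.b_cn k hk _ hqb).2 hq'
      have h2 := h.b_cn_eq k hk _ hqb hq'
      have h3 := mem₁ q h1 (by rw [h2]; exact inv_ne_zero hq')
      rw [H.eq₁ q h3, Prod.mk.injEq] at h2
      rw [hk, bn]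
      refine Prod.ext h2.1 ?_
      have h4 := h2.2
      rw [h2.1] at h4
      field_simp at h4
      simpa [mul_comm] using h4
  · have hk' : k < n := by omega
    rw [ms k hk']
    rcases split hk with hk | hk
    · rw [f _ hk]
      exact h.succ_b k hk _ ((ms _ hk q).1 hq)
    · rw [hk, bn] at hq ⊢
      rw [h.cn_b k hk _ (sub₁ q hq), H.eq₁ q hq]
  · have hk' : k < n := by omega
    have hqb := (ms k hk' q).1 hq
    rcases split hl with hl | rfl
    · exact h.b_far k l hk hl _ hqb ((ms l hl q).1 hq')
    · rw [bn] at hq'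
      exact h.far_cn k hk _ hqb (sub₁ q hq')
  · obtain rfl : k = n := by omega
    rw [bn] at hq ⊢
    exact H.overlap₁ q hq
  · obtain rfl : k = n := by omega
    rw [bn] at hq hq' ⊢
    have h1 := (H.overlap₁ q hq).2 hq'
    have h2 := H.mul_eq_one q ⟨hq, h1⟩
    have h3 := H.eq₁ q hq
    rw [H.eq₂ q h1] at h3
    exact Prod.ext (eq_inv_of_mul_eq_one_right h2) (Prod.ext_iff.1 h3).2
  · obtain rfl : k = n := by omega
    rw [bn]
    exact H.overlap₂ q hq
  · have hk' : k < n := by omega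
    have hqb := (ms k hk' q).1 hq
    -- In the case `k + 1 = n` the old charts `b k` and `cn` do meet over `F = 0`. But on `b k` the
    -- first coordinate of `cn`, which is `u v` in the new chart `(u, v)`, is nonzero, whereas `F =
    -- 0` forces `v = 0`.
    rcases Nat.lt_or_ge (k + 1) n with h1 | h1
    · exact h.far_cn k h1 _ hqb (sub₂ q hq')
    · intro hF
      have h2 := (h.cn_b k (by omega) _ (sub₂ q hq')).1 hqb
      rw [h.cn_eq _ (sub₂ q hq'), H.eq₂ q hq'] at hF
      rw [H.eq₂ q hq'] at h2
      exact right_ne_zero_of_mul h2 (congrArg Prod.snd hF)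

/-- Up to four blow-ups of the end point of a curve `X = s ^ 4 * g s`, `y = s`. -/
theorem exists_tower {S : MarkedSurface} {c : OpenPartialHomeomorph S (ℂ × ℂ)} (hc : c ∈ Coord S)
    (ht : c.target = univ) (hp : ∀ z, S.patch z ≠ c.symm 0) {γ : ℂ → ℂ × ℂ} {g : ℂ → ℂ} {g₀ : ℂ}
    (hg : Tendsto g (𝓝[≠] 0) (𝓝 g₀))
    (hγ : ∀ᶠ s in 𝓝[≠] 0, S.patch (γ s) = c.symm (s ^ 4 * g s, s)) (n : ℕ) (hn : n ≤ 4) :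
    ∃ (S' : MarkedSurface) (π : S' → S) (b : ℕ → OpenPartialHomeomorph S' (ℂ × ℂ))
      (cn : OpenPartialHomeomorph S' (ℂ × ℂ)),
      IsTower S' (π ⁻¹' c.source) (fun q => c (π q)) n b cn ∧ IsModif π {c.symm 0} ∧
      ∀ l N, Arises l S' N → Arises (List.replicate n (.blowUp γ) ++ l) S N := by
  induction n with
  | zero => exact ⟨S, fun q => q, _, c, isTower_zero hc ht, isModif_id S _, fun l N h => h⟩
  | succ n ih =>
    obtain ⟨S₁, π₁, b, cn, hT, hM, hA⟩ := ih (by omega)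
    have hcu : ∀ z, z ∈ c.target := fun z => by simp [ht]
    have h0 : π₁ (cn.symm 0) = c.symm 0 := by
      rw [← c.left_inv hT.cn_zero.1]
      exact congrArg c.symm hT.cn_zero.2
    obtain ⟨S₂, π₂, e₁, e₂, H⟩ := exists_isStdBlowUp S₁ hT.cn_mem hT.cn_target fun z hz => by
      apply hp z
      rw [← hM.patch, hz, h0]
    obtain ⟨b', hT'⟩ := hT.step H
    refine ⟨S₂, fun q => π₁ (π₂ q), b', e₂, hT', hM.comp H.isModif le_rfl ?_, fun l N h => ?_⟩
    · rintro _ rfl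
      exact h0
    · rw [List.replicate_succ', List.append_assoc]
      refine hA _ N ⟨S₂, ⟨cn.symm 0, ?_, H.isBlowUp⟩, h⟩
      -- In the coordinates `(X / yⁿ, y)` the curve is `(s ^ (4 - n) * g s, s)`. It tends to the
      -- origin as long as `n ≤ 3`, which allows four blow-ups along the curve.
      have h1 : Tendsto (fun s : ℂ => ((s ^ (4 - n) * g s, s) : ℂ × ℂ)) (𝓝[≠] 0) (𝓝 0) := by
        have h2 : Tendsto (fun s : ℂ => s) (𝓝[≠] 0) (𝓝 0) := tendsto_id'.2 nhdsWithin_le_nhds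
        refine Tendsto.prodMk_nhds ?_ h2
        have h3 := (h2.pow (4 - n)).mul hg
        rwa [zero_pow (by omega), zero_mul] at h3
      refine ((cn.symm.continuousAt (by simp [hT.cn_target])).tendsto.comp h1).congr' ?_
      filter_upwards [hγ, self_mem_nhdsWithin] with s hs hs0
      have hs0 : s ≠ 0 := hs0
      have h2 : π₁ (S₁.patch (γ s)) = c.symm (s ^ 4 * g s, s) := by rw [hM.patch, hs]
      have h3 : S₁.patch (γ s) ∈ π₁ ⁻¹' c.source := by
        rw [mem_preimage, h2]; exact c.map_target (hcu _)
      have h4 : c (π₁ (S₁.patch (γ s))) = (s ^ 4 * g s, s) := by rw [h2, c.right_inv (hcu _)]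
      have h5 := hT.mem_cn _ h3 (by rw [h4]; exact hs0)
      have h6 := hT.cn_eq _ h5
      rw [h4, Prod.mk.injEq] at h6
      rw [Function.comp_apply, ← cn.left_inv h5]
      congr 1
      refine Prod.ext ?_ h6.2
      have h7 := h6.1
      rw [← h6.2] at h7
      simp only
      refine mul_right_cancel₀ (pow_ne_zero n hs0) ?_
      rw [← h7, mul_right_comm, ← pow_add]
      congr 2
      omega

/-! ### Derivatives of maps of the plane -/

/-- The linear map of the plane with the given matrix. -/
def planeMap (a b c d : ℂ) : ℂ × ℂ →L[ℂ] ℂ × ℂ :=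
  (a • ContinuousLinearMap.fst ℂ ℂ ℂ + b • ContinuousLinearMap.snd ℂ ℂ ℂ).prod
    (c • ContinuousLinearMap.fst ℂ ℂ ℂ + d • ContinuousLinearMap.snd ℂ ℂ ℂ)

theorem det_planeMap (a b c d : ℂ) : (planeMap a b c d).det = a * d - b * c := by
  have h : (planeMap a b c d : ℂ × ℂ →ₗ[ℂ] ℂ × ℂ) =
      Matrix.toLin (Module.Basis.finTwoProd ℂ) (Module.Basis.finTwoProd ℂ) !![a, b; c, d] := by
    refine LinearMap.ext fun z => ?_
    simp [planeMap, Matrix.toLin_finTwoProd_apply]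
  rw [ContinuousLinearMap.det, h, LinearMap.det_toLin, Matrix.det_fin_two_of]

theorem hasFDerivAt_planeMap {f g : ℂ × ℂ → ℂ} {z : ℂ × ℂ} {f' g' : ℂ × ℂ →L[ℂ] ℂ} {a b c d : ℂ}
    (hf : HasFDerivAt f f' z) (hg : HasFDerivAt g g' z) (ha : f' (1, 0) = a) (hb : f' (0, 1) = b)
    (hc : g' (1, 0) = c) (hd : g' (0, 1) = d) :
    HasFDerivAt (fun z => (f z, g z)) (planeMap a b c d) z := by
  have key : ∀ (l : ℂ × ℂ →L[ℂ] ℂ) (u v : ℂ), l (1, 0) = u → l (0, 1) = v →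
      l = u • ContinuousLinearMap.fst ℂ ℂ ℂ + v • ContinuousLinearMap.snd ℂ ℂ ℂ := by
    rintro l _ _ rfl rfl
    ext <;> simp
  rw [planeMap, ← key f' a b ha hb, ← key g' c d hc hd]
  exact hf.prodMk hg

/-- The chain rule for determinants. -/
theorem det_fderiv_mul {f P Q : ℂ × ℂ → ℂ × ℂ} {w : ℂ × ℂ} {P' Q' : ℂ × ℂ →L[ℂ] ℂ × ℂ}
    (hf : DifferentiableAt ℂ f w) (hP : HasFDerivAt P P' (f w)) (hQ : HasFDerivAt Q Q' w)
    (h : ∀ᶠ w' in 𝓝 w, P (f w') = Q w') : (fderiv ℂ f w).det * P'.det = Q'.det := by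
  have h1 := (hP.comp w hf.hasFDerivAt).congr_of_eventuallyEq (h.mono fun _ h => h.symm)
  rw [hQ.unique h1, mul_comm]
  exact (LinearMap.det_comp _ _).symm

theorem differentiableAt_coord_patch {M : MarkedSurface} {e : OpenPartialHomeomorph M (ℂ × ℂ)}
    (he : e ∈ Coord M) {w : ℂ × ℂ} (hw : M.patch w ∈ e.source) :
    DifferentiableAt ℂ (fun w' => e (M.patch w')) w ∧ ∀ᶠ w' in 𝓝 w, M.patch w' ∈ e.source := by
  obtain ⟨A, hA, tA, pA⟩ := M.isPatch
  have hU : IsOpen (A.target ∩ A.symm ⁻¹' e.source) := A.symm.isOpen_inter_preimage e.open_source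
  have hm : A.target ∩ A.symm ⁻¹' e.source ∈ 𝓝 w :=
    hU.mem_nhds ⟨by simp [tA], by rw [mem_preimage, pA]; exact hw⟩
  have h := contDiffOn_coord_change (s := A.target ∩ A.symm ⁻¹' e.source) hA he
    inter_subset_left fun z hz => hz.2
  simp only [pA] at h
  refine ⟨(h.contDiffAt hm).differentiableAt (by simp), ?_⟩
  filter_upwards [hm] with w' hw'
  rw [← pA]
  exact hw'.2

/-! ### Swapping and restricting coordinates -/

section Swap

variable {S : Type} [TopologicalSpace S] [ChartedSpace (ℂ × ℂ) S]
  [IsManifold 𝓘(ℂ, ℂ × ℂ) ω S]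

theorem exists_coord_swap {e : OpenPartialHomeomorph S (ℂ × ℂ)} (he : e ∈ Coord S)
    (hu : e.target = univ) :
    ∃ e' ∈ Coord S, e'.source = e.source ∧ e'.target = univ ∧
      (∀ q, e' q = ((e q).2, (e q).1)) ∧ ∀ z, e'.symm z = e.symm (z.2, z.1) := by
  have cswap : ContDiffOn ℂ ω (fun z : ℂ × ℂ => (z.2, z.1)) univ :=
    (contDiff_snd.prodMk contDiff_fst).contDiffOn
  obtain ⟨e', he', s', t', f', i'⟩ := exists_coord_comp he hu (s := univ) (t := univ)
    (f := fun z => (z.2, z.1)) (g := fun z => (z.2, z.1)) isOpen_univ isOpen_univ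
    (fun _ _ => trivial) (fun _ _ => trivial) (fun _ _ => rfl) (fun _ _ => rfl) cswap cswap
  exact ⟨e', he', ext fun q => (s' q).trans (and_iff_left trivial), t', f', i'⟩

theorem exists_coord_restrict {e : OpenPartialHomeomorph S (ℂ × ℂ)} (he : e ∈ Coord S)
    (hu : e.target = univ) {s : Set (ℂ × ℂ)} (hs : IsOpen s) :
    ∃ e' ∈ Coord S, (∀ q, q ∈ e'.source ↔ q ∈ e.source ∧ e q ∈ s) ∧ e'.target = s ∧
      ∀ q, e' q = e q := by
  obtain ⟨e', he', s', t', f', -⟩ := exists_coord_comp he hu (s := s) (t := s) (f := id) (g := id)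
    hs hs (fun _ h => h) (fun _ h => h) (fun _ _ => rfl) (fun _ _ => rfl) contDiffOn_id
    contDiffOn_id
  exact ⟨e', he', s', t', f'⟩

theorem MeetOnce.symm {C C' : Set S} (h : MeetOnce C C') : MeetOnce C' C := by
  obtain ⟨q, hq, e, he, hqe, h⟩ := h
  have cswap : ContDiff ℂ ω (fun z : ℂ × ℂ => (z.2, z.1)) := contDiff_snd.prodMk contDiff_fst
  let e' := e.trans (Homeomorph.prodComm ℂ ℂ).toOpenPartialHomeomorph
  have hs : e'.source = e.source := by simp [e']
  have he' : e' ∈ Coord S := by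
    refine mem_coord_iff.2 ⟨?_, ?_⟩
    · rw [hs]
      exact (contMDiffOn_iff_contDiffOn.2 cswap.contDiffOn).comp (mem_coord_iff.1 he).1
        (t := univ) fun _ _ => trivial
    · refine (mem_coord_iff.1 he).2.comp (contMDiffOn_iff_contDiffOn.2 cswap.contDiffOn) ?_
      intro z hz
      simpa [e'] using hz
  refine ⟨q, by rw [inter_comm, hq], e', he', hs ▸ hqe, fun w hw => ?_⟩
  rw [hs] at hw
  exact ⟨(h w hw).2, (h w hw).1⟩

end Swap

/-! ### Local equations of an anticanonical divisor -/

/-- A function that is a coordinate or a constant `≠ 0`, as local equation. -/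
def IsSimpleEq (g : ℂ × ℂ → ℂ) : Prop :=
  Differentiable ℂ g ∧ ∀ z, g z = 0 → fderiv ℂ g z ≠ 0

theorem isSimpleEq_fst : IsSimpleEq Prod.fst :=
  ⟨differentiable_fst, fun z _ h => by
    rw [fderiv_fst] at h
    simpa using congrArg (fun l : ℂ × ℂ →L[ℂ] ℂ => l (1, 0)) h⟩

theorem isSimpleEq_snd : IsSimpleEq Prod.snd :=
  ⟨differentiable_snd, fun z _ h => by
    rw [fderiv_snd] at h
    simpa using congrArg (fun l : ℂ × ℂ →L[ℂ] ℂ => l (0, 1)) h⟩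

theorem isSimpleEq_one : IsSimpleEq fun _ => 1 :=
  ⟨differentiable_const _, fun _ h => (one_ne_zero h).elim⟩

/-- The condition at `q` that `∑ mᵢ Dᵢ` is the pole divisor of the extension of `dx ∧ dy`. -/
def IsAnticanonicalAt (M : MarkedSurface) {ι : Type} [Fintype ι] (D : ι → Set M) (m : ι → ℕ)
    (q : M) : Prop :=
  ∃ e ∈ Coord M, q ∈ e.source ∧ ∃ (h : ℂ × ℂ → ℂ) (f : ι → ℂ × ℂ → ℂ),
    DifferentiableOn ℂ h e.target ∧ (∀ z ∈ e.target, h z ≠ 0) ∧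
    (∀ i, DifferentiableOn ℂ (f i) e.target ∧ ∀ z ∈ e.target,
      (f i z = 0 ↔ e.symm z ∈ D i) ∧ (f i z = 0 → fderiv ℂ (f i) z ≠ 0)) ∧
    ∀ w : ℂ × ℂ, M.patch w ∈ e.source →
      (fderiv ℂ (fun w' => e (M.patch w')) w).det * h (e (M.patch w)) =
        ∏ i, f i (e (M.patch w)) ^ m i

/-- At most two boundary curves pass through a point; the others receive the local equation `1`.
Since `g₁` and `g₂` may themselves be the constant `1`, this also serves for points on one curve or
on none. -/
theorem isAnticanonicalAt_of_two {M : MarkedSurface} {ι : Type} [Fintype ι] {D : ι → Set M}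
    {m : ι → ℕ} {q : M} {e : OpenPartialHomeomorph M (ℂ × ℂ)} (he : e ∈ Coord M)
    (hq : q ∈ e.source) {i j : ι} (hij : i ≠ j) {h g₁ g₂ : ℂ × ℂ → ℂ}
    (hd : DifferentiableOn ℂ h e.target) (h0 : ∀ z ∈ e.target, h z ≠ 0) (hg₁ : IsSimpleEq g₁)
    (hg₂ : IsSimpleEq g₂) (hi : ∀ q ∈ e.source, q ∈ D i ↔ g₁ (e q) = 0)
    (hj : ∀ q ∈ e.source, q ∈ D j ↔ g₂ (e q) = 0)
    (hk : ∀ k, k ≠ i → k ≠ j → ∀ q ∈ e.source, q ∉ D k)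
    (hdet : ∀ w, M.patch w ∈ e.source →
      (fderiv ℂ (fun w' => e (M.patch w')) w).det * h (e (M.patch w)) =
        g₁ (e (M.patch w)) ^ m i * g₂ (e (M.patch w)) ^ m j) : IsAnticanonicalAt M D m q := by
  classical
  let f : ι → ℂ × ℂ → ℂ := fun k => if k = i then g₁ else if k = j then g₂ else fun _ => 1
  have fi : f i = g₁ := if_pos rfl
  have fj : f j = g₂ := (if_neg hij.symm).trans (if_pos rfl)
  have fk : ∀ k, k ≠ i → k ≠ j → f k = fun _ => 1 := fun k h h' => (if_neg h).trans (if_neg h')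
  refine ⟨e, he, hq, h, f, hd, h0, fun k => ?_, fun w hw => ?_⟩
  · have hs : ∀ z ∈ e.target, ∀ k (g : ℂ × ℂ → ℂ), (∀ q ∈ e.source, q ∈ D k ↔ g (e q) = 0) →
        (g z = 0 ↔ e.symm z ∈ D k) := fun z hz k g h => by
      rw [h _ (e.map_target hz), e.right_inv hz]
    by_cases h1 : k = i
    · rw [h1, fi]
      exact ⟨hg₁.1.differentiableOn, fun z hz => ⟨hs z hz i g₁ hi, hg₁.2 z⟩⟩
    · by_cases h2 : k = j
      · rw [h2, fj]
        exact ⟨hg₂.1.differentiableOn, fun z hz => ⟨hs z hz j g₂ hj, hg₂.2 z⟩⟩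
      · rw [fk k h1 h2]
        refine ⟨isSimpleEq_one.1.differentiableOn, fun z hz => ⟨?_, isSimpleEq_one.2 z⟩⟩
        exact iff_of_false one_ne_zero (hk k h1 h2 _ (e.map_target hz))
  · rw [Fintype.prod_eq_mul i j hij fun k hk => by rw [fk k hk.1 hk.2, one_pow], fi, fj, hdet w hw]

/-! ### The boundary curves in a tower -/

section TowerCurves

variable {M : MarkedSurface} {O : Set M} {F : M → ℂ × ℂ}
  {b : ℕ → OpenPartialHomeomorph M (ℂ × ℂ)} {cn : OpenPartialHomeomorph M (ℂ × ℂ)}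

/-- The strict transform of the `j`-th exceptional curve of a tower. -/
def excCurve (b : ℕ → OpenPartialHomeomorph M (ℂ × ℂ)) (j : ℕ) : Set M :=
  {q | (q ∈ (b j).source ∧ (b j q).1 = 0) ∨ (q ∈ (b (j + 1)).source ∧ b (j + 1) q = 0)}

theorem IsTower.excCurve_sub (h : IsTower M O F 4 b cn) {j : ℕ} (hj : j + 1 < 4) {q : M}
    (hq : q ∈ excCurve b j) : q ∈ O ∧ F q = 0 := by
  rcases hq with ⟨hq, h0⟩ | ⟨hq, h0⟩
  · refine ⟨h.b_sub j (by omega) q hq, ?_⟩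
    rw [h.b_eq j (by omega) q hq, h0]
    simp
  · refine ⟨h.b_sub _ hj q hq, ?_⟩
    rw [h.b_eq _ hj q hq, h0]
    simp

theorem IsTower.mem_excCurve_iff (h : IsTower M O F 4 b cn) {j : ℕ} (hj : j + 1 < 4) {q : M}
    (hq : q ∈ (b j).source) : q ∈ excCurve b j ↔ (b j q).1 = 0 := by
  refine ⟨?_, fun h0 => Or.inl ⟨hq, h0⟩⟩
  rintro (⟨-, h0⟩ | ⟨hq', h0⟩)
  · exact h0
  · exact absurd (congrArg Prod.fst h0) ((h.succ_b j hj q hq').1 hq)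

/-- With `(u, v) = b j` one has `b (j + 1) = (v⁻¹, u v ^ 2)`, so the curve `u = 0` turns into the
zero set of the second coordinate, completed by the origin. -/
theorem IsTower.mem_excCurve_iff' (h : IsTower M O F 4 b cn) {j : ℕ} (hj : j + 1 < 4) {q : M}
    (hq : q ∈ (b (j + 1)).source) : q ∈ excCurve b j ↔ (b (j + 1) q).2 = 0 := by
  constructor
  · rintro (⟨hq', h0⟩ | ⟨-, h0⟩)
    · rw [h.b_succ_eq j hj q hq' ((h.b_succ j hj q hq').1 hq), h0, zero_mul]
    · exact congrArg Prod.snd h0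
  · intro h0
    by_cases h1 : (b (j + 1) q).1 = 0
    · exact Or.inr ⟨hq, Prod.ext h1 h0⟩
    · have hq' := (h.succ_b j hj q hq).2 h1
      have h2 := (h.b_succ j hj q hq').1 hq
      rw [h.b_succ_eq j hj q hq' h2] at h0
      exact Or.inl ⟨hq', (mul_eq_zero.1 h0).resolve_right (pow_ne_zero 2 h2)⟩

/-- The exceptional curves lie over `F = 0`, where charts whose indices differ by two or more do not
meet. For neighbouring indices the overlap condition excludes the axis in question. The same
argument handles larger indices and `cn`. -/
theorem IsTower.notMem_excCurve_of_lt (h : IsTower M O F 4 b cn) {j l : ℕ} (hj : j + 1 < 4)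
    (hl : l < j) {q : M} (hq : q ∈ (b l).source) : q ∉ excCurve b j := by
  intro hE
  have hF := (h.excCurve_sub hj hE).2
  rcases hE with ⟨hq', h0⟩ | ⟨hq', h0⟩
  · rcases Nat.lt_or_ge (l + 1) j with h1 | h1
    · exact h.b_far l j h1 (by omega) q hq hq' hF
    · obtain rfl : j = l + 1 := by omega
      exact (h.succ_b l (by omega) q hq').1 hq h0
  · exact h.b_far l (j + 1) (by omega) hj q hq hq' hF

theorem IsTower.notMem_excCurve_of_gt (h : IsTower M O F 4 b cn) {j l : ℕ} (hl : j + 2 ≤ l)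
    (hl' : l < 4) {q : M} (hq : q ∈ (b l).source) : q ∉ excCurve b j := by
  intro hE
  have hF := (h.excCurve_sub (by omega) hE).2
  rcases hE with ⟨hq', h0⟩ | ⟨hq', h0⟩
  · exact h.b_far j l hl hl' q hq' hq hF
  · rcases Nat.lt_or_ge (j + 2) l with h1 | h1
    · exact h.b_far (j + 1) l h1 hl' q hq' hq hF
    · obtain rfl : l = j + 1 + 1 := by omega
      exact (h.b_succ (j + 1) hl' q hq').1 hq (congrArg Prod.snd h0)

theorem IsTower.notMem_excCurve_cn (h : IsTower M O F 4 b cn) {j : ℕ} (hj : j + 1 < 4)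
    {q : M} (hq : q ∈ cn.source) : q ∉ excCurve b j := by
  intro hE
  have hF := (h.excCurve_sub (by omega) hE).2
  rcases hE with ⟨hq', h0⟩ | ⟨hq', h0⟩
  · exact h.far_cn j (by omega) q hq' hq hF
  · rcases Nat.lt_or_ge (j + 2) 4 with h1 | h1
    · exact h.far_cn (j + 1) (by omega) q hq' hq hF
    · exact (h.b_cn (j + 1) (by omega) q hq').1 hq (congrArg Prod.snd h0)

/-- The last exceptional curve is not in the boundary: it splits into its point on the third one,
the origin of `b 3`, and the affine line `y = 0` of `cn`. -/
theorem IsTower.excCurve_cases (h : IsTower M O F 4 b cn) {q : M} (hq : q ∈ O) (hF : F q = 0) :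
    (∃ j < 3, q ∈ (b j).source ∧ (b j q).1 = 0) ∨ (q ∈ (b 3).source ∧ b 3 q = 0) ∨
      (q ∈ cn.source ∧ (cn q).2 = 0) := by
  rcases h.cover q hq hF with ⟨hc, h0⟩ | ⟨k, hk, hb, h0⟩
  · exact Or.inr (Or.inr ⟨hc, congrArg Prod.snd h0⟩)
  · rcases Nat.lt_or_ge k 3 with h1 | h1
    · exact Or.inl ⟨k, h1, hb, h0⟩
    · obtain rfl : k = 3 := by omega
      by_cases h2 : (b 3 q).2 = 0
      · exact Or.inr (Or.inl ⟨hb, Prod.ext h0 h2⟩)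
      · refine Or.inr (Or.inr ⟨(h.b_cn 3 rfl q hb).2 h2, ?_⟩)
        rw [h.b_cn_eq 3 rfl q hb h2, h0, zero_mul]

/-- The change `(u, v) ↦ (v⁻¹, u v ^ 2)` from `b j` to `b (j + 1)` multiplies the normal coordinate
`u` by `ζ ^ 2` with `ζ = v`, which is self-intersection `-2`: an exceptional curve blown up once
more at one of its points. For the last curve the change to `cn` is `(v⁻¹, u v)` and gives `-1`;
hence the restriction `j + 1 < 4`. -/
theorem IsTower.isRationalCurve_excCurve (h : IsTower M O F 4 b cn) {j : ℕ} (hj : j + 1 < 4) :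
    IsRationalCurve (excCurve b j) (-2) := by
  have hu : ∀ z, z ∈ (b j).target := fun z => by simp [h.b_target j (by omega)]
  have hu' : ∀ z, z ∈ (b (j + 1)).target := fun z => by simp [h.b_target _ hj]
  obtain ⟨e, he, hs, ht, hv, hi⟩ := exists_coord_swap (h.b_mem j (by omega))
    (h.b_target j (by omega))
  refine ⟨e, he, b (j + 1), h.b_mem _ hj, fun ζ => by simp [ht], hu' _, ?_, fun q hq => ?_,
    fun q hq => h.mem_excCurve_iff' hj hq, fun ζ hζ => ?_⟩
  · rintro q (⟨hq, -⟩ | ⟨hq, h0⟩)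
    · exact Or.inr (hs ▸ hq)
    · left
      rw [← (b (j + 1)).left_inv hq, h0]
      rfl
  · rw [hv, h.mem_excCurve_iff hj (hs ▸ hq)]
  · simp only [hi] at hζ ⊢
    have h1 : ∀ s, (b j).symm (s, ζ) ∈ (b j).source := fun s => (b j).map_target (hu _)
    have h2 : ∀ s, b j ((b j).symm (s, ζ)) = (s, ζ) := fun s => (b j).right_inv (hu _)
    have h3 : ζ ≠ 0 := by
      have := (h.b_succ j hj _ (h1 0)).1 hζ
      rwa [h2] at this
    have h4 : ∀ s, b (j + 1) ((b j).symm (s, ζ)) = (ζ⁻¹, s * ζ ^ 2) := fun s => by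
      rw [h.b_succ_eq j hj _ (h1 s) (by rwa [h2]), h2]
    simp only [h4]
    refine ⟨inv_mul_cancel₀ h3, ?_⟩
    have h5 := (hasDerivAt_id (0 : ℂ)).mul_const (ζ ^ 2)
    simpa using h5

/-- Both curves are axes of the chart `b (j + 1)`, and the only point of the later curve outside
this chart, the origin of `b (j + 2)`, is not on the earlier one. -/
theorem IsTower.meetOnce_excCurve (h : IsTower M O F 4 b cn) {j : ℕ} (hj : j + 2 < 4) :
    MeetOnce (excCurve b (j + 1)) (excCurve b j) := by
  have hu : (0 : ℂ × ℂ) ∈ (b (j + 1)).target := by simp [h.b_target (j + 1) (by omega)]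
  have h1 := (b (j + 1)).map_target hu
  have h2 := (b (j + 1)).right_inv hu
  refine ⟨(b (j + 1)).symm 0, Subset.antisymm ?_ ?_, b (j + 1), h.b_mem _ (by omega), h1,
    fun w hw => ⟨h.mem_excCurve_iff (by omega) hw, h.mem_excCurve_iff' (by omega) hw⟩⟩
  · rintro q ⟨hq, hq'⟩
    have hb : q ∈ (b (j + 1)).source := by
      rcases hq with ⟨hb, -⟩ | ⟨hb, -⟩
      · exact hb
      · exact absurd hq' (h.notMem_excCurve_of_gt (l := j + 1 + 1) (by omega) (by omega) hb)
    have h3 : b (j + 1) q = 0 := Prod.ext ((h.mem_excCurve_iff (by omega) hb).1 hq)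
      ((h.mem_excCurve_iff' (by omega) hb).1 hq')
    rw [mem_singleton_iff, ← h3, (b (j + 1)).left_inv hb]
  · rintro _ rfl
    exact ⟨(h.mem_excCurve_iff (by omega) h1).2 (by rw [h2]; rfl),
      (h.mem_excCurve_iff' (by omega) h1).2 (by rw [h2]; rfl)⟩

theorem IsTower.disjoint_excCurve (h : IsTower M O F 4 b cn) :
    Disjoint (excCurve b 0) (excCurve b 2) := by
  refine disjoint_left.2 fun q hq hq' => ?_
  rcases hq' with ⟨hb, -⟩ | ⟨hb, -⟩
  · exact h.notMem_excCurve_of_gt (l := 2) le_rfl (by omega) hb hq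
  · exact h.notMem_excCurve_of_gt (l := 3) (by omega) (by omega) hb hq

end TowerCurves

/-! ### One side of the boundary -/

/-- With `z = (x⁻¹ - a y ^ 2 - b y ^ 3, y)` this is `x⁻¹`. -/
def lineEq (a b : ℂ) (z : ℂ × ℂ) : ℂ := z.1 + a * z.2 ^ 2 + b * z.2 ^ 3

/-- A tower over the point `(x⁻¹, y) = 0`, where `(x, y) = sp` on the distinguished patch, together
with the coordinate system `d = (x⁻¹, y⁻¹)`. -/
structure IsSide (M : MarkedSurface) (sp : ℂ × ℂ → ℂ × ℂ) (a c ε : ℂ) (O : Set M)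
    (F : M → ℂ × ℂ) (b : ℕ → OpenPartialHomeomorph M (ℂ × ℂ))
    (cn d : OpenPartialHomeomorph M (ℂ × ℂ)) : Prop where
  a_ne : a ≠ 0
  ε_ne : ε ≠ 0
  tower : IsTower M O F 4 b cn
  d_mem : d ∈ Coord M
  d_target : d.target = univ
  d_O : ∀ q ∈ d.source, q ∈ O ↔ (d q).2 ≠ 0
  d_fst : ∀ q ∈ d.source, q ∈ O → (d q).1 = lineEq a c (F q)
  d_snd : ∀ q ∈ d.source, q ∈ O → (F q).2 = (d q).2⁻¹
  O_d : ∀ q ∈ O, (F q).2 ≠ 0 → q ∈ d.source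
  patch_O : ∀ z, M.patch z ∈ O ↔ (sp z).1 ≠ 0
  patch_fst : ∀ z, M.patch z ∈ O → lineEq a c (F (M.patch z)) = (sp z).1⁻¹
  patch_snd : ∀ z, M.patch z ∈ O → (F (M.patch z)).2 = (sp z).2
  patch_d : ∀ z, M.patch z ∈ d.source → (sp z).1 ≠ 0 ∧ (sp z).2 ≠ 0
  det : ∀ w, (sp w).1 ≠ 0 → ∃ Q', HasFDerivAt (fun w => ((sp w).1⁻¹, (sp w).2)) Q' w ∧
    Q'.det = ε * ((sp w).1⁻¹) ^ 2

/-- The strict transform of the line at infinity. -/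
def lineCurve {M : MarkedSurface} (a : ℂ) (b : ℕ → OpenPartialHomeomorph M (ℂ × ℂ))
    (d : OpenPartialHomeomorph M (ℂ × ℂ)) : Set M :=
  {q | (q ∈ d.source ∧ (d q).1 = 0) ∨ (q ∈ (b 2).source ∧ b 2 q = (-a, 0))}

/-! ### The line at infinity of one side, in the charts of the tower -/

namespace IsSide

variable {M : MarkedSurface} {sp : ℂ × ℂ → ℂ × ℂ} {a c ε : ℂ} {O : Set M}
    {F : M → ℂ × ℂ} {b : ℕ → OpenPartialHomeomorph M (ℂ × ℂ)}
    {cn d : OpenPartialHomeomorph M (ℂ × ℂ)}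

theorem snd_ne (h : IsSide M sp a c ε O F b cn d) {q : M} (hq : q ∈ d.source) (hO : q ∈ O) :
    (F q).2 ≠ 0 := by
  rw [h.d_snd q hq hO]
  exact inv_ne_zero ((h.d_O q hq).1 hO)

theorem patch_notMem_of_zero (h : IsSide M sp a c ε O F b cn d) {z : ℂ × ℂ}
    (hO : M.patch z ∈ O) : F (M.patch z) ≠ 0 := by
  intro h0
  have h1 := h.patch_fst z hO
  rw [h0] at h1
  exact inv_ne_zero ((h.patch_O z).1 hO) (by simpa [lineEq] using h1.symm)

theorem notMem_excCurve_of_d (h : IsSide M sp a c ε O F b cn d) {j : ℕ} (hj : j + 1 < 4) {q : M}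
    (hq : q ∈ d.source) : q ∉ excCurve b j := fun hE =>
  h.snd_ne hq (h.tower.excCurve_sub hj hE).1 (by rw [(h.tower.excCurve_sub hj hE).2]; rfl)

theorem b2_zero (h : IsSide M sp a c ε O F b cn d) {q : M} (hq : q ∈ (b 2).source)
    (h0 : b 2 q = (-a, 0)) : q ∈ O ∧ F q = 0 := by
  refine ⟨h.tower.b_sub 2 (by omega) q hq, ?_⟩
  rw [h.tower.b_eq 2 (by omega) q hq, h0]
  simp

theorem patch_notMem_excCurve (h : IsSide M sp a c ε O F b cn d) {j : ℕ} (hj : j + 1 < 4)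
    (z : ℂ × ℂ) : M.patch z ∉ excCurve b j := fun hE =>
  h.patch_notMem_of_zero (h.tower.excCurve_sub hj hE).1 (h.tower.excCurve_sub hj hE).2

theorem mem_lineCurve_d (h : IsSide M sp a c ε O F b cn d) {q : M} (hq : q ∈ d.source) :
    q ∈ lineCurve a b d ↔ (d q).1 = 0 := by
  refine ⟨?_, fun h0 => Or.inl ⟨hq, h0⟩⟩
  rintro (⟨-, h0⟩ | ⟨hb, h0⟩)
  · exact h0
  · obtain ⟨h1, h2⟩ := h.b2_zero hb h0
    exact absurd (by rw [h2]; rfl) (h.snd_ne hq h1)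

theorem patch_notMem_lineCurve (h : IsSide M sp a c ε O F b cn d) (hd : ∀ z,
    M.patch z ∈ d.source → M.patch z ∈ O) (z : ℂ × ℂ) : M.patch z ∉ lineCurve a b d := by
  rintro (⟨hq, h0⟩ | ⟨hb, h0⟩)
  · rw [h.d_fst _ hq (hd z hq), h.patch_fst _ (hd z hq)] at h0
    exact inv_ne_zero ((h.patch_O z).1 (hd z hq)) h0
  · obtain ⟨h1, h2⟩ := h.b2_zero hb h0
    exact h.patch_notMem_of_zero h1 h2

/-- On the line, away from the coordinate system `b 2`, we have `x⁻¹ = 0` and `y ≠ 0`. -/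
theorem lineCurve_cases (h : IsSide M sp a c ε O F b cn d) {q : M} (hq : q ∈ lineCurve a b d)
    (hO : q ∈ O) : ((F q).2 ≠ 0 ∧ lineEq a c (F q) = 0) ∨
      (q ∈ (b 2).source ∧ b 2 q = (-a, 0) ∧ F q = 0) := by
  rcases hq with ⟨hq, h0⟩ | ⟨hb, h0⟩
  · left
    exact ⟨h.snd_ne hq hO, by rw [← h.d_fst q hq hO, h0]⟩
  · exact Or.inr ⟨hb, h0, (h.b2_zero hb h0).2⟩

/-- With `(u, v) = b 0` the line has the equation `u (1 + a u v ^ 2 + c u ^ 2 v ^ 3) = 0` at points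
with `y ≠ 0`. There `u ≠ 0`, so only the bracket can vanish; the point of the line with `y = 0` lies
in `b 2` and not here. The versions for `b 1`, `b 3` and `cn` rest on the corresponding
factorisations. -/
theorem notMem_lineCurve_b0 (h : IsSide M sp a c ε O F b cn d) {q : M} (hq : q ∈ (b 0).source)
    (hf : 1 + a * (b 0 q).1 * (b 0 q).2 ^ 2 + c * (b 0 q).1 ^ 2 * (b 0 q).2 ^ 3 ≠ 0) :
    q ∉ lineCurve a b d := by
  intro hL
  rcases h.lineCurve_cases hL (h.tower.b_sub 0 (by omega) q hq) with ⟨h1, h2⟩ | ⟨h1, -, h3⟩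
  · rw [h.tower.b_eq 0 (by omega) q hq] at h1 h2
    refine mul_ne_zero (left_ne_zero_of_mul h1) hf ?_
    rw [← h2, lineEq]
    ring
  · exact h.tower.b_far 0 2 le_rfl (by omega) q hq h1 h3

theorem notMem_lineCurve_b1 (h : IsSide M sp a c ε O F b cn d) {q : M} (hq : q ∈ (b 1).source)
    (hf : 1 + a * (b 1 q).2 + c * (b 1 q).1 * (b 1 q).2 ^ 2 ≠ 0) :
    q ∉ lineCurve a b d := by
  intro hL
  rcases h.lineCurve_cases hL (h.tower.b_sub 1 (by omega) q hq) with ⟨h1, h2⟩ | ⟨h1, h2, h3⟩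
  · rw [h.tower.b_eq 1 (by omega) q hq] at h1 h2
    refine mul_ne_zero (mul_ne_zero (left_ne_zero_of_mul h1) h1) hf ?_
    rw [← h2, lineEq]
    ring
  · have h4 := (h.tower.b_succ 1 (by omega) q hq).1 h1
    have h5 := h.tower.b_succ_eq 1 (by omega) q hq h4
    rw [h2, Prod.ext_iff] at h5
    have h6 : (b 1 q).1 = 0 := (mul_eq_zero.1 h5.2.symm).resolve_right (pow_ne_zero 2 h4)
    have h7 : -a * (b 1 q).2 = 1 := by
      rw [show -a = (b 1 q).2⁻¹ from h5.1, inv_mul_cancel₀ h4]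
    apply hf
    rw [h6]
    linear_combination -h7

/-- With `(u, v) = b 2` one has `x⁻¹ = (u v) ^ 2 (u + a + c u v)`. The line, given by the last
factor, crosses the second exceptional curve `v = 0` at `u = -a`. As `a ≠ 0`, it does not pass
through the third centre. -/
theorem mem_lineCurve_b2 (h : IsSide M sp a c ε O F b cn d) {q : M} (hq : q ∈ (b 2).source) :
    q ∈ lineCurve a b d ↔ (b 2 q).1 + a + c * ((b 2 q).1 * (b 2 q).2) = 0 := by
  have hO := h.tower.b_sub 2 (by omega) q hq
  have hF := h.tower.b_eq 2 (by omega) q hq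
  constructor
  · intro hL
    rcases h.lineCurve_cases hL hO with ⟨h1, h2⟩ | ⟨h1, h2, h3⟩
    · rw [hF] at h1 h2
      refine (mul_eq_zero.1 (?_ : ((b 2 q).1 * (b 2 q).2) ^ 2 * _ = 0)).resolve_left
        (pow_ne_zero 2 h1)
      rw [← h2, lineEq]
      ring
    · rw [h2]
      simp
  · intro h0
    by_cases h1 : (b 2 q).1 * (b 2 q).2 = 0
    · right
      rw [h1, mul_zero, add_zero] at h0
      have h2 : (b 2 q).1 = -a := eq_neg_of_add_eq_zero_left h0
      refine ⟨hq, Prod.ext h2 ((mul_eq_zero.1 h1).resolve_left ?_)⟩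
      rw [h2]
      exact neg_ne_zero.2 h.a_ne
    · left
      have hd := h.O_d q hO (by rw [hF]; exact h1)
      refine ⟨hd, ?_⟩
      rw [h.d_fst q hd hO, hF, lineEq]
      linear_combination ((b 2 q).1 * (b 2 q).2) ^ 2 * h0

theorem notMem_lineCurve_b3 (h : IsSide M sp a c ε O F b cn d) {q : M} (hq : q ∈ (b 3).source)
    (hf : (b 3 q).1 ^ 2 * (b 3 q).2 + a + c * ((b 3 q).1 * (b 3 q).2) ≠ 0) :
    q ∉ lineCurve a b d := by
  intro hL
  rcases h.lineCurve_cases hL (h.tower.b_sub 3 (by omega) q hq) with ⟨h1, h2⟩ | ⟨h1, h2, h3⟩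
  · rw [h.tower.b_eq 3 (by omega) q hq] at h1 h2
    refine mul_ne_zero (pow_ne_zero 2 h1) hf ?_
    rw [← h2, lineEq]
    ring
  · have h4 := (h.tower.b_succ 2 (by omega) q h1).1 hq
    rw [h2] at h4
    exact h4 rfl

theorem notMem_lineCurve_cn (h : IsSide M sp a c ε O F b cn d) {q : M} (hq : q ∈ cn.source)
    (hf : (cn q).1 * (cn q).2 ^ 2 + a + c * (cn q).2 ≠ 0) : q ∉ lineCurve a b d := by
  intro hL
  rcases h.lineCurve_cases hL (h.tower.cn_sub q hq) with ⟨h1, h2⟩ | ⟨h1, h2, h3⟩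
  · rw [h.tower.cn_eq q hq] at h1 h2
    refine mul_ne_zero (pow_ne_zero 2 h1) hf ?_
    rw [← h2, lineEq]
    ring
  · exact h.tower.far_cn 2 (by omega) q h1 hq h3

/-- Coordinates near the intersection of the line with the exceptional curves. -/
theorem exists_coord_line (h : IsSide M sp a c ε O F b cn d) : ∃ e ∈ Coord M,
    (∀ q, q ∈ e.source ↔ q ∈ (b 2).source ∧ (b 2 q).1 ≠ 0) ∧
    (∀ q, e q = ((b 2 q).1 * (b 2 q).2, (b 2 q).1 + a + c * ((b 2 q).1 * (b 2 q).2))) ∧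
    (0, 0) ∈ e.target ∧ e.symm (0, 0) = (b 2).symm (-a, 0) := by
  have os : IsOpen {z : ℂ × ℂ | z.1 ≠ 0} := isOpen_ne.preimage continuous_fst
  have ot : IsOpen {z : ℂ × ℂ | z.2 - a - c * z.1 ≠ 0} :=
    isOpen_ne.preimage (f := fun z : ℂ × ℂ => z.2 - a - c * z.1) (by fun_prop)
  -- These coordinates are `y` and `x⁻¹ / y ^ 2`. Solving for `(u, v) = b 2` gives `u = z.2 - a - c
  -- z.1` and `v = z.1 / u`, which explains the condition on the target.
  obtain ⟨e, he, hs, ht, hv, hi⟩ := exists_coord_comp (h.tower.b_mem 2 (by omega))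
    (h.tower.b_target 2 (by omega)) (s := {z | z.1 ≠ 0}) (t := {z | z.2 - a - c * z.1 ≠ 0})
    (f := fun z => (z.1 * z.2, z.1 + a + c * (z.1 * z.2)))
    (g := fun z => (z.2 - a - c * z.1, z.1 / (z.2 - a - c * z.1))) os ot
    (fun z hz => by
      have : z.1 + a + c * (z.1 * z.2) - a - c * (z.1 * z.2) = z.1 := by ring
      simpa [this] using hz) (fun z hz => hz)
    (fun z hz => by
      have : z.1 + a + c * (z.1 * z.2) - a - c * (z.1 * z.2) = z.1 := by ring
      simp only [this]
      rw [mul_div_cancel_left₀ _ hz])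
    (fun z hz => by
      simp only []
      rw [mul_div_cancel₀ _ hz]
      refine Prod.ext rfl ?_
      simp only []
      ring)
    (by fun_prop)
    (by
      refine ContDiffOn.prodMk (by fun_prop) (ContDiffOn.div (by fun_prop) (by fun_prop) ?_)
      exact fun z hz => hz)
  refine ⟨e, he, hs, hv, ?_, ?_⟩
  · rw [ht]
    simpa using h.a_ne
  · rw [hi]
    simp

/-- Along the line use `ζ = y⁻¹` with normal coordinate `x⁻¹`. The chart at the remaining point is
`(y, x⁻¹ / y ^ 2)`, whose normal coordinate is `ζ ^ 2` times the first one. This reflects that a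
fibre of `ℙ¹ × ℙ¹`, of self-intersection `0`, was blown up at two of its points. -/
theorem isRationalCurve_lineCurve (h : IsSide M sp a c ε O F b cn d) :
    IsRationalCurve (lineCurve a b d) (-2) := by
  have hu : ∀ z, z ∈ d.target := fun z => by simp [h.d_target]
  obtain ⟨e, he, hs, ht, hv, hi⟩ := exists_coord_swap h.d_mem h.d_target
  obtain ⟨e₁, he₁, s₁, v₁, z₁, i₁⟩ := h.exists_coord_line
  have hd : ∀ q ∈ d.source, q ∈ e₁.source → (d q).2 ≠ 0 ∧ (e₁ q).1 = (d q).2⁻¹ ∧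
      (d q).1 * (d q).2 ^ 2 = (e₁ q).2 := fun q hq hq' => by
    have hb := ((s₁ q).1 hq').1
    have hO := h.tower.b_sub 2 (by omega) q hb
    have hF := h.tower.b_eq 2 (by omega) q hb
    have h0 := (h.d_O q hq).1 hO
    have h1 : (b 2 q).1 * (b 2 q).2 = (d q).2⁻¹ := by rw [← h.d_snd q hq hO, hF]
    refine ⟨h0, by rw [v₁, h1], ?_⟩
    rw [h.d_fst q hq hO, hF, lineEq, v₁]
    simp only [h1]
    field_simp
  refine ⟨e, he, e₁, he₁, fun ζ => by simp [ht], z₁, ?_, fun q hq => ?_, fun q hq => ?_,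
    fun ζ hζ => ?_⟩
  · rintro q (⟨hq, -⟩ | ⟨hq, h0⟩)
    · exact Or.inr (hs ▸ hq)
    · left
      rw [i₁, ← h0, (b 2).left_inv hq]
  · rw [hv, h.mem_lineCurve_d (hs ▸ hq)]
  · rw [v₁, h.mem_lineCurve_b2 ((s₁ q).1 hq).1]
  · simp only [hi] at hζ ⊢
    have h1 : ∀ s, d.symm (s, ζ) ∈ d.source := fun s => d.map_target (hu _)
    have h2 : ∀ s, d (d.symm (s, ζ)) = (s, ζ) := fun s => d.right_inv (hu _)
    obtain ⟨h3, h4, -⟩ := hd _ (h1 0) hζ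
    simp only [h2] at h3 h4
    refine ⟨by rw [h4, inv_mul_cancel₀ h3], ?_⟩
    have h5 : ∀ᶠ s in 𝓝 (0 : ℂ), d.symm (s, ζ) ∈ e₁.source := by
      have hc : Continuous d.symm := by
        have := d.continuousOn_symm
        rwa [h.d_target, continuousOn_univ] at this
      have hc' : Continuous fun s : ℂ => d.symm (s, ζ) := hc.comp (by fun_prop)
      exact hc'.continuousAt.eventually_mem (e₁.open_source.mem_nhds hζ)
    have h6 := (hasDerivAt_id (0 : ℂ)).mul_const (ζ ^ 2)
    rw [one_mul] at h6
    refine (h6.congr_of_eventuallyEq ?_).congr_deriv (by simp)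
    filter_upwards [h5] with s hs'
    have h7 := (hd _ (h1 s) hs').2.2
    rw [h2] at h7
    exact h7.symm

theorem meetOnce_line (h : IsSide M sp a c ε O F b cn d) :
    MeetOnce (excCurve b 1) (lineCurve a b d) := by
  obtain ⟨e₁, he₁, s₁, v₁, z₁, i₁⟩ := h.exists_coord_line
  have hu : (-a, (0 : ℂ)) ∈ (b 2).target := by simp [h.tower.b_target 2 (by omega)]
  have hb := (b 2).map_target hu
  have hv := (b 2).right_inv hu
  refine ⟨(b 2).symm (-a, 0), Subset.antisymm ?_ ?_, e₁, he₁, i₁ ▸ e₁.map_target z₁,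
    fun w hw => ?_⟩
  · rintro q ⟨hE, hL⟩
    obtain ⟨hO, hF⟩ := h.tower.excCurve_sub (by omega) hE
    rcases h.lineCurve_cases hL hO with ⟨h1, -⟩ | ⟨h1, h2, -⟩
    · exact absurd (by rw [hF]; rfl) h1
    · rw [mem_singleton_iff, ← h2, (b 2).left_inv h1]
  · rintro _ rfl
    exact ⟨(h.tower.mem_excCurve_iff' (by omega) hb).2 (by rw [hv]), Or.inr ⟨hb, hv⟩⟩
  · obtain ⟨hw1, hw2⟩ := (s₁ w).1 hw
    rw [v₁]
    refine ⟨?_, h.mem_lineCurve_b2 hw1⟩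
    rw [h.tower.mem_excCurve_iff' (by omega) hw1]
    simp [hw2]

theorem disjoint_excCurve_lineCurve (h : IsSide M sp a c ε O F b cn d) {j : ℕ}
    (hj : j = 0 ∨ j = 2) : Disjoint (excCurve b j) (lineCurve a b d) := by
  refine disjoint_left.2 fun q hE hL => ?_
  obtain ⟨hO, hF⟩ := h.tower.excCurve_sub (by omega) hE
  rcases h.lineCurve_cases hL hO with ⟨h1, -⟩ | ⟨h1, h2, -⟩
  · exact absurd (by rw [hF]; rfl) h1
  · rcases hj with rfl | rfl
    · exact h.tower.notMem_excCurve_of_gt (l := 2) le_rfl (by omega) h1 hE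
    · have h3 := (h.tower.mem_excCurve_iff (by omega) h1).1 hE
      rw [h2] at h3
      exact neg_ne_zero.2 h.a_ne h3

end IsSide

/-! ### The pole divisor of the two-form -/

theorem exists_hasFDerivAt_lineEq (a c : ℂ) (k : ℕ) (z : ℂ × ℂ) : ∃ P',
    HasFDerivAt (fun z : ℂ × ℂ => (lineEq a c (z.1 * z.2 ^ k, z.2), z.2)) P' z ∧
      P'.det = z.2 ^ k := by
  refine ⟨_, hasFDerivAt_planeMap (a := z.2 ^ k) (c := 0) (d := 1)
    (((hasFDerivAt_fst.mul (hasFDerivAt_snd.pow k)).add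
      ((hasFDerivAt_snd.pow 2).const_mul a)).add ((hasFDerivAt_snd.pow 3).const_mul c))
    hasFDerivAt_snd (by simp) rfl (by simp) (by simp), ?_⟩
  rw [det_planeMap]
  ring

/-- By the chain rule: the blow-up map `(u, v) ↦ (u, u v)` has Jacobian `u`, and multiplying the
first entry by the `k`-th power of the second contributes `(u v) ^ k`. The shear in `lineEq`
contributes nothing. -/
theorem exists_hasFDerivAt_blowParam (a c : ℂ) (k : ℕ) (z : ℂ × ℂ) : ∃ P',
    HasFDerivAt (fun z : ℂ × ℂ => (lineEq a c (z.1 * (z.1 * z.2) ^ k, z.1 * z.2), z.1 * z.2)) P' z ∧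
      P'.det = z.1 * (z.1 * z.2) ^ k := by
  have hX : HasFDerivAt (fun z : ℂ × ℂ => (z.1, z.1 * z.2)) (planeMap 1 0 z.2 z.1) z :=
    hasFDerivAt_planeMap hasFDerivAt_fst (hasFDerivAt_fst.mul hasFDerivAt_snd) (by simp) (by simp)
      (by simp) (by simp)
  obtain ⟨P', hP, hd⟩ := exists_hasFDerivAt_lineEq a c k (z.1, z.1 * z.2)
  refine ⟨_, hP.comp z hX, ?_⟩
  have h1 := det_planeMap 1 0 z.2 z.1
  have h2 : (P'.comp (planeMap 1 0 z.2 z.1)).det = P'.det * (planeMap 1 0 z.2 z.1).det :=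
    LinearMap.det_comp _ _
  rw [h2, h1, hd]
  ring

/-- Where `f ≠ 0` the factor `ε f ^ 2` is a unit, and its inverse is the function `h` of the
definition. In the applications `f = 0` is the part of the line at infinity that is visible in the
chart, and points off it are treated. -/
theorem isAnticanonicalAt_of_restrict {M : MarkedSurface} {ι : Type} [Fintype ι] {D : ι → Set M}
    {m : ι → ℕ} {q : M} {e : OpenPartialHomeomorph M (ℂ × ℂ)} (he : e ∈ Coord M)
    (ht : e.target = univ) {f : ℂ × ℂ → ℂ} (hf : Differentiable ℂ f) (hq : q ∈ e.source)
    (hfq : f (e q) ≠ 0) {ε : ℂ} (hε : ε ≠ 0) {i j : ι} (hij : i ≠ j) {g₁ g₂ : ℂ × ℂ → ℂ}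
    (hg₁ : IsSimpleEq g₁) (hg₂ : IsSimpleEq g₂)
    (hi : ∀ q ∈ e.source, f (e q) ≠ 0 → (q ∈ D i ↔ g₁ (e q) = 0))
    (hj : ∀ q ∈ e.source, f (e q) ≠ 0 → (q ∈ D j ↔ g₂ (e q) = 0))
    (hk : ∀ k, k ≠ i → k ≠ j → ∀ q ∈ e.source, f (e q) ≠ 0 → q ∉ D k)
    (hdet : ∀ w, M.patch w ∈ e.source →
      (fderiv ℂ (fun w' => e (M.patch w')) w).det =
        ε * f (e (M.patch w)) ^ 2 * (g₁ (e (M.patch w)) ^ m i * g₂ (e (M.patch w)) ^ m j)) :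
    IsAnticanonicalAt M D m q := by
  obtain ⟨e', he', hs', ht', hv'⟩ := exists_coord_restrict he ht
    (s := {z | f z ≠ 0}) (isOpen_ne.preimage hf.continuous)
  have hne : ∀ z ∈ e'.target, ε * f z ^ 2 ≠ 0 := fun z hz => by
    rw [ht'] at hz
    exact mul_ne_zero hε (pow_ne_zero 2 hz)
  refine isAnticanonicalAt_of_two he' ((hs' q).2 ⟨hq, hfq⟩) hij (h := fun z => (ε * f z ^ 2)⁻¹)
    (DifferentiableOn.inv (by fun_prop) hne)
    (fun z hz => inv_ne_zero (hne z hz)) hg₁ hg₂ (fun q hq => ?_) (fun q hq => ?_)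
    (fun k h1 h2 q hq => ?_) fun w hw => ?_
  · rw [hv']
    exact hi q ((hs' q).1 hq).1 ((hs' q).1 hq).2
  · rw [hv']
    exact hj q ((hs' q).1 hq).1 ((hs' q).1 hq).2
  · exact hk k h1 h2 q ((hs' q).1 hq).1 ((hs' q).1 hq).2
  · have h1 := hne _ (e'.map_source hw)
    simp only [hv'] at h1 ⊢
    rw [hdet w ((hs' _).1 hw).1, mul_right_comm, mul_inv_cancel₀ h1, one_mul]

/-! ### Pole orders along one tower -/

namespace IsSide

variable {M : MarkedSurface} {sp : ℂ × ℂ → ℂ × ℂ} {a c ε : ℂ} {O : Set M}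
    {F : M → ℂ × ℂ} {b : ℕ → OpenPartialHomeomorph M (ℂ × ℂ)}
    {cn d : OpenPartialHomeomorph M (ℂ × ℂ)}

theorem lineEq_patch_ne (h : IsSide M sp a c ε O F b cn d) {z : ℂ × ℂ} (hz : M.patch z ∈ O) :
    lineEq a c (F (M.patch z)) ≠ 0 := by
  rw [h.patch_fst z hz]
  exact inv_ne_zero ((h.patch_O z).1 hz)

/-- `P` writes `(x⁻¹, y)` in terms of the coordinates `e`, and on the patch `(x⁻¹, y)` has Jacobian
`ε (x⁻¹) ^ 2`; the chain rule compares the two. -/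
theorem det_coord (h : IsSide M sp a c ε O F b cn d) {e : OpenPartialHomeomorph M (ℂ × ℂ)}
    (he : e ∈ Coord M) {w : ℂ × ℂ} (hw : M.patch w ∈ e.source) {P : ℂ × ℂ → ℂ × ℂ}
    {P' : ℂ × ℂ →L[ℂ] ℂ × ℂ} (hP : HasFDerivAt P P' (e (M.patch w)))
    (hO : ∀ w, M.patch w ∈ e.source → M.patch w ∈ O)
    (hPe : ∀ q ∈ e.source, q ∈ O → P (e q) = (lineEq a c (F q), (F q).2)) :
    (fderiv ℂ (fun w' => e (M.patch w')) w).det * P'.det =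
      ε * lineEq a c (F (M.patch w)) ^ 2 := by
  obtain ⟨h1, h2⟩ := differentiableAt_coord_patch he hw
  obtain ⟨Q', hQ, hQd⟩ := h.det w ((h.patch_O w).1 (hO w hw))
  rw [det_fderiv_mul h1 hP hQ ?_, hQd, h.patch_fst w (hO w hw)]
  filter_upwards [h2] with w' hw'
  rw [hPe _ hw' (hO w' hw'), h.patch_fst w' (hO w' hw'), h.patch_snd w' (hO w' hw')]

theorem det_b (h : IsSide M sp a c ε O F b cn d) {k : ℕ} (hk : k < 4) {w : ℂ × ℂ}
    (hw : M.patch w ∈ (b k).source) :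
    (fderiv ℂ (fun w' => b k (M.patch w')) w).det * ((b k (M.patch w)).1 *
      ((b k (M.patch w)).1 * (b k (M.patch w)).2) ^ k) =
      ε * lineEq a c ((b k (M.patch w)).1 * ((b k (M.patch w)).1 * (b k (M.patch w)).2) ^ k,
        (b k (M.patch w)).1 * (b k (M.patch w)).2) ^ 2 ∧
    lineEq a c ((b k (M.patch w)).1 * ((b k (M.patch w)).1 * (b k (M.patch w)).2) ^ k,
        (b k (M.patch w)).1 * (b k (M.patch w)).2) ≠ 0 := by
  obtain ⟨P', hP, hd⟩ := exists_hasFDerivAt_blowParam a c k (b k (M.patch w))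
  have hO := h.tower.b_sub k hk
  have h1 := h.det_coord (h.tower.b_mem k hk) hw hP (fun w hw => hO _ hw) fun q hq _ => by
    rw [h.tower.b_eq k hk q hq]
  rw [hd, h.tower.b_eq k hk _ hw] at h1
  refine ⟨h1, ?_⟩
  have h2 := h.lineEq_patch_ne (hO _ hw)
  rwa [h.tower.b_eq k hk _ hw] at h2

theorem det_cn (h : IsSide M sp a c ε O F b cn d) {w : ℂ × ℂ} (hw : M.patch w ∈ cn.source) :
    (fderiv ℂ (fun w' => cn (M.patch w')) w).det =
      ε * ((cn (M.patch w)).1 * (cn (M.patch w)).2 ^ 2 + a + c * (cn (M.patch w)).2) ^ 2 := by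
  obtain ⟨P', hP, hd⟩ := exists_hasFDerivAt_lineEq a c 4 (cn (M.patch w))
  have hO := h.tower.cn_sub
  have h1 := h.det_coord h.tower.cn_mem hw hP (fun w hw => hO _ hw) fun q hq _ => by
    rw [h.tower.cn_eq q hq]
  have h2 := h.lineEq_patch_ne (hO _ hw)
  rw [hd, h.tower.cn_eq _ hw] at h1
  rw [h.tower.cn_eq _ hw] at h2
  have hy : (cn (M.patch w)).2 ≠ 0 := fun h0 => h2 (by simp [lineEq, h0])
  refine mul_right_cancel₀ (pow_ne_zero 4 hy) (h1.trans ?_)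
  rw [lineEq]
  ring

/-- Let `(u, v) = b k` and `ℓ = x⁻¹`. On the patch the Jacobian of `b k` is `ε ℓ ^ 2 / (u (u v) ^
k)`. Factoring `ℓ` turns this into `ε f ^ 2` times `u`, `u ^ 2 v`, `u v ^ 2`, `v` for `k = 0, 1, 2,
3`, and times `1` in `cn`. So the orders along the four exceptional curves are `1, 2, 1, 0`, and the
line, contained in `f = 0`, has order `2`. The map `i` lists the indices of the first three
exceptional curves and of the line. -/
theorem isAnticanonicalAt (h : IsSide M sp a c ε O F b cn d) {ι : Type} [Fintype ι]
    {D : ι → Set M} {m : ι → ℕ} {i : Fin 4 → ι} (hi : Function.Injective i)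
    (h0 : D (i 0) = excCurve b 0) (h1 : D (i 1) = excCurve b 1) (h2 : D (i 2) = excCurve b 2)
    (h3 : D (i 3) = lineCurve a b d) (m0 : m (i 0) = 1) (m1 : m (i 1) = 2) (m2 : m (i 2) = 1)
    (m3 : m (i 3) = 2) (hD : ∀ k, ∀ q ∈ O, q ∈ D k → ∃ j, k = i j) {q : M} (hq : q ∈ O)
    (hF : F q = 0) : IsAnticanonicalAt M D m q := by
  have T := h.tower
  have hk : ∀ {s : Set M}, s ⊆ O → ∀ {i₁ i₂ : Fin 4}, (∀ j, j ≠ i₁ → j ≠ i₂ → ∀ q ∈ s, q ∉ D (i j)) →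
      ∀ k, k ≠ i i₁ → k ≠ i i₂ → ∀ q ∈ s, q ∉ D k := by
    intro s hs i₁ i₂ hj k hk₁ hk₂ q hq hqD
    obtain ⟨j, rfl⟩ := hD k q (hs hq) hqD
    exact hj j (fun e => hk₁ (e ▸ rfl)) (fun e => hk₂ (e ▸ rfl)) q hq hqD
  have key : ∀ {e : OpenPartialHomeomorph M (ℂ × ℂ)}, e ∈ Coord M → e.target = univ →
      ∀ {f : ℂ × ℂ → ℂ}, Differentiable ℂ f → q ∈ e.source → f (e q) ≠ 0 →
      ∀ (i₁ i₂ : Fin 4), i₁ ≠ i₂ → ∀ {g₁ g₂ : ℂ × ℂ → ℂ}, IsSimpleEq g₁ → IsSimpleEq g₂ →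
      (∀ q ∈ e.source, q ∈ O) →
      (∀ q ∈ e.source, f (e q) ≠ 0 → (q ∈ D (i i₁) ↔ g₁ (e q) = 0)) →
      (∀ q ∈ e.source, f (e q) ≠ 0 → (q ∈ D (i i₂) ↔ g₂ (e q) = 0)) →
      (∀ j, j ≠ i₁ → j ≠ i₂ → ∀ q ∈ e.source, f (e q) ≠ 0 → q ∉ D (i j)) →
      (∀ w, M.patch w ∈ e.source → (fderiv ℂ (fun w' => e (M.patch w')) w).det =
        ε * f (e (M.patch w)) ^ 2 * (g₁ (e (M.patch w)) ^ m (i i₁) * g₂ (e (M.patch w)) ^ m (i i₂)))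
      → IsAnticanonicalAt M D m q := by
    intro e he ht f hf hq hfq i₁ i₂ h12 g₁ g₂ hg₁ hg₂ hO hi₁ hi₂ hj hdet
    refine isAnticanonicalAt_of_restrict he ht hf hq hfq h.ε_ne (hi.ne h12) hg₁ hg₂ hi₁ hi₂ ?_ hdet
    intro k hk₁ hk₂ q hq hfq
    exact hk (s := {q | q ∈ e.source ∧ f (e q) ≠ 0}) (fun q hq => hO q hq.1)
      (fun j hj₁ hj₂ q hq => hj j hj₁ hj₂ q hq.1 hq.2) k hk₁ hk₂ q ⟨hq, hfq⟩
  rcases T.excCurve_cases hq hF with ⟨k, hk3, hb, hu⟩ | ⟨hb, hu⟩ | ⟨hb, hu⟩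
  · obtain rfl | rfl | rfl : k = 0 ∨ k = 1 ∨ k = 2 := by omega
    -- Only the first exceptional curve is met here; the line is listed second with the equation
    -- `1`.
    · refine key (T.b_mem 0 (by omega)) (T.b_target 0 (by omega))
        (f := fun z => 1 + a * z.1 * z.2 ^ 2 + c * z.1 ^ 2 * z.2 ^ 3) (by fun_prop) hb
        (by simp [hu]) 0 3 (by decide) isSimpleEq_fst isSimpleEq_one (T.b_sub 0 (by omega)) ?_ ?_
        ?_ ?_
      · intro q hq _
        rw [h0, T.mem_excCurve_iff (by omega) hq]
      · intro q hq hf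
        rw [h3]
        exact iff_of_false (h.notMem_lineCurve_b0 hq hf) one_ne_zero
      · intro j hj₁ hj₂ q hq _
        obtain rfl | rfl : j = 1 ∨ j = 2 := by revert hj₁ hj₂; revert j; decide
        · rw [h1]
          exact T.notMem_excCurve_of_lt (by omega) (by omega) hq
        · rw [h2]
          exact T.notMem_excCurve_of_lt (by omega) (by omega) hq
      · intro w hw
        obtain ⟨hd, hne⟩ := h.det_b (k := 0) (by omega) hw
        have hu : (b 0 (M.patch w)).1 ≠ 0 := fun h0 => hne (by simp [lineEq, h0])
        refine mul_right_cancel₀ (mul_ne_zero hu (pow_ne_zero 0 hu)) (Eq.trans hd ?_)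
        rw [lineEq, m0]
        ring
    -- On the second exceptional curve this factor vanishes at the point of the line. There the
    -- coordinates `(y, x⁻¹ / y ^ 2)` have both curves as axes.
    · by_cases hf : 1 + a * (b 1 q).2 + c * (b 1 q).1 * (b 1 q).2 ^ 2 = 0
      · obtain ⟨e, he, hs, hv, -⟩ := h.exists_coord_line
        have hne : (b 1 q).2 ≠ 0 := fun h0 => by simp [h0] at hf
        have hb2 := (T.b_succ 1 (by omega) q hb).2 hne
        have he2 := T.b_succ_eq 1 (by omega) q hb hne
        have hsub : ∀ q ∈ e.source, q ∈ O := fun q hq => T.b_sub 2 (by omega) q ((hs q).1 hq).1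
        refine isAnticanonicalAt_of_two he ((hs q).2 ⟨hb2, by rw [he2]; exact inv_ne_zero hne⟩)
          (hi.ne (show (1 : Fin 4) ≠ 3 by decide)) (h := fun _ => (-ε)⁻¹) (by fun_prop)
          (fun _ _ => inv_ne_zero (neg_ne_zero.2 h.ε_ne)) isSimpleEq_fst isSimpleEq_snd ?_ ?_
          (hk hsub ?_) ?_
        · intro q hq
          obtain ⟨hq1, hq2⟩ := (hs q).1 hq
          rw [h1, T.mem_excCurve_iff' (by omega) hq1, hv]
          simp [hq2]
        · intro q hq
          rw [h3, h.mem_lineCurve_b2 ((hs q).1 hq).1, hv]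
        · intro j hj₁ hj₂ q hq
          obtain ⟨hq1, hq2⟩ := (hs q).1 hq
          obtain rfl | rfl : j = 0 ∨ j = 2 := by revert hj₁ hj₂; revert j; decide
          · rw [h0]
            exact T.notMem_excCurve_of_gt (by omega) (by omega) hq1
          · rw [h2, T.mem_excCurve_iff (by omega) hq1]
            exact hq2
        · intro w hw
          -- In these coordinates `(x⁻¹, y) = (z₂ z₁ ^ 2, z₁)`, with Jacobian `-z₁ ^ 2`. Hence the
          -- chart has Jacobian `-ε z₁ ^ 2 z₂ ^ 2` on the patch: order two along both curves.
          have hP : HasFDerivAt (fun z : ℂ × ℂ => (z.2 * z.1 ^ 2, z.1))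
              (planeMap (2 * (e (M.patch w)).2 * (e (M.patch w)).1) ((e (M.patch w)).1 ^ 2) 1 0)
              (e (M.patch w)) :=
            hasFDerivAt_planeMap (hasFDerivAt_snd.mul (hasFDerivAt_fst.pow 2)) hasFDerivAt_fst
              (by simp; ring) (by simp) (by simp) (by simp)
          have hPe : ∀ q ∈ e.source, ((e q).2 * (e q).1 ^ 2, (e q).1) =
              (lineEq a c (F q), (F q).2) := fun q hq => by
            rw [hv, T.b_eq 2 (by omega) q ((hs q).1 hq).1, lineEq]
            refine Prod.ext ?_ rfl
            simp only []
            ring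
          have hd := h.det_coord he hw hP (fun w hw => hsub _ hw) fun q hq _ => hPe q hq
          have hne := h.lineEq_patch_ne (hsub _ hw)
          have hl : (e (M.patch w)).2 * (e (M.patch w)).1 ^ 2 = lineEq a c (F (M.patch w)) :=
            (Prod.ext_iff.1 (hPe _ hw)).1
          rw [← hl] at hd hne
          rw [det_planeMap] at hd
          have hy : (e (M.patch w)).1 ≠ 0 := fun h0 => hne (by simp [h0])
          rw [m1, m3, mul_inv_eq_iff_eq_mul₀ (neg_ne_zero.2 h.ε_ne)]
          refine mul_right_cancel₀ (neg_ne_zero.2 (pow_ne_zero 2 hy)) (Eq.trans ?_ (hd.trans ?_))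
          · ring
          · ring
      · refine key (T.b_mem 1 (by omega)) (T.b_target 1 (by omega))
          (f := fun z => 1 + a * z.2 + c * z.1 * z.2 ^ 2) (by fun_prop) hb
          hf 1 0 (by decide) isSimpleEq_fst isSimpleEq_snd (T.b_sub 1 (by omega)) ?_ ?_ ?_ ?_
        · intro q hq _
          rw [h1, T.mem_excCurve_iff (by omega) hq]
        · intro q hq _
          rw [h0, T.mem_excCurve_iff' (by omega) hq]
        · intro j hj₁ hj₂ q hq hf
          obtain rfl | rfl : j = 2 ∨ j = 3 := by revert hj₁ hj₂; revert j; decide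
          · rw [h2]
            exact T.notMem_excCurve_of_lt (by omega) (by omega) hq
          · rw [h3]
            exact h.notMem_lineCurve_b1 hq hf
        · intro w hw
          obtain ⟨hd, hne⟩ := h.det_b (k := 1) (by omega) hw
          have hu : (b 1 (M.patch w)).1 ≠ 0 := fun h0 => hne (by simp [lineEq, h0])
          have hv : (b 1 (M.patch w)).2 ≠ 0 := fun h0 => hne (by simp [lineEq, h0])
          refine mul_right_cancel₀ (mul_ne_zero hu (pow_ne_zero 1 (mul_ne_zero hu hv)))
            (Eq.trans hd ?_)
          rw [lineEq, m0, m1]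
          ring
    · refine key (T.b_mem 2 (by omega)) (T.b_target 2 (by omega))
        (f := fun z => z.1 + a + c * (z.1 * z.2)) (by fun_prop) hb
        (by simpa [hu] using h.a_ne) 2 1 (by decide) isSimpleEq_fst isSimpleEq_snd
        (T.b_sub 2 (by omega)) ?_ ?_ ?_ ?_
      · intro q hq _
        rw [h2, T.mem_excCurve_iff (by omega) hq]
      · intro q hq _
        rw [h1, T.mem_excCurve_iff' (by omega) hq]
      · intro j hj₁ hj₂ q hq hf
        obtain rfl | rfl : j = 0 ∨ j = 3 := by revert hj₁ hj₂; revert j; decide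
        · rw [h0]
          exact T.notMem_excCurve_of_gt (by omega) (by omega) hq
        · rw [h3, h.mem_lineCurve_b2 hq]
          exact hf
      · intro w hw
        obtain ⟨hd, hne⟩ := h.det_b (k := 2) (by omega) hw
        have hu : (b 2 (M.patch w)).1 ≠ 0 := fun h0 => hne (by simp [lineEq, h0])
        have hv : (b 2 (M.patch w)).2 ≠ 0 := fun h0 => hne (by simp [lineEq, h0])
        refine mul_right_cancel₀ (mul_ne_zero hu (pow_ne_zero 2 (mul_ne_zero hu hv)))
          (Eq.trans hd ?_)
        rw [lineEq, m1, m2]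
        ring
  -- The point where the third exceptional curve meets the fourth: order one along the third, `v =
  -- 0`, and none along the fourth, `u = 0`. Index `0` is a filler with the equation `1`.
  · refine key (T.b_mem 3 (by omega)) (T.b_target 3 (by omega))
      (f := fun z => z.1 ^ 2 * z.2 + a + c * (z.1 * z.2)) (by fun_prop) hb
      (by simpa [hu] using h.a_ne) 2 0 (by decide) isSimpleEq_snd isSimpleEq_one
      (T.b_sub 3 (by omega)) ?_ ?_ ?_ ?_
    · intro q hq _
      rw [h2, T.mem_excCurve_iff' (by omega) hq]
    · intro q hq _
      rw [h0]
      exact iff_of_false (T.notMem_excCurve_of_gt (by omega) (by omega) hq) one_ne_zero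
    · intro j hj₁ hj₂ q hq hf
      obtain rfl | rfl : j = 1 ∨ j = 3 := by revert hj₁ hj₂; revert j; decide
      · rw [h1]
        exact T.notMem_excCurve_of_gt (by omega) (by omega) hq
      · rw [h3]
        exact h.notMem_lineCurve_b3 hq hf
    · intro w hw
      obtain ⟨hd, hne⟩ := h.det_b (k := 3) (by omega) hw
      have hu : (b 3 (M.patch w)).1 ≠ 0 := fun h0 => hne (by simp [lineEq, h0])
      have hv : (b 3 (M.patch w)).2 ≠ 0 := fun h0 => hne (by simp [lineEq, h0])
      refine mul_right_cancel₀ (mul_ne_zero hu (pow_ne_zero 3 (mul_ne_zero hu hv)))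
        (Eq.trans hd ?_)
      rw [lineEq, m0, m2]
      ring
  -- On the affine part of the last exceptional curve no boundary curve is present; both indices are
  -- fillers with the equation `1`.
  · refine key T.cn_mem T.cn_target
      (f := fun z => z.1 * z.2 ^ 2 + a + c * z.2) (by fun_prop) hb
      (by simpa [hu] using h.a_ne) 0 1 (by decide) isSimpleEq_one isSimpleEq_one
      T.cn_sub ?_ ?_ ?_ ?_
    · intro q hq _
      rw [h0]
      exact iff_of_false (T.notMem_excCurve_cn (by omega) hq) one_ne_zero
    · intro q hq _
      rw [h1]
      exact iff_of_false (T.notMem_excCurve_cn (by omega) hq) one_ne_zero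
    · intro j hj₁ hj₂ q hq hf
      obtain rfl | rfl : j = 2 ∨ j = 3 := by revert hj₁ hj₂; revert j; decide
      · rw [h2]
        exact T.notMem_excCurve_cn (by omega) hq
      · rw [h3]
        exact h.notMem_lineCurve_cn hq hf
    · intro w hw
      rw [h.det_cn hw]
      ring

end IsSide

/-! ### Surfaces of type `D₇⁽¹⁾` -/

/-- Two towers over different points at infinity of `ℙ¹ × ℙ¹`, with common coordinate system
`(x⁻¹, y⁻¹)`. -/
structure IsTwoSided (M : MarkedSurface) (sp sp' : ℂ × ℂ → ℂ × ℂ) (a c ε a' c' ε' : ℂ)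
    (O O' : Set M) (F F' : M → ℂ × ℂ) (b b' : ℕ → OpenPartialHomeomorph M (ℂ × ℂ))
    (cn cn' d d' : OpenPartialHomeomorph M (ℂ × ℂ)) : Prop where
  left : IsSide M sp a c ε O F b cn d
  right : IsSide M sp' a' c' ε' O' F' b' cn' d'
  source_eq : d'.source = d.source
  swap_eq : ∀ q, d' q = ((d q).2, (d q).1)
  left_notMem : ∀ q ∈ O, F q = 0 → q ∉ O'
  right_notMem : ∀ q ∈ O', F' q = 0 → q ∉ O
  cover : ∀ q, q ∈ range M.patch ∨ q ∈ d.source ∨ (q ∈ O ∧ F q = 0) ∨ (q ∈ O' ∧ F' q = 0)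
  mem_patch : ∀ q ∈ O, lineEq a c (F q) ≠ 0 → q ∈ range M.patch
  dense : DenseRange M.patch

/-- The boundary curves. -/
def boundary {M : MarkedSurface} (a a' : ℂ) (b b' : ℕ → OpenPartialHomeomorph M (ℂ × ℂ))
    (d d' : OpenPartialHomeomorph M (ℂ × ℂ)) : Fin 8 → Set M :=
  ![excCurve b 0, excCurve b 2, excCurve b 1, lineCurve a b d, lineCurve a' b' d',
    excCurve b' 1, excCurve b' 0, excCurve b' 2]

/-- A form of adjacency that `decide` can evaluate on all pairs of nodes. -/
theorem affineD7_adj_iff (i j : Fin 8) : affineD7.Adj i j ↔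
    (i, j) ∈ ([(0, 2), (1, 2), (2, 3), (3, 4), (4, 5), (5, 6), (5, 7)] : List (Fin 8 × Fin 8)) ∨
    (j, i) ∈ ([(0, 2), (1, 2), (2, 3), (3, 4), (4, 5), (5, 6), (5, 7)] : List (Fin 8 × Fin 8)) := by
  simp only [affineD7, SimpleGraph.fromEdgeSet_adj, Set.mem_insert_iff, mem_singleton_iff]
  revert i j
  decide

namespace IsTwoSided

variable {M : MarkedSurface} {sp sp' : ℂ × ℂ → ℂ × ℂ} {a c ε a' c' ε' : ℂ}
    {O O' : Set M} {F F' : M → ℂ × ℂ} {b b' : ℕ → OpenPartialHomeomorph M (ℂ × ℂ)}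
    {cn cn' d d' : OpenPartialHomeomorph M (ℂ × ℂ)}

theorem patch_mem (h : IsTwoSided M sp sp' a c ε a' c' ε' O O' F F' b b' cn cn' d d') (z : ℂ × ℂ)
    (hz : M.patch z ∈ d.source) : M.patch z ∈ O ∧ M.patch z ∈ O' :=
  ⟨(h.left.patch_O z).2 (h.left.patch_d z hz).1,
    (h.right.patch_O z).2 (h.right.patch_d z (h.source_eq ▸ hz)).1⟩

theorem disjoint_excCurve (h : IsTwoSided M sp sp' a c ε a' c' ε' O O' F F' b b' cn cn' d d')
    {j k : ℕ} (hj : j + 1 < 4) (hk : k + 1 < 4) : Disjoint (excCurve b j) (excCurve b' k) :=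
  disjoint_left.2 fun _ hE hE' => h.left_notMem _ (h.left.tower.excCurve_sub hj hE).1
    (h.left.tower.excCurve_sub hj hE).2 (h.right.tower.excCurve_sub hk hE').1

theorem disjoint_excCurve_line
    (h : IsTwoSided M sp sp' a c ε a' c' ε' O O' F F' b b' cn cn' d d')
    {j : ℕ} (hj : j + 1 < 4) : Disjoint (excCurve b j) (lineCurve a' b' d') := by
  refine disjoint_left.2 fun q hE hL => ?_
  rcases hL with ⟨hq, -⟩ | ⟨hb, h0⟩
  · exact h.left.notMem_excCurve_of_d hj (h.source_eq ▸ hq) hE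
  · exact h.left_notMem q (h.left.tower.excCurve_sub hj hE).1 (h.left.tower.excCurve_sub hj hE).2
      (h.right.b2_zero hb h0).1

theorem disjoint_line_excCurve
    (h : IsTwoSided M sp sp' a c ε a' c' ε' O O' F F' b b' cn cn' d d')
    {j : ℕ} (hj : j + 1 < 4) : Disjoint (lineCurve a b d) (excCurve b' j) := by
  refine disjoint_left.2 fun q hL hE => ?_
  rcases hL with ⟨hq, -⟩ | ⟨hb, h0⟩
  · exact h.right.notMem_excCurve_of_d hj (h.source_eq ▸ hq) hE
  · exact h.right_notMem q (h.right.tower.excCurve_sub hj hE).1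
      (h.right.tower.excCurve_sub hj hE).2 (h.left.b2_zero hb h0).1

theorem mem_lineCurve' (h : IsTwoSided M sp sp' a c ε a' c' ε' O O' F F' b b' cn cn' d d')
    {q : M} (hq : q ∈ d.source) : q ∈ lineCurve a' b' d' ↔ (d q).2 = 0 := by
  rw [h.right.mem_lineCurve_d (h.source_eq ▸ hq), h.swap_eq]

theorem meetOnce_lines (h : IsTwoSided M sp sp' a c ε a' c' ε' O O' F F' b b' cn cn' d d') :
    MeetOnce (lineCurve a b d) (lineCurve a' b' d') := by
  have hu : (0 : ℂ × ℂ) ∈ d.target := by simp [h.left.d_target]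
  have hd := d.map_target hu
  have hv := d.right_inv hu
  refine ⟨d.symm 0, Subset.antisymm ?_ ?_, d, h.left.d_mem, hd, fun w hw =>
    ⟨h.left.mem_lineCurve_d hw, h.mem_lineCurve' hw⟩⟩
  · rintro q ⟨hL, hL'⟩
    have hq : q ∈ d.source := by
      rcases hL with ⟨hq, -⟩ | ⟨hb, h0⟩
      · exact hq
      · rcases hL' with ⟨hq, -⟩ | ⟨hb', h0'⟩
        · exact h.source_eq ▸ hq
        · exact absurd (h.right.b2_zero hb' h0').1
            (h.left_notMem q (h.left.b2_zero hb h0).1 (h.left.b2_zero hb h0).2)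
    have h0 : d q = 0 := Prod.ext ((h.left.mem_lineCurve_d hq).1 hL) ((h.mem_lineCurve' hq).1 hL')
    rw [mem_singleton_iff, ← h0, d.left_inv hq]
  · rintro _ rfl
    exact ⟨(h.left.mem_lineCurve_d hd).2 (by rw [hv]; rfl), (h.mem_lineCurve' hd).2 (by rw [hv]; rfl)⟩

theorem notMem_lineCurve' (h : IsTwoSided M sp sp' a c ε a' c' ε' O O' F F' b b' cn cn' d d')
    {q : M} (hO : q ∈ O) : q ∉ lineCurve a' b' d' := by
  rintro (⟨hq, h0⟩ | ⟨hb, h0⟩)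
  · rw [h.source_eq] at hq
    rw [h.swap_eq] at h0
    exact (h.left.d_O q hq).1 hO h0
  · exact h.right_notMem q (h.right.b2_zero hb h0).1 (h.right.b2_zero hb h0).2 hO

theorem notMem_excCurve' (h : IsTwoSided M sp sp' a c ε a' c' ε' O O' F F' b b' cn cn' d d')
    {q : M} (hO : q ∈ O) {j : ℕ} (hj : j + 1 < 4) : q ∉ excCurve b' j := fun hE =>
  h.right_notMem q (h.right.tower.excCurve_sub hj hE).1 (h.right.tower.excCurve_sub hj hE).2 hO

theorem notMem_lineCurve (h : IsTwoSided M sp sp' a c ε a' c' ε' O O' F F' b b' cn cn' d d')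
    {q : M} (hO : q ∈ O') : q ∉ lineCurve a b d := by
  rintro (⟨hq, h0⟩ | ⟨hb, h0⟩)
  · have h1 := (h.right.d_O q (h.source_eq ▸ hq)).1 hO
    rw [h.swap_eq] at h1
    exact h1 h0
  · exact h.left_notMem q (h.left.b2_zero hb h0).1 (h.left.b2_zero hb h0).2 hO

theorem notMem_excCurve (h : IsTwoSided M sp sp' a c ε a' c' ε' O O' F F' b b' cn cn' d d')
    {q : M} (hO : q ∈ O') {j : ℕ} (hj : j + 1 < 4) : q ∉ excCurve b j := fun hE =>
  h.left_notMem q (h.left.tower.excCurve_sub hj hE).1 (h.left.tower.excCurve_sub hj hE).2 hO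

theorem patch_notMem (h : IsTwoSided M sp sp' a c ε a' c' ε' O O' F F' b b' cn cn' d d')
    (z : ℂ × ℂ) (i : Fin 8) : M.patch z ∉ boundary a a' b b' d d' i := by
  have hL := h.left.patch_notMem_lineCurve (fun z hz => (h.patch_mem z hz).1) z
  have hL' := h.right.patch_notMem_lineCurve
    (fun z hz => (h.patch_mem z (h.source_eq ▸ hz)).2) z
  fin_cases i
  exacts [h.left.patch_notMem_excCurve (by omega) z, h.left.patch_notMem_excCurve (by omega) z,
    h.left.patch_notMem_excCurve (by omega) z, hL, hL', h.right.patch_notMem_excCurve (by omega) z,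
    h.right.patch_notMem_excCurve (by omega) z, h.right.patch_notMem_excCurve (by omega) z]

theorem isAnticanonicalAt_patch
    (h : IsTwoSided M sp sp' a c ε a' c' ε' O O' F F' b b' cn cn' d d') (z : ℂ × ℂ) :
    IsAnticanonicalAt M (boundary a a' b b' d d') marksD7 (M.patch z) := by
  obtain ⟨A, hA, tA, pA⟩ := M.isPatch
  have hu : ∀ z, z ∈ A.target := fun z => by simp [tA]
  have hn : ∀ k, ∀ q ∈ A.source, q ∉ boundary a a' b b' d d' k := fun k q hq => by
    rw [← A.left_inv hq, pA]
    exact h.patch_notMem _ k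
  refine isAnticanonicalAt_of_two hA (by rw [← pA]; exact A.map_target (hu z))
    (show (0 : Fin 8) ≠ 1 by decide) (h := fun _ => 1) (by fun_prop) (fun _ _ => one_ne_zero)
    isSimpleEq_one isSimpleEq_one
    (fun q hq => iff_of_false (hn _ q hq) one_ne_zero)
    (fun q hq => iff_of_false (hn _ q hq) one_ne_zero) (fun k _ _ q hq => hn k q hq)
    fun w _ => ?_
  have hid : (fun w' => A (M.patch w')) = id := funext fun w' => by
    rw [← pA, A.right_inv (hu w')]
    rfl
  rw [hid, fderiv_id]
  simp [ContinuousLinearMap.det]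

/-- On the patch `(x⁻¹, y⁻¹)` has Jacobian `-ε x⁻² y⁻²`, so the form has double poles along the two
lines. -/
theorem isAnticanonicalAt_d
    (h : IsTwoSided M sp sp' a c ε a' c' ε' O O' F F' b b' cn cn' d d') {q : M}
    (hq : q ∈ d.source) : IsAnticanonicalAt M (boundary a a' b b' d d') marksD7 q := by
  refine isAnticanonicalAt_of_two h.left.d_mem hq (show (3 : Fin 8) ≠ 4 by decide)
    (h := fun _ => (-ε)⁻¹) (by fun_prop) (fun _ _ => inv_ne_zero (neg_ne_zero.2 h.left.ε_ne))
    isSimpleEq_fst isSimpleEq_snd (fun q hq => h.left.mem_lineCurve_d hq)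
    (fun q hq => h.mem_lineCurve' hq) (fun k h3 h4 q hq => ?_) fun w hw => ?_
  · have hq' : q ∈ d'.source := h.source_eq ▸ hq
    fin_cases k
    exacts [h.left.notMem_excCurve_of_d (by omega) hq, h.left.notMem_excCurve_of_d (by omega) hq,
      h.left.notMem_excCurve_of_d (by omega) hq, absurd rfl h3, absurd rfl h4,
      h.right.notMem_excCurve_of_d (by omega) hq', h.right.notMem_excCurve_of_d (by omega) hq',
      h.right.notMem_excCurve_of_d (by omega) hq']
  · have hO := (h.patch_mem w hw).1
    have hy := (h.left.d_O _ hw).1 hO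
    have hP : HasFDerivAt (fun z : ℂ × ℂ => (z.1, z.2⁻¹))
        (planeMap 1 0 0 (-((d (M.patch w)).2 ^ 2)⁻¹)) (d (M.patch w)) :=
      hasFDerivAt_planeMap hasFDerivAt_fst ((hasDerivAt_inv hy).comp_hasFDerivAt _ hasFDerivAt_snd)
        (by simp) (by simp) (by simp) (by simp)
    have hd := h.left.det_coord h.left.d_mem hw hP (fun w hw => (h.patch_mem w hw).1)
      fun q hq hO => by rw [h.left.d_fst q hq hO, h.left.d_snd q hq hO]
    rw [det_planeMap, ← h.left.d_fst _ hw hO] at hd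
    rw [mul_inv_eq_iff_eq_mul₀ (neg_ne_zero.2 h.left.ε_ne)]
    have h1 : ((d (M.patch w)).2 ^ 2)⁻¹ * (d (M.patch w)).2 ^ 2 = 1 :=
      inv_mul_cancel₀ (pow_ne_zero 2 hy)
    show _ = (d (M.patch w)).1 ^ 2 * (d (M.patch w)).2 ^ 2 * -ε
    linear_combination (-(d (M.patch w)).2 ^ 2) * hd -
      (fderiv ℂ (fun w' => d (M.patch w')) w).det * h1

theorem isTypeD7 (h : IsTwoSided M sp sp' a c ε a' c' ε' O O' F F' b b' cn cn' d d') :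
    IsTypeD7 M (boundary a a' b b' d d') := by
  have T := h.left.tower
  have T' := h.right.tower
  refine ⟨fun i => ?_, fun i j hij => ?_, fun i j hij hadj => ?_, h.dense, fun q => ?_⟩
  · fin_cases i
    exacts [T.isRationalCurve_excCurve (by omega), T.isRationalCurve_excCurve (by omega),
      T.isRationalCurve_excCurve (by omega), h.left.isRationalCurve_lineCurve,
      h.right.isRationalCurve_lineCurve, T'.isRationalCurve_excCurve (by omega),
      T'.isRationalCurve_excCurve (by omega), T'.isRationalCurve_excCurve (by omega)]
  · have key : ∀ i j : Fin 8, (i, j) ∈ ([(0, 2), (1, 2), (2, 3), (3, 4), (4, 5), (5, 6), (5, 7)] :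
        List (Fin 8 × Fin 8)) →
        MeetOnce (boundary a a' b b' d d' i) (boundary a a' b b' d d' j) := by
      intro i j hij
      simp only [List.mem_cons, Prod.mk.injEq, List.not_mem_nil, or_false] at hij
      rcases hij with ⟨rfl, rfl⟩ | ⟨rfl, rfl⟩ | ⟨rfl, rfl⟩ | ⟨rfl, rfl⟩ | ⟨rfl, rfl⟩ | ⟨rfl, rfl⟩ |
        ⟨rfl, rfl⟩
      exacts [(T.meetOnce_excCurve (by omega)).symm, T.meetOnce_excCurve (by omega),
        h.left.meetOnce_line, h.meetOnce_lines, h.right.meetOnce_line.symm,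
        T'.meetOnce_excCurve (by omega), (T'.meetOnce_excCurve (by omega)).symm]
    rcases (affineD7_adj_iff i j).1 hij with h1 | h1
    · exact key i j h1
    · exact (key j i h1).symm
  · have key : ∀ i j : Fin 8, i < j → ¬ affineD7.Adj i j →
        Disjoint (boundary a a' b b' d d' i) (boundary a a' b b' d d' j) := by
      intro i j hij hadj
      -- These are the 21 of the 28 pairs of nodes that are not edges; the last nine join
      -- exceptional curves of different towers.
      have h1 : (i, j) ∈ ([(0, 1), (0, 3), (1, 3), (6, 7), (4, 6), (4, 7), (0, 4), (1, 4), (2, 4),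
          (3, 5), (3, 6), (3, 7), (0, 5), (0, 6), (0, 7), (1, 5), (1, 6), (1, 7), (2, 5), (2, 6),
          (2, 7)] : List (Fin 8 × Fin 8)) := by
        rw [affineD7_adj_iff] at hadj
        revert i j
        decide
      simp only [List.mem_cons, Prod.mk.injEq, List.not_mem_nil, or_false] at h1
      rcases h1 with ⟨rfl, rfl⟩ | ⟨rfl, rfl⟩ | ⟨rfl, rfl⟩ | ⟨rfl, rfl⟩ | ⟨rfl, rfl⟩ | ⟨rfl, rfl⟩ |
        ⟨rfl, rfl⟩ | ⟨rfl, rfl⟩ | ⟨rfl, rfl⟩ | ⟨rfl, rfl⟩ | ⟨rfl, rfl⟩ | ⟨rfl, rfl⟩ |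
        h1
      iterate 12 rotate_left
      · rcases h1 with ⟨rfl, rfl⟩ | ⟨rfl, rfl⟩ | ⟨rfl, rfl⟩ | ⟨rfl, rfl⟩ | ⟨rfl, rfl⟩ | ⟨rfl, rfl⟩ |
          ⟨rfl, rfl⟩ | ⟨rfl, rfl⟩ | ⟨rfl, rfl⟩ <;>
        exact h.disjoint_excCurve (by omega) (by omega)
      exacts [T.disjoint_excCurve, h.left.disjoint_excCurve_lineCurve (Or.inl rfl),
        h.left.disjoint_excCurve_lineCurve (Or.inr rfl), T'.disjoint_excCurve,
        (h.right.disjoint_excCurve_lineCurve (Or.inl rfl)).symm,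
        (h.right.disjoint_excCurve_lineCurve (Or.inr rfl)).symm,
        h.disjoint_excCurve_line (by omega), h.disjoint_excCurve_line (by omega),
        h.disjoint_excCurve_line (by omega), h.disjoint_line_excCurve (by omega),
        h.disjoint_line_excCurve (by omega), h.disjoint_line_excCurve (by omega)]
    rcases lt_or_gt_of_ne hij with h1 | h1
    · exact key i j h1 hadj
    · exact (key j i h1 fun h2 => hadj h2.symm).symm
  · change IsAnticanonicalAt M (boundary a a' b b' d d') marksD7 q
    rcases h.cover q with ⟨z, rfl⟩ | hd | ⟨hO, hF⟩ | ⟨hO, hF⟩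
    · exact h.isAnticanonicalAt_patch z
    · exact h.isAnticanonicalAt_d hd
    -- In `boundary` the first, second and third exceptional curves and the line have the indices
    -- `0, 2, 1, 3` on the left, and `6, 5, 7, 4` on the right.
    · refine h.left.isAnticanonicalAt (i := ![0, 2, 1, 3]) (by decide) rfl rfl rfl rfl rfl rfl rfl
        rfl (fun k q hq hk => ?_) hO hF
      fin_cases k
      exacts [⟨0, rfl⟩, ⟨2, rfl⟩, ⟨1, rfl⟩, ⟨3, rfl⟩, absurd hk (h.notMem_lineCurve' hq),
        absurd hk (h.notMem_excCurve' hq (by omega)), absurd hk (h.notMem_excCurve' hq (by omega)),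
        absurd hk (h.notMem_excCurve' hq (by omega))]
    · refine h.right.isAnticanonicalAt (i := ![6, 5, 7, 4]) (by decide) rfl rfl rfl rfl rfl rfl rfl
        rfl (fun k q hq hk => ?_) hO hF
      fin_cases k
      exacts [absurd hk (h.notMem_excCurve hq (by omega)),
        absurd hk (h.notMem_excCurve hq (by omega)), absurd hk (h.notMem_excCurve hq (by omega)),
        absurd hk (h.notMem_lineCurve hq), ⟨3, rfl⟩, ⟨1, rfl⟩, ⟨0, rfl⟩, ⟨2, rfl⟩]

/-- The complement of the boundary. -/
theorem mem_compl_boundary (h : IsTwoSided M sp sp' a c ε a' c' ε' O O' F F' b b' cn cn' d d')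
    (q : M) : q ∈ (⋃ i, boundary a a' b b' d d' i)ᶜ ↔ q ∈ range M.patch ∨
      (q ∈ cn.source ∧ (cn q).2 = 0) ∨ (q ∈ cn'.source ∧ (cn' q).2 = 0) := by
  have side : ∀ {sp : ℂ × ℂ → ℂ × ℂ} {a c ε : ℂ} {O : Set M} {F : M → ℂ × ℂ}
      {b : ℕ → OpenPartialHomeomorph M (ℂ × ℂ)} {cn d : OpenPartialHomeomorph M (ℂ × ℂ)},
      IsSide M sp a c ε O F b cn d → q ∈ O → F q = 0 →
      (q ∈ cn.source ∧ (cn q).2 = 0) ∨ q ∈ excCurve b 0 ∨ q ∈ excCurve b 1 ∨ q ∈ excCurve b 2 := by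
    intro sp a c ε O F b cn d h hO hF
    rcases h.tower.excCurve_cases hO hF with ⟨k, hk, h1⟩ | h1 | h1
    · obtain rfl | rfl | rfl : k = 0 ∨ k = 1 ∨ k = 2 := by omega
      exacts [Or.inr (Or.inl (Or.inl h1)), Or.inr (Or.inr (Or.inl (Or.inl h1))),
        Or.inr (Or.inr (Or.inr (Or.inl h1)))]
    · exact Or.inr (Or.inr (Or.inr (Or.inr h1)))
    · exact Or.inl h1
  have side' : ∀ {sp : ℂ × ℂ → ℂ × ℂ} {a c ε : ℂ} {O : Set M} {F : M → ℂ × ℂ}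
      {b : ℕ → OpenPartialHomeomorph M (ℂ × ℂ)} {cn d : OpenPartialHomeomorph M (ℂ × ℂ)},
      IsSide M sp a c ε O F b cn d → q ∈ cn.source → (cn q).2 = 0 →
      q ∈ O ∧ F q = 0 ∧ (∀ j, j + 1 < 4 → q ∉ excCurve b j) ∧ q ∉ lineCurve a b d := by
    intro sp a c ε O F b cn d h hq h0
    refine ⟨h.tower.cn_sub q hq, by rw [h.tower.cn_eq q hq, h0]; simp,
      fun j hj => h.tower.notMem_excCurve_cn hj hq, h.notMem_lineCurve_cn hq ?_⟩
    simpa [h0] using h.a_ne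
  rw [mem_compl_iff, mem_iUnion, not_exists]
  constructor
  · intro hn
    rcases h.cover q with h1 | hd | ⟨hO, hF⟩ | ⟨hO, hF⟩
    · exact Or.inl h1
    · have h3 : (d q).1 ≠ 0 := fun h0 => hn 3 ((h.left.mem_lineCurve_d hd).2 h0)
      have h4 : (d q).2 ≠ 0 := fun h0 => hn 4 ((h.mem_lineCurve' hd).2 h0)
      have hO := (h.left.d_O q hd).2 h4
      exact Or.inl (h.mem_patch q hO (by rwa [← h.left.d_fst q hd hO]))
    · rcases side h.left hO hF with h1 | h1 | h1 | h1
      exacts [Or.inr (Or.inl h1), absurd h1 (hn 0), absurd h1 (hn 2), absurd h1 (hn 1)]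
    · rcases side h.right hO hF with h1 | h1 | h1 | h1
      exacts [Or.inr (Or.inr h1), absurd h1 (hn 6), absurd h1 (hn 5), absurd h1 (hn 7)]
  · rintro (⟨z, rfl⟩ | ⟨h1, h2⟩ | ⟨h1, h2⟩) i
    · exact h.patch_notMem z i
    · obtain ⟨hO, hF, hE, hL⟩ := side' h.left h1 h2
      fin_cases i
      exacts [hE 0 (by omega), hE 2 (by omega), hE 1 (by omega), hL, h.notMem_lineCurve' hO,
        h.notMem_excCurve' hO (by omega), h.notMem_excCurve' hO (by omega),
        h.notMem_excCurve' hO (by omega)]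
    · obtain ⟨hO, hF, hE, hL⟩ := side' h.right h1 h2
      fin_cases i
      exacts [h.notMem_excCurve hO (by omega), h.notMem_excCurve hO (by omega),
        h.notMem_excCurve hO (by omega), h.notMem_lineCurve hO, hL, hE 1 (by omega),
        hE 0 (by omega), hE 2 (by omega)]

end IsTwoSided

/-! ### The two points at infinity of `ℙ¹ × ℙ¹` -/

/-- Coordinates `w = (x⁻¹, y)` and `d = (x⁻¹, y⁻¹)`, where `(x, y) = sp` on the distinguished
patch. -/
structure IsSideBase (N : MarkedSurface) (sp : ℂ × ℂ → ℂ × ℂ)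
    (w d : OpenPartialHomeomorph N (ℂ × ℂ)) : Prop where
  w_mem : w ∈ Coord N
  w_target : w.target = univ
  d_w : ∀ q ∈ d.source, q ∈ w.source ↔ (d q).2 ≠ 0
  d_eq : ∀ q ∈ d.source, q ∈ w.source → d q = ((w q).1, (w q).2⁻¹)
  w_d : ∀ q ∈ w.source, (w q).2 ≠ 0 → q ∈ d.source
  patch_w : ∀ z, N.patch z ∈ w.source ↔ (sp z).1 ≠ 0
  patch_eq : ∀ z, N.patch z ∈ w.source → w (N.patch z) = ((sp z).1⁻¹, (sp z).2)
  patch_d : ∀ z, N.patch z ∈ d.source → (sp z).1 ≠ 0 ∧ (sp z).2 ≠ 0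
  w_patch : ∀ q ∈ w.source, (w q).1 ≠ 0 → q ∈ range N.patch

namespace IsSideBase

variable {N : MarkedSurface} {sp : ℂ × ℂ → ℂ × ℂ} {w d : OpenPartialHomeomorph N (ℂ × ℂ)}

/-- Coordinates in which a curve touching `x⁻¹ = a y ^ 2 + c y ^ 3` is close to an axis. -/
theorem exists_shear (h : IsSideBase N sp w d) (a c : ℂ) : ∃ e ∈ Coord N, e.source = w.source ∧
    e.target = univ ∧ (∀ q, lineEq a c (e q) = (w q).1 ∧ (e q).2 = (w q).2) ∧
    e.symm 0 = w.symm 0 := by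
  obtain ⟨e, he, hs, ht, hv, hi⟩ := exists_coord_comp h.w_mem h.w_target (s := univ) (t := univ)
    (f := fun z => (z.1 - a * z.2 ^ 2 - c * z.2 ^ 3, z.2))
    (g := fun z => (z.1 + a * z.2 ^ 2 + c * z.2 ^ 3, z.2)) isOpen_univ isOpen_univ
    (fun _ _ => trivial) (fun _ _ => trivial)
    (fun z _ => Prod.ext (by simp only []; ring) rfl)
    (fun z _ => Prod.ext (by simp only []; ring) rfl) (by fun_prop) (by fun_prop)
  refine ⟨e, he, ext fun q => (hs q).trans (and_iff_left trivial), ht, fun q => ?_, ?_⟩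
  · rw [hv, lineEq]
    exact ⟨by ring, rfl⟩
  · rw [hi]
    simp
    rfl

theorem patch_ne (h : IsSideBase N sp w d) (z : ℂ × ℂ) : N.patch z ≠ w.symm 0 := by
  intro h0
  have h1 : N.patch z ∈ w.source := h0 ▸ w.map_target (by simp [h.w_target])
  have h2 := h.patch_eq z h1
  rw [h0, w.right_inv (by simp [h.w_target])] at h2
  exact inv_ne_zero ((h.patch_w z).1 h1) (Prod.ext_iff.1 h2).1.symm

theorem zero_notMem_d (h : IsSideBase N sp w d) : w.symm 0 ∉ d.source := by
  intro h0
  have h1 : w.symm 0 ∈ w.source := w.map_target (by simp [h.w_target])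
  have h2 := h.d_eq _ h0 h1
  refine (h.d_w _ h0).1 h1 ?_
  rw [h2, w.right_inv (by simp [h.w_target])]
  simp

/-- The curve `x = α / s ^ 2 - β / s`, `y = s`. -/
theorem eventually_curve (h : IsSideBase N sp w d) {α β : ℂ} (hα : α ≠ 0)
    {e : OpenPartialHomeomorph N (ℂ × ℂ)} (hs : e.source = w.source)
    (hv : ∀ q, lineEq α⁻¹ (β / α ^ 2) (e q) = (w q).1 ∧ (e q).2 = (w q).2) {γ : ℂ → ℂ × ℂ}
    (hγ : ∀ s, s ≠ 0 → sp (γ s) = (α / s ^ 2 - β / s, s)) :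
    Tendsto (fun s => β ^ 2 / (α ^ 2 * (α - β * s))) (𝓝[≠] 0)
      (𝓝 (β ^ 2 / (α ^ 2 * (α - β * 0)))) ∧
    ∀ᶠ s in 𝓝[≠] 0, N.patch (γ s) = e.symm (s ^ 4 * (β ^ 2 / (α ^ 2 * (α - β * s))), s) := by
  -- Here `x⁻¹ = s²/(α - β s)` and `1/(α - β s) = 1/α + β s/α² + β² s²/(α² (α - β s))`. The first
  -- two terms are removed by the shear; the last one leaves `s ^ 4` times this function.
  have hc : ContinuousAt (fun s => β ^ 2 / (α ^ 2 * (α - β * s))) 0 :=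
    ContinuousAt.div (by fun_prop) (by fun_prop) (by simp [hα])
  refine ⟨hc.tendsto.mono_left nhdsWithin_le_nhds, ?_⟩
  have h1 : ∀ᶠ s : ℂ in 𝓝[≠] 0, α - β * s ≠ 0 := by
    have h2 : ContinuousAt (fun s : ℂ => α - β * s) 0 := by fun_prop
    exact (h2.eventually_ne (by simpa using hα)).filter_mono nhdsWithin_le_nhds
  filter_upwards [h1, self_mem_nhdsWithin] with s hs1 hs0
  replace hs0 : s ≠ 0 := hs0
  have hx : α / s ^ 2 - β / s = (α - β * s) / s ^ 2 := by field_simp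
  have hx0 : (sp (γ s)).1 ≠ 0 := by
    rw [hγ s hs0, hx]
    exact div_ne_zero hs1 (pow_ne_zero 2 hs0)
  have hw := (h.patch_w (γ s)).2 hx0
  refine (e.left_inv (hs ▸ hw : N.patch (γ s) ∈ e.source)).symm.trans (congrArg e.symm ?_)
  obtain ⟨h3, h4⟩ := hv (N.patch (γ s))
  rw [h.patch_eq _ hw, hγ s hs0, hx] at h3 h4
  refine Prod.ext ?_ h4
  rw [lineEq, h4] at h3
  simp only at h3 ⊢
  rw [← eq_sub_iff_add_eq, ← eq_sub_iff_add_eq] at h3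
  rw [h3]
  field_simp
  ring

theorem isSide (h : IsSideBase N sp w d) {a c ε : ℂ} (ha : a ≠ 0) (hε : ε ≠ 0)
    (hsp : ∀ z, (sp z).1 ≠ 0 → ∃ Q', HasFDerivAt (fun z => ((sp z).1⁻¹, (sp z).2)) Q' z ∧
      Q'.det = ε * ((sp z).1⁻¹) ^ 2)
    {e : OpenPartialHomeomorph N (ℂ × ℂ)}
    (hv : ∀ q, lineEq a c (e q) = (w q).1 ∧ (e q).2 = (w q).2)
    {M : MarkedSurface} {ρ : M → N} (hρ : ∀ z, ρ (M.patch z) = N.patch z)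
    {b : ℕ → OpenPartialHomeomorph M (ℂ × ℂ)} {cn d' : OpenPartialHomeomorph M (ℂ × ℂ)}
    (hT : IsTower M (ρ ⁻¹' w.source) (fun q => e (ρ q)) 4 b cn) (hd' : d' ∈ Coord M)
    (ht' : d'.target = univ) (hs' : d'.source = ρ ⁻¹' d.source) (hv' : ∀ q, d' q = d (ρ q)) :
    IsSide M sp a c ε (ρ ⁻¹' w.source) (fun q => e (ρ q)) b cn d' where
  a_ne := ha
  ε_ne := hε
  tower := hT
  d_mem := hd'
  d_target := ht'
  d_O q hq := by
    rw [hs'] at hq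
    rw [hv', ← h.d_w _ hq]
    rfl
  d_fst q hq hO := by
    rw [hs'] at hq
    rw [hv', (hv _).1, h.d_eq _ hq hO]
  d_snd q hq hO := by
    rw [hs'] at hq
    rw [hv', (hv _).2, h.d_eq _ hq hO, inv_inv]
  O_d q hO hy := by
    rw [(hv _).2] at hy
    rw [hs']
    exact h.w_d _ hO hy
  patch_O z := by
    rw [mem_preimage, hρ, h.patch_w]
  patch_fst z hz := by
    rw [mem_preimage, hρ] at hz
    rw [hρ, (hv _).1, h.patch_eq _ hz]
  patch_snd z hz := by
    rw [mem_preimage, hρ] at hz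
    rw [hρ, (hv _).2, h.patch_eq _ hz]
  patch_d z hz := by
    rw [hs', mem_preimage, hρ] at hz
    exact h.patch_d z hz
  det := hsp

end IsSideBase

theorem tendsto_curve {α : ℂ} (β : ℂ) (hα : α ≠ 0) :
    (∀ᶠ s in 𝓝[≠] 0, α / s ^ 2 - β / s ≠ 0) ∧
      Tendsto (fun s => (α / s ^ 2 - β / s)⁻¹) (𝓝[≠] 0) (𝓝 0) := by
  have h1 : ∀ᶠ s : ℂ in 𝓝[≠] 0, α - β * s ≠ 0 := by
    have h2 : ContinuousAt (fun s : ℂ => α - β * s) 0 := by fun_prop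
    exact (h2.eventually_ne (by simpa using hα)).filter_mono nhdsWithin_le_nhds
  have hx : ∀ s : ℂ, s ≠ 0 → α / s ^ 2 - β / s = (α - β * s) / s ^ 2 := fun s hs => by field_simp
  constructor
  · filter_upwards [h1, self_mem_nhdsWithin] with s hs1 hs0
    rw [hx s hs0]
    exact div_ne_zero hs1 (pow_ne_zero 2 hs0)
  · have hc : ContinuousAt (fun s : ℂ => s ^ 2 / (α - β * s)) 0 :=
      ContinuousAt.div (by fun_prop) (by fun_prop) (by simpa using hα)
    have hc' := hc.tendsto.mono_left (nhdsWithin_le_nhds (s := {0}ᶜ))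
    simp only [ne_eq, OfNat.ofNat_ne_zero, not_false_eq_true, zero_pow, zero_div] at hc'
    refine hc'.congr' ?_
    filter_upwards [self_mem_nhdsWithin] with s hs0
    rw [hx s hs0, inv_div]

/-- The four affine patches of `ℙ¹ × ℙ¹`. -/
structure IsLineProduct (N : MarkedSurface) (V : Bool × Bool → OpenPartialHomeomorph N (ℂ × ℂ)) :
    Prop where
  mem : ∀ i, V i ∈ Coord N
  target : ∀ i, (V i).target = univ
  patch : ∀ z, N.patch z = (V (false, false)).symm z
  cover : ∀ q, ∃ i, q ∈ (V i).source
  source : ∀ i j z,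
    (V i).symm z ∈ (V j).source ↔ z.1 ∈ lineDom i.1 j.1 ∧ z.2 ∈ lineDom i.2 j.2
  eq : ∀ i j z, z.1 ∈ lineDom i.1 j.1 → z.2 ∈ lineDom i.2 j.2 →
    V j ((V i).symm z) = (lineChange i.1 j.1 z.1, lineChange i.2 j.2 z.2)

namespace IsLineProduct

variable {N : MarkedSurface} {V : Bool × Bool → OpenPartialHomeomorph N (ℂ × ℂ)}

theorem source' (h : IsLineProduct N V) {i : Bool × Bool} (j : Bool × Bool) {q : N}
    (hq : q ∈ (V i).source) :
    q ∈ (V j).source ↔ (V i q).1 ∈ lineDom i.1 j.1 ∧ (V i q).2 ∈ lineDom i.2 j.2 := by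
  rw [← h.source, (V i).left_inv hq]

theorem eq' (h : IsLineProduct N V) {i j : Bool × Bool} {q : N} (hq : q ∈ (V i).source)
    (hq' : q ∈ (V j).source) :
    V j q = (lineChange i.1 j.1 (V i q).1, lineChange i.2 j.2 (V i q).2) := by
  have h1 := (h.source' j hq).1 hq'
  rw [← h.eq i j _ h1.1 h1.2, (V i).left_inv hq]

theorem patch_mem (h : IsLineProduct N V) (z : ℂ × ℂ) :
    N.patch z ∈ (V (false, false)).source ∧ V (false, false) (N.patch z) = z := by
  have hu : z ∈ (V (false, false)).target := by simp [h.target]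
  rw [h.patch]
  exact ⟨(V _).map_target hu, (V _).right_inv hu⟩

theorem mem_range (h : IsLineProduct N V) {q : N} (hq : q ∈ (V (false, false)).source) :
    q ∈ range N.patch :=
  ⟨V (false, false) q, by rw [h.patch, (V _).left_inv hq]⟩

theorem left (h : IsLineProduct N V) :
    IsSideBase N (fun z => z) (V (true, false)) (V (true, true)) where
  w_mem := h.mem _
  w_target := h.target _
  d_w q hq := by
    rw [h.source' _ hq]
    simp [lineDom]
  d_eq q hq hq' := by
    rw [h.eq' hq' hq]
    simp [lineChange]
  w_d q hq hy := by
    rw [h.source' _ hq]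
    simpa [lineDom] using hy
  patch_w z := by
    rw [h.source' _ (h.patch_mem z).1, (h.patch_mem z).2]
    simp [lineDom]
  patch_eq z hz := by
    rw [h.eq' (h.patch_mem z).1 hz, (h.patch_mem z).2]
    simp [lineChange]
  patch_d z hz := by
    rw [h.source' _ (h.patch_mem z).1, (h.patch_mem z).2] at hz
    simpa [lineDom] using hz
  w_patch q hq hx := by
    refine h.mem_range ?_
    rw [h.source' _ hq]
    simpa [lineDom] using hx

theorem right (h : IsLineProduct N V) {w d : OpenPartialHomeomorph N (ℂ × ℂ)} (hw : w ∈ Coord N)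
    (ht : w.target = univ) (sw : w.source = (V (false, true)).source)
    (vw : ∀ q, w q = ((V (false, true) q).2, (V (false, true) q).1))
    (sd : d.source = (V (true, true)).source)
    (vd : ∀ q, d q = ((V (true, true) q).2, (V (true, true) q).1)) :
    IsSideBase N (fun z => (z.2, z.1)) w d where
  w_mem := hw
  w_target := ht
  d_w q hq := by
    rw [sd] at hq
    rw [sw, h.source' _ hq, vd]
    simp [lineDom]
  d_eq q hq hq' := by
    rw [sd] at hq
    rw [sw] at hq'
    rw [vd, h.eq' hq' hq, vw]
    simp [lineChange]
  w_d q hq hy := by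
    rw [sw] at hq
    rw [vw] at hy
    rw [sd, h.source' _ hq]
    simpa [lineDom] using hy
  patch_w z := by
    rw [sw, h.source' _ (h.patch_mem z).1, (h.patch_mem z).2]
    simp [lineDom]
  patch_eq z hz := by
    rw [sw] at hz
    rw [vw, h.eq' (h.patch_mem z).1 hz, (h.patch_mem z).2]
    simp [lineChange]
  patch_d z hz := by
    rw [sd, h.source' _ (h.patch_mem z).1, (h.patch_mem z).2] at hz
    simpa [lineDom, and_comm] using hz
  w_patch q hq hx := by
    rw [sw] at hq
    rw [vw] at hx
    refine h.mem_range ?_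
    rw [h.source' _ hq]
    simpa [lineDom] using hx

end IsLineProduct

/-- The list of modifications leads to a surface with two towers. -/
theorem exists_isTwoSided {α β α' β' : ℂ} (hα : α ≠ 0) (hα' : α' ≠ 0) {γ₁ γ₂ δ : ℂ → ℂ × ℂ}
    (hγ₁ : ∀ s, s ≠ 0 → γ₁ s = (α / s ^ 2 - β / s, s))
    (hγ₂ : ∀ s, s ≠ 0 → γ₂ s = (s, α' / s ^ 2 - β' / s))
    (hδ : ∀ s, s ≠ 0 → δ s = (1 / s, 1 / s)) :
    ∃ M₀ M : MarkedSurface, IsProjectivePlane M₀ ∧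
      Arises ([.blowUp γ₁, .blowUp γ₂, .blowDown δ] ++ (List.replicate 4 (.blowUp γ₁) ++
        (List.replicate 4 (.blowUp γ₂) ++ []))) M₀ M ∧
      ∃ O O' F F' b b' cn cn' d d',
        IsTwoSided M (fun z => z) (fun z => (z.2, z.1)) α⁻¹ (β / α ^ 2) (-1) α'⁻¹ (β' / α' ^ 2) 1
          O O' F F' b b' cn cn' d d' := by
  obtain ⟨M₀, M₁, M₂, N, V, hM₀, hM₁, hM₂, hN, hdense, V1, V2, V3, V4, V5, V6⟩ :=
    exists_planeToLineProduct (γ₁ := γ₁) (γ₂ := γ₂) (δ := δ)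
      (by
        filter_upwards [(tendsto_curve β hα).1, self_mem_nhdsWithin] with s hs hs0
        rwa [hγ₁ s hs0])
      ((tendsto_curve β hα).2.congr' (by
        filter_upwards [self_mem_nhdsWithin] with s hs0
        rw [hγ₁ s hs0]))
      ((tendsto_id.mono_left nhdsWithin_le_nhds).congr' (by
        filter_upwards [self_mem_nhdsWithin] with s hs0
        rw [hγ₁ s hs0]
        rfl))
      (by
        filter_upwards [(tendsto_curve β' hα').1, self_mem_nhdsWithin] with s hs hs0
        rwa [hγ₂ s hs0])
      ((tendsto_id.mono_left nhdsWithin_le_nhds).congr' (by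
        filter_upwards [self_mem_nhdsWithin] with s hs0
        rw [hγ₂ s hs0]
        rfl))
      ((tendsto_curve β' hα').2.congr' (by
        filter_upwards [self_mem_nhdsWithin] with s hs0
        rw [hγ₂ s hs0])) hδ
  have L : IsLineProduct N V := ⟨V1, V2, V3, V4, V5, V6⟩
  obtain ⟨w, hw, sw, tw, vw, iw⟩ := exists_coord_swap (V1 (false, true)) (V2 _)
  obtain ⟨dd, hdd, sd, td, vd, -⟩ := exists_coord_swap (V1 (true, true)) (V2 _)
  have B := L.left
  have B' := L.right hw tw sw vw sd vd
  obtain ⟨e, he, se, te, ve, ze⟩ := B.exists_shear α⁻¹ (β / α ^ 2)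
  obtain ⟨e', he', se', te', ve', ze'⟩ := B'.exists_shear α'⁻¹ (β' / α' ^ 2)
  -- The centre `(∞, 0)` is not in the chart `(y⁻¹, x)`, nor `(0, ∞)` in `(x⁻¹, y)`, so the two
  -- towers do not interfere.
  have hpw : e.symm 0 ∉ w.source := by
    rw [ze, sw, V5]
    simp [lineDom]
  have hpw' : e'.symm 0 ∉ (V (true, false)).source := by
    rw [ze', iw, V5]
    simp [lineDom]
  obtain ⟨g1, g2⟩ := B.eventually_curve hα se ve hγ₁
  obtain ⟨S₁, π₁, b, cn, T, Mf, A⟩ := exists_tower he te (by rw [ze]; exact B.patch_ne) g1 g2 4 le_rfl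
  obtain ⟨e₁, he₁, se₁, te₁, ve₁⟩ := Mf.lift e' he' (by
    rintro _ rfl
    rwa [se'])
  have hz₁ : π₁ (e₁.symm 0) = e'.symm 0 := by
    have h0 : (0 : ℂ × ℂ) ∈ e₁.target := by simp [te₁, te']
    have h1 := e₁.map_target h0
    rw [se₁] at h1
    rw [← e'.left_inv h1, ← ve₁, e₁.right_inv h0]
  obtain ⟨g1', g2'⟩ := B'.eventually_curve hα' se' ve' (γ := γ₂) fun s hs => by rw [hγ₂ s hs]
  obtain ⟨M, π₂, b', cn', T', Mf', A'⟩ := exists_tower (n := 4) (γ := γ₂) he₁ (te₁.trans te')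
    (fun z hz => B'.patch_ne z (by rw [← ze', ← hz₁, ← hz, Mf.patch])) g1' (by
      filter_upwards [g2'] with s hs
      have h0 : ∀ z, z ∈ e'.target := fun z => by simp [te']
      have h1 : S₁.patch (γ₂ s) ∈ e₁.source := by
        rw [se₁, mem_preimage, Mf.patch, hs]
        exact e'.map_target (h0 _)
      rw [← e₁.left_inv h1, ve₁, Mf.patch, hs, e'.right_inv (h0 _)]) le_rfl
  -- The first tower lifts past the later blow-ups, whose centres lie over a point outside its
  -- domain.
  obtain ⟨b₁, cn₁, T₁⟩ := T.lift Mf' (by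
    rintro _ rfl
    rwa [mem_preimage, hz₁, se])
  have R : IsModif (fun q => π₁ (π₂ q)) {e.symm 0, e'.symm 0} := Mf.comp Mf'
    (by simp) (by rintro _ rfl; simp [hz₁])
  have hpd : e.symm 0 ∉ (V (true, true)).source := ze ▸ B.zero_notMem_d
  have hpd' : e'.symm 0 ∉ (V (true, true)).source := by
    rw [← sd, ze']
    exact B'.zero_notMem_d
  obtain ⟨d, hd, sd₁, td₁, vd₁⟩ := R.lift _ (V1 (true, true)) (by
    rintro _ (rfl | rfl)
    exacts [hpd, hpd'])
  obtain ⟨d', hd', sd₂, td₂, vd₂⟩ := R.lift dd hdd (by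
    rintro _ (rfl | rfl)
    · rwa [sd]
    · rwa [sd])
  -- The sign is that of `d(x⁻¹) ∧ dy = -x⁻² dx ∧ dy`. On the other side `d(y⁻¹) ∧ dx = y⁻² dx ∧
  -- dy`: the exchange of the coordinates changes the sign once more, so `ε = 1`.
  have hleft := B.isSide (inv_ne_zero hα) (ε := -1) (by norm_num) (fun z hz => ⟨_,
    hasFDerivAt_planeMap (a := -(z.1 ^ 2)⁻¹) (b := 0) (c := 0) (d := 1)
      ((hasDerivAt_inv hz).comp_hasFDerivAt z hasFDerivAt_fst) hasFDerivAt_snd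
      (by simp) (by simp) (by simp) (by simp), by rw [det_planeMap]; simp⟩)
    ve R.patch (se ▸ T₁) hd (td₁.trans (V2 _)) sd₁ vd₁
  have hright := B'.isSide (inv_ne_zero hα') (ε := 1) one_ne_zero (fun z hz => ⟨_,
    hasFDerivAt_planeMap (a := 0) (b := -(z.2 ^ 2)⁻¹) (c := 1) (d := 0)
      ((hasDerivAt_inv hz).comp_hasFDerivAt z hasFDerivAt_snd) hasFDerivAt_fst
      (by simp) (by simp) (by simp) (by simp), by rw [det_planeMap]; simp⟩)
    ve' R.patch (d' := d') (b := b') (cn := cn') (ρ := fun q => π₁ (π₂ q)) (by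
      have h1 : (fun q => e₁ (π₂ q)) = fun q => e' (π₁ (π₂ q)) := funext fun q => ve₁ _
      rw [← se', ← h1]
      rw [se₁] at T'
      exact T') hd' (td₂.trans td) sd₂ vd₂
  have hlift : ∀ q : M, π₁ (π₂ q) ∈ (V (false, false)).source → q ∈ range M.patch := by
    intro q hq
    obtain ⟨z, hz⟩ := L.mem_range hq
    refine ⟨z, (R.inj _ _ ((R.patch z).trans hz) ?_)⟩
    rw [R.patch]
    rintro (h | h)
    · exact B.patch_ne z (h.trans ze)
    · exact B'.patch_ne z (h.trans ze')
  have hF0 : ∀ q : N, e q = 0 → q ∈ e.source → q = e.symm 0 := fun q h0 hq => by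
    rw [← h0, e.left_inv hq]
  have hF0' : ∀ q : N, e' q = 0 → q ∈ e'.source → q = e'.symm 0 := fun q h0 hq => by
    rw [← h0, e'.left_inv hq]
  have hr : ∀ q : M, π₁ (π₂ q) ∈ (V (true, false)).source →
      lineEq α⁻¹ (β / α ^ 2) (e (π₁ (π₂ q))) ≠ 0 → q ∈ range M.patch := by
    intro q hq h0
    rw [(ve _).1] at h0
    obtain ⟨z, hz⟩ := B.w_patch _ hq h0
    exact hlift q (hz ▸ (L.patch_mem z).1)
  refine ⟨M₀, M, hM₀, ⟨M₁, hM₁, M₂, hM₂, N, hN, A _ _ (A' _ _ rfl)⟩, _, _, _, _, _, _, _, _, _, _,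
    ⟨hleft, hright, ?_, ?_, ?_, ?_, ?_, hr, R.dense hdense⟩⟩
  · rw [sd₁, sd₂, sd]
  · intro q
    rw [vd₂, vd₁, vd]
  · intro q hq h0 hq'
    rw [mem_preimage, hF0 _ h0 (by rw [se]; exact hq)] at hq'
    exact hpw hq'
  · intro q hq h0 hq'
    rw [mem_preimage, hF0' _ h0 (by rw [se']; exact hq)] at hq'
    exact hpw' hq'
  -- A point of the chart `(x⁻¹, y)` lies in the patch if `x⁻¹ ≠ 0`, in the chart `(x⁻¹, y⁻¹)` if `y
  -- ≠ 0`, and is the centre otherwise.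
  · have hside : ∀ {sp : ℂ × ℂ → ℂ × ℂ} {w d e : OpenPartialHomeomorph N (ℂ × ℂ)} {a c : ℂ} {q : N},
        IsSideBase N sp w d → (∀ q, lineEq a c (e q) = (w q).1 ∧ (e q).2 = (w q).2) →
        q ∈ w.source → q ∈ (V (false, false)).source ∨ q ∈ d.source ∨ e q = 0 := by
      intro sp w d e a c q H ve hq
      by_cases h1 : (w q).1 = 0
      · by_cases h2 : (w q).2 = 0
        · right; right
          obtain ⟨h3, h4⟩ := ve q
          rw [h2] at h4
          rw [lineEq, h4, h1] at h3
          exact Prod.ext (by simpa using h3) h4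
        · exact Or.inr (Or.inl (H.w_d q hq h2))
      · obtain ⟨z, rfl⟩ := H.w_patch q hq h1
        exact Or.inl (L.patch_mem z).1
    intro q
    rw [sd₁]
    obtain ⟨⟨_ | _, _ | _⟩, hi⟩ := L.cover (π₁ (π₂ q))
    · exact Or.inl (hlift q hi)
    · rw [← sw] at hi
      rcases hside B' ve' hi with h | h | h
      · exact Or.inl (hlift q h)
      · rw [sd] at h
        exact Or.inr (Or.inl h)
      · exact Or.inr (Or.inr (Or.inr ⟨hi, h⟩))
    · rcases hside B ve hi with h | h | h
      · exact Or.inl (hlift q h)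
      · exact Or.inr (Or.inl h)
      · exact Or.inr (Or.inr (Or.inl ⟨hi, h⟩))
    · exact Or.inr (Or.inl hi)

/-! ### The affine patches of the complement of the boundary -/

/-- A further affine patch: it extends `(x + β / y - α / y ^ 2, y)` to `y = 0`. -/
theorem IsSide.exists_patch {M : MarkedSurface} {sp : ℂ × ℂ → ℂ × ℂ} {α β ε : ℂ} {O : Set M}
    {F : M → ℂ × ℂ} {b : ℕ → OpenPartialHomeomorph M (ℂ × ℂ)}
    {cn d : OpenPartialHomeomorph M (ℂ × ℂ)} (hα : α ≠ 0)
    (h : IsSide M sp α⁻¹ (β / α ^ 2) ε O F b cn d)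
    (hsp : ContDiff ℂ ω sp) (hsp' : ∀ z, sp (sp z) = z) : ∃ e ∈ Coord M, e.target = univ ∧
      (∀ w, (sp w).2 ≠ 0 →
        e.symm ((sp w).1 + β / (sp w).2 - α / (sp w).2 ^ 2, (sp w).2) = M.patch w) ∧
      (∀ x, e.symm (x, 0) ∈ cn.source ∧ (cn (e.symm (x, 0))).2 = 0) ∧
      ∀ q ∈ cn.source, (cn q).2 = 0 → ∃ x, e.symm (x, 0) = q := by
  obtain ⟨A, hA, tA, pA⟩ := M.isPatch
  have T := h.tower
  have hu : ∀ z, z ∈ A.target := fun z => by simp [tA]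
  have hcu : ∀ z, z ∈ cn.target := fun z => by simp [T.cn_target]
  set a := α⁻¹ with ha
  set c := β / α ^ 2 with hc
  -- In `cn = (u, y)` one has `x⁻¹ = y² m(u, y)`, and in terms of `x₁` one has `x = n(x₁, y) / y²`.
  -- So the two coordinate systems are related by `m n = 1`.
  let m : ℂ × ℂ → ℂ := fun z => a + c * z.2 + z.1 * z.2 ^ 2
  let n : ℂ × ℂ → ℂ := fun z => α - β * z.2 + z.1 * z.2 ^ 2
  have hmc : ContDiff ℂ ω m := by fun_prop
  have hnc : ContDiff ℂ ω n := by fun_prop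
  -- From `x = 1/(y² m)` follows `x₁ = (1 + (β y - α) m)/(y² m)`. In the numerator the terms of
  -- order `0` and `1` in `y` cancel because `α a = 1` and `β a = α c`, leaving `f` after division
  -- by `y²`. This is where the two coefficients of the shear are needed. The inverse `g` is
  -- obtained in the same way from `m = 1 / n`.
  let f : ℂ × ℂ → ℂ × ℂ := fun z => ((c * β - z.1 * (α - β * z.2)) / m z, z.2)
  let g : ℂ × ℂ → ℂ × ℂ := fun z => ((c * β - (a + c * z.2) * z.1) / n z, z.2)
  have hnf : ∀ z, m z ≠ 0 → n (f z) * m z = 1 := by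
    intro z hz
    simp only [n, f]
    have h1 : (α - β * z.2 + (c * β - z.1 * (α - β * z.2)) / m z * z.2 ^ 2) * m z =
        (α - β * z.2) * m z + (c * β - z.1 * (α - β * z.2)) * z.2 ^ 2 := by
      field_simp
    rw [h1]
    simp only [m, ha, hc]
    field_simp
    ring
  have hmg : ∀ z, n z ≠ 0 → m (g z) * n z = 1 := by
    intro z hz
    simp only [m, g]
    have h1 : (a + c * z.2 + (c * β - (a + c * z.2) * z.1) / n z * z.2 ^ 2) * n z =
        (a + c * z.2) * n z + (c * β - (a + c * z.2) * z.1) * z.2 ^ 2 := by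
      field_simp
    rw [h1]
    simp only [n, ha, hc]
    field_simp
    ring
  have hgf : ∀ z, m z ≠ 0 → g (f z) = z := by
    intro z hz
    refine Prod.ext ?_ rfl
    have h1 := hnf z hz
    have h2 : (f z).1 * m z = c * β - z.1 * (α - β * z.2) := div_mul_cancel₀ _ hz
    have h3 : n (f z) ≠ 0 := left_ne_zero_of_mul (h1.trans_ne one_ne_zero)
    show (c * β - (a + c * z.2) * (f z).1) / n (f z) = z.1
    rw [div_eq_iff h3]
    refine mul_right_cancel₀ hz ?_
    rw [mul_assoc, h1]
    have h4 : (c * β - (a + c * z.2) * (f z).1) * m z =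
        c * β * m z - (a + c * z.2) * ((f z).1 * m z) := by ring
    rw [h4, h2]
    simp only [m, ha, hc]
    field_simp
    ring
  have hfg : ∀ z, n z ≠ 0 → f (g z) = z := by
    intro z hz
    refine Prod.ext ?_ rfl
    have h1 := hmg z hz
    have h2 : (g z).1 * n z = c * β - (a + c * z.2) * z.1 := div_mul_cancel₀ _ hz
    have h3 : m (g z) ≠ 0 := left_ne_zero_of_mul (h1.trans_ne one_ne_zero)
    show (c * β - (g z).1 * (α - β * z.2)) / m (g z) = z.1
    rw [div_eq_iff h3]
    refine mul_right_cancel₀ hz ?_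
    rw [mul_assoc, h1]
    have h4 : (c * β - (g z).1 * (α - β * z.2)) * n z =
        c * β * n z - (α - β * z.2) * ((g z).1 * n z) := by ring
    rw [h4, h2]
    simp only [n, ha, hc]
    field_simp
    ring
  obtain ⟨f₁, hf₁, s₁, t₁, v₁, i₁⟩ := exists_coord_comp T.cn_mem T.cn_target
    (s := {z | m z ≠ 0}) (t := {z | n z ≠ 0}) (f := f) (g := g)
    (isOpen_ne.preimage hmc.continuous) (isOpen_ne.preimage hnc.continuous)
    (fun z hz => left_ne_zero_of_mul ((hnf z hz).trans_ne one_ne_zero))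
    (fun z hz => left_ne_zero_of_mul ((hmg z hz).trans_ne one_ne_zero)) hgf hfg
    (ContDiffOn.prodMk (ContDiffOn.div (by fun_prop) hmc.contDiffOn fun _ h => h) (by fun_prop))
    (ContDiffOn.prodMk (ContDiffOn.div (by fun_prop) hnc.contDiffOn fun _ h => h) (by fun_prop))
  obtain ⟨f₂, hf₂, s₂, t₂, v₂, i₂⟩ := exists_coord_comp hA tA
    (s := {w | (sp w).2 ≠ 0}) (t := {z | z.2 ≠ 0})
    (f := fun w => ((sp w).1 + β / (sp w).2 - α / (sp w).2 ^ 2, (sp w).2))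
    (g := fun z => sp (z.1 - β / z.2 + α / z.2 ^ 2, z.2))
    (isOpen_ne.preimage (continuous_snd.comp hsp.continuous)) (isOpen_ne.preimage continuous_snd)
    (fun w hw => hw) (fun z hz => by simpa [hsp'] using hz)
    (fun w hw => by
      simp only []
      rw [← hsp' w, hsp' (sp w)]
      congr 1
      refine Prod.ext ?_ rfl
      simp only []
      ring)
    (fun z hz => by
      simp only [hsp']
      refine Prod.ext ?_ rfl
      simp only []
      ring)
    (by
      have h1 : ContDiff ℂ ω fun w => (sp w).1 := contDiff_fst.comp hsp
      have h2 : ContDiff ℂ ω fun w => (sp w).2 := contDiff_snd.comp hsp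
      refine ContDiffOn.prodMk ((h1.contDiffOn.add (contDiffOn_const.div h2.contDiffOn
        fun _ h => h)).sub (contDiffOn_const.div (h2.pow 2).contDiffOn fun w hw => pow_ne_zero 2 hw))
        h2.contDiffOn)
    (by
      refine hsp.comp_contDiffOn (ContDiffOn.prodMk (ContDiffOn.add (ContDiffOn.sub (by fun_prop)
        (contDiffOn_const.div (by fun_prop) fun _ h => h))
        (contDiffOn_const.div (by fun_prop) fun z hz => pow_ne_zero 2 hz)) (by fun_prop)))
  have hcn : ∀ q ∈ cn.source, lineEq a c (F q) = (cn q).2 ^ 2 * m (cn q) := fun q hq => by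
    rw [T.cn_eq q hq, lineEq]
    ring
  -- The targets `n ≠ 0` and `y ≠ 0` cover `ℂ²`, because `n = α ≠ 0` on `y = 0`.
  obtain ⟨e, he, -, te, -, -, ie₁, ie₂⟩ := exists_coord_union hf₁ hf₂ (by
    intro q hq hq'
    obtain ⟨hq1, hq2⟩ := (s₁ q).1 hq
    obtain ⟨hq3, hq4⟩ := (s₂ q).1 hq'
    have hw : M.patch (A q) = q := by rw [← pA, A.left_inv hq3]
    have hO := T.cn_sub q hq1
    rw [v₁, v₂]
    have h1 := h.patch_fst (A q) (by rw [hw]; exact hO)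
    have h2 := h.patch_snd (A q) (by rw [hw]; exact hO)
    rw [hw] at h1 h2
    rw [hcn q hq1] at h1
    rw [T.cn_eq q hq1] at h2
    refine Prod.ext ?_ h2
    simp only [mem_ofPred_eq] at hq2 hq4 h2
    rw [← h2] at hq4
    have h3 : (sp (A q)).1 = ((cn q).2 ^ 2 * m (cn q))⁻¹ := by rw [h1, inv_inv]
    simp only [f]
    rw [h3, ← h2, div_eq_iff hq2]
    have h4 : (((cn q).2 ^ 2 * m (cn q))⁻¹ + β / (cn q).2 - α / (cn q).2 ^ 2) * m (cn q) =
        (1 + (β * (cn q).2 - α) * m (cn q)) / (cn q).2 ^ 2 := by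
      field_simp
      ring
    rw [h4, eq_div_iff (pow_ne_zero 2 hq4)]
    simp only [m, ha, hc]
    field_simp
    ring) (by
    intro z hz hz'
    rw [t₁] at hz
    rw [t₂] at hz'
    have hz1 : z.2 ≠ 0 := hz'
    rw [i₂, pA]
    have hx : z.1 - β / z.2 + α / z.2 ^ 2 = n z / z.2 ^ 2 := by
      simp only [n]
      field_simp
      ring
    have hO : M.patch (sp (z.1 - β / z.2 + α / z.2 ^ 2, z.2)) ∈ O := by
      rw [h.patch_O, hsp', hx]
      exact div_ne_zero hz (pow_ne_zero 2 hz1)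
    have hq : M.patch (sp (z.1 - β / z.2 + α / z.2 ^ 2, z.2)) ∈ cn.source := by
      refine T.mem_cn _ hO ?_
      rw [h.patch_snd _ hO, hsp']
      exact hz1
    refine (s₁ _).2 ⟨hq, ?_⟩
    have h1 := h.lineEq_patch_ne hO
    rw [hcn _ hq] at h1
    exact right_ne_zero_of_mul h1)
  have h0 : ∀ x : ℂ, (x, (0 : ℂ)) ∈ f₁.target := fun x => by
    rw [t₁]
    simpa [n] using hα
  have hg0 : ∀ x : ℂ, g (x, 0) = ((c * β - a * x) / α, 0) := fun x => by simp [g, n]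
  refine ⟨e, he, ?_, fun w hw => ?_, fun x => ?_, fun q hq hq0 => ?_⟩
  · rw [te, t₁, t₂, eq_univ_iff_forall]
    intro z
    by_cases hz : z.2 = 0
    · left
      simpa [n, hz] using hα
    · exact Or.inr hz
  · rw [ie₂ _ (by rw [t₂]; exact hw), i₂, pA]
    simp only []
    congr 1
    rw [← hsp' w, hsp' (sp w)]
    congr 1
    refine Prod.ext ?_ rfl
    simp only []
    ring
  · rw [ie₁ _ (h0 x), i₁, cn.right_inv (hcu _)]
    exact ⟨cn.map_target (hcu _), rfl⟩
  -- The solution of `(c β - a x) / α = (cn q).1`: on `y = 0` the change of coordinates is affine.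
  · refine ⟨(c * β - α * (cn q).1) / a, ?_⟩
    rw [ie₁ _ (h0 _), i₁, hg0, mul_div_cancel₀ _ (inv_ne_zero hα), sub_sub_cancel,
      mul_div_cancel_left₀ _ hα]
    conv_rhs => rw [← cn.left_inv hq]
    rw [← hq0]

/-! ### The coordinate changes -/

namespace Data

variable (P : Data)

/-- The coefficient `c₂ exp(c₁ t) / √r(t)`. -/
def expCoeff (t : ℂ) : ℂ := P.c₂ * Complex.exp (P.c₁ * t) / P.sqrtR t

theorem toChart_one (t : ℂ) (z : ℂ × ℂ) : P.toChart 1 t z =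
    (z.1 + (2 * (1 + Complex.I) * P.c₁ / z.2 - 2 * P.expCoeff t / z.2 ^ 2), z.2) := by
  refine Prod.ext ?_ rfl
  simp only [toChart, expCoeff]
  rw [← add_sub_assoc, ← div_div]
  congr 2
  ring

theorem ofChart_one (t : ℂ) (z : ℂ × ℂ) : P.ofChart 1 t z =
    (z.1 - (2 * (1 + Complex.I) * P.c₁ / z.2 - 2 * P.expCoeff t / z.2 ^ 2), z.2) := by
  refine Prod.ext ?_ rfl
  simp only [ofChart, expCoeff]
  rw [← sub_add, ← div_div]
  congr 2
  ring

theorem toChart_two (t : ℂ) (z : ℂ × ℂ) : P.toChart 2 t z =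
    (z.1, z.2 + (2 * Complex.I * P.c₁ / z.1 + 2 * P.sqrtNegR t / z.1 ^ 2)) := by
  rw [← add_assoc]
  rfl

theorem ofChart_two (t : ℂ) (z : ℂ × ℂ) : P.ofChart 2 t z =
    (z.1, z.2 - (2 * Complex.I * P.c₁ / z.1 + 2 * P.sqrtNegR t / z.1 ^ 2)) := by
  rw [← sub_sub]
  rfl

theorem toChart_mem (k : Fin 3) (t : ℂ) {z : ℂ × ℂ} (hz : z ∈ dom k) : P.toChart k t z ∈ dom k := by
  fin_cases k <;> exact hz

theorem ofChart_mem (k : Fin 3) (t : ℂ) {z : ℂ × ℂ} (hz : z ∈ dom k) : P.ofChart k t z ∈ dom k := by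
  fin_cases k <;> exact hz

/-- The shift depends only on the coordinate that is kept, so adding and subtracting it are inverse
even where division by zero gives a default value; no domain condition is needed. -/
theorem ofChart_toChart (k : Fin 3) (t : ℂ) (z : ℂ × ℂ) : P.ofChart k t (P.toChart k t z) = z := by
  fin_cases k
  · rfl
  · change P.ofChart 1 t (P.toChart 1 t z) = z
    rw [toChart_one, ofChart_one, add_sub_cancel_right]
  · change P.ofChart 2 t (P.toChart 2 t z) = z
    rw [toChart_two, ofChart_two, add_sub_cancel_right]

theorem toChart_ofChart (k : Fin 3) (t : ℂ) (z : ℂ × ℂ) : P.toChart k t (P.ofChart k t z) = z := by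
  fin_cases k
  · rfl
  · change P.toChart 1 t (P.ofChart 1 t z) = z
    rw [ofChart_one, toChart_one, sub_add_cancel]
  · change P.toChart 2 t (P.ofChart 2 t z) = z
    rw [ofChart_two, toChart_two, sub_add_cancel]

theorem bijOn_toChart (k : Fin 3) (t : ℂ) : BijOn (P.toChart k t) (dom k) (dom k) ∧
    InvOn (P.ofChart k t) (P.toChart k t) (dom k) (dom k) := by
  have h : InvOn (P.ofChart k t) (P.toChart k t) (dom k) (dom k) :=
    ⟨fun z _ => P.ofChart_toChart k t z, fun z _ => P.toChart_ofChart k t z⟩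
  exact ⟨h.bijOn (fun _ hz => P.toChart_mem k t hz) fun _ hz => P.ofChart_mem k t hz, h⟩

section Holomorphic

variable {P} {B : Set ℂ}

theorem sqrtR_ne (hr0 : ∀ t ∈ B, P.r t ≠ 0) (hs2 : ∀ t ∈ B, P.sqrtR t ^ 2 = P.r t) {t : ℂ}
    (ht : t ∈ B) : P.sqrtR t ≠ 0 := fun h => hr0 t ht (by rw [← hs2 t ht, h]; simp)

theorem sqrtNegR_ne (hr0 : ∀ t ∈ B, P.r t ≠ 0) (hn2 : ∀ t ∈ B, P.sqrtNegR t ^ 2 = -P.r t) {t : ℂ}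
    (ht : t ∈ B) : P.sqrtNegR t ≠ 0 := fun h => hr0 t ht (by
      rw [← neg_eq_zero, ← hn2 t ht, h]; simp)

theorem expCoeff_ne (hr0 : ∀ t ∈ B, P.r t ≠ 0) (hs2 : ∀ t ∈ B, P.sqrtR t ^ 2 = P.r t)
    (hc₂ : P.c₂ ≠ 0) {t : ℂ} (ht : t ∈ B) : P.expCoeff t ≠ 0 :=
  div_ne_zero (mul_ne_zero hc₂ (Complex.exp_ne_zero _)) (sqrtR_ne hr0 hs2 ht)

theorem differentiableOn_expCoeff (hr0 : ∀ t ∈ B, P.r t ≠ 0) (hs : DifferentiableOn ℂ P.sqrtR B)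
    (hs2 : ∀ t ∈ B, P.sqrtR t ^ 2 = P.r t) : DifferentiableOn ℂ P.expCoeff B :=
  DifferentiableOn.div (by fun_prop) hs fun _ ht => sqrtR_ne hr0 hs2 ht

theorem contDiffOn_chartShift {n : WithTop ℕ∞} {f g : ℂ → ℂ} (hf : ContDiffOn ℂ n f B)
    (hg : ContDiffOn ℂ n g B) : ContDiffOn ℂ n (fun p : ℂ × ℂ => f p.2 / p.1 + g p.2 / p.1 ^ 2)
      ({0}ᶜ ×ˢ B) := by
  have h1 : ContDiffOn ℂ n (fun p : ℂ × ℂ => f p.2) ({0}ᶜ ×ˢ B) :=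
    hf.comp contDiffOn_snd fun p hp => hp.2
  have h2 : ContDiffOn ℂ n (fun p : ℂ × ℂ => g p.2) ({0}ᶜ ×ˢ B) :=
    hg.comp contDiffOn_snd fun p hp => hp.2
  exact (h1.div contDiffOn_fst fun p hp => hp.1).add
    (h2.div (contDiffOn_fst.pow 2) fun p hp => pow_ne_zero 2 hp.1)

/-- The coordinate changes and their inverses are holomorphic in all variables. -/
theorem contDiffOn_charts (hB : IsOpen B) (hr0 : ∀ t ∈ B, P.r t ≠ 0)
    (hs : DifferentiableOn ℂ P.sqrtR B) (hs2 : ∀ t ∈ B, P.sqrtR t ^ 2 = P.r t)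
    (hn : DifferentiableOn ℂ P.sqrtNegR B) (k : Fin 3) :
    ContDiffOn ℂ ω (fun p : (ℂ × ℂ) × ℂ => P.toChart k p.2 p.1) (dom k ×ˢ B) ∧
      ContDiffOn ℂ ω (fun p : (ℂ × ℂ) × ℂ => P.ofChart k p.2 p.1) (dom k ×ˢ B) := by
  have hg : ContDiffOn ℂ ω (fun t => -(2 * P.expCoeff t)) B :=
    DifferentiableOn.contDiffOn (((differentiableOn_expCoeff hr0 hs hs2).const_mul 2).neg) hB
  have hn' : ContDiffOn ℂ ω (fun t => 2 * P.sqrtNegR t) B :=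
    DifferentiableOn.contDiffOn (hn.const_mul 2) hB
  have h1 : ContDiffOn ℂ ω (fun p : (ℂ × ℂ) × ℂ => 2 * (1 + Complex.I) * P.c₁ / p.1.2 +
      -(2 * P.expCoeff p.2) / p.1.2 ^ 2) (dom 1 ×ˢ B) :=
    (contDiffOn_chartShift contDiffOn_const hg).comp
      (f := fun p : (ℂ × ℂ) × ℂ => (p.1.2, p.2)) (by fun_prop) fun p hp => ⟨hp.1, hp.2⟩
  have h2 : ContDiffOn ℂ ω (fun p : (ℂ × ℂ) × ℂ => 2 * Complex.I * P.c₁ / p.1.1 +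
      2 * P.sqrtNegR p.2 / p.1.1 ^ 2) (dom 2 ×ˢ B) :=
    (contDiffOn_chartShift contDiffOn_const hn').comp
      (f := fun p : (ℂ × ℂ) × ℂ => (p.1.1, p.2)) (by fun_prop) fun p hp => ⟨hp.1, hp.2⟩
  simp only [neg_div, ← sub_eq_add_neg] at h1
  fin_cases k
  · exact ⟨contDiffOn_fst, contDiffOn_fst⟩
  · change ContDiffOn ℂ ω (fun p : (ℂ × ℂ) × ℂ => P.toChart 1 p.2 p.1) (dom 1 ×ˢ B) ∧
      ContDiffOn ℂ ω (fun p : (ℂ × ℂ) × ℂ => P.ofChart 1 p.2 p.1) (dom 1 ×ˢ B)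
    simp only [toChart_one, ofChart_one]
    exact ⟨ContDiffOn.prodMk (ContDiffOn.add (by fun_prop) h1) (by fun_prop),
      ContDiffOn.prodMk (ContDiffOn.sub (by fun_prop) h1) (by fun_prop)⟩
  · change ContDiffOn ℂ ω (fun p : (ℂ × ℂ) × ℂ => P.toChart 2 p.2 p.1) (dom 2 ×ˢ B) ∧
      ContDiffOn ℂ ω (fun p : (ℂ × ℂ) × ℂ => P.ofChart 2 p.2 p.1) (dom 2 ×ˢ B)
    simp only [toChart_two, ofChart_two]
    exact ⟨ContDiffOn.prodMk (by fun_prop) (ContDiffOn.add (by fun_prop) h2),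
      ContDiffOn.prodMk (by fun_prop) (ContDiffOn.sub (by fun_prop) h2)⟩

end Holomorphic

theorem hasDerivAt_chartShift (b c : ℂ) {s : ℂ} (hs : s ≠ 0) :
    HasDerivAt (fun s => b / s + c / s ^ 2) (-b / s ^ 2 - 2 * c / s ^ 3) s := by
  have h1 := (hasDerivAt_const s b).div (hasDerivAt_id s) hs
  have h2 := (hasDerivAt_const s c).div (hasDerivAt_pow 2 s) (pow_ne_zero 2 hs)
  refine (h1.add h2).congr_deriv ?_
  simp only [id]
  field_simp
  ring

/-- For the same reason the derivative is triangular with ones on the diagonal. -/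
theorem det_toChart (k : Fin 3) (t : ℂ) {z : ℂ × ℂ} (hz : z ∈ dom k) :
    (fderiv ℂ (P.toChart k t) z).det = 1 := by
  fin_cases k
  · change (fderiv ℂ (fun z : ℂ × ℂ => z) z).det = 1
    rw [fderiv_fun_id]
    simp [ContinuousLinearMap.det]
  · change (fderiv ℂ (P.toChart 1 t) z).det = 1
    have h1 := hasDerivAt_chartShift (2 * (1 + Complex.I) * P.c₁) (-(2 * P.expCoeff t))
      (s := z.2) hz
    simp only [neg_div, ← sub_eq_add_neg] at h1
    have h2 : HasFDerivAt (P.toChart 1 t) (planeMap 1 _ 0 1) z :=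
      (funext (P.toChart_one t)) ▸ hasFDerivAt_planeMap
        (hasFDerivAt_fst.add (h1.comp_hasFDerivAt z hasFDerivAt_snd))
        hasFDerivAt_snd (by simp) rfl (by simp) (by simp)
    rw [h2.fderiv, det_planeMap]
    ring
  · change (fderiv ℂ (P.toChart 2 t) z).det = 1
    have h1 := hasDerivAt_chartShift (2 * Complex.I * P.c₁) (2 * P.sqrtNegR t) (s := z.1) hz
    have h2 : HasFDerivAt (P.toChart 2 t) (planeMap 1 0 _ 1) z :=
      (funext (P.toChart_two t)) ▸ hasFDerivAt_planeMap hasFDerivAt_fst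
        (hasFDerivAt_snd.add (h1.comp_hasFDerivAt z hasFDerivAt_fst)) (by simp) (by simp) rfl
        (by simp)
    rw [h2.fderiv, det_planeMap]
    ring

end Data

/-! ### The Hamiltonians in the three charts -/

open MvPolynomial in
/-- The polynomials `x²y²/2 + A x y + s y - h x`. -/
def quadHam (A s h : ℂ → ℂ) : TPoly :=
  C (fun _ => 1 / 2) * X 0 ^ 2 * X 1 ^ 2 + C A * X 0 * X 1 + C s * X 1 - C h * X 0

theorem hamField_quadHam (A s h : ℂ → ℂ) (t : ℂ) (z : ℂ × ℂ) : hamField (quadHam A s h) t z =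
    (z.1 ^ 2 * z.2 + A t * z.1 + s t, -(z.1 * z.2 ^ 2 + A t * z.2 - h t)) := by
  refine Prod.ext ?_ ?_
  · simp [hamField, quadHam, TPoly.val, Derivation.leibniz, MvPolynomial.pderiv_X]
    ring
  · simp [hamField, quadHam, TPoly.val, Derivation.leibniz, MvPolynomial.pderiv_X]
    ring

/-! ### Holomorphic coefficients of the Hamiltonians -/

section Coeff

variable {B : Set ℂ}

theorem differentiableOn_coeff_mul {K L : TPoly} (hK : ∀ m, DifferentiableOn ℂ (K.coeff m) B)
    (hL : ∀ m, DifferentiableOn ℂ (L.coeff m) B) (m) : DifferentiableOn ℂ ((K * L).coeff m) B := by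
  rw [MvPolynomial.coeff_mul]
  exact DifferentiableOn.sum fun p _ => (hK _).mul (hL _)

theorem differentiableOn_coeff_C {f : ℂ → ℂ} (hf : DifferentiableOn ℂ f B) (m) :
    DifferentiableOn ℂ ((MvPolynomial.C f : TPoly).coeff m) B := by
  rw [MvPolynomial.coeff_C]
  split_ifs
  · exact hf
  · exact differentiableOn_const 0

theorem differentiableOn_coeff_X (i : Fin 2) (m) :
    DifferentiableOn ℂ ((MvPolynomial.X i : TPoly).coeff m) B := by
  rw [MvPolynomial.coeff_X]
  split_ifs
  · exact differentiableOn_const 1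
  · exact differentiableOn_const 0

theorem differentiableOn_coeff_quadHam {A s h : ℂ → ℂ} (hA : DifferentiableOn ℂ A B)
    (hs : DifferentiableOn ℂ s B) (hh : DifferentiableOn ℂ h B) (m) :
    DifferentiableOn ℂ ((quadHam A s h).coeff m) B := by
  rw [quadHam, sq, sq, MvPolynomial.coeff_sub, MvPolynomial.coeff_add, MvPolynomial.coeff_add]
  have hX := differentiableOn_coeff_X (B := B)
  have hC : ∀ {f : ℂ → ℂ}, DifferentiableOn ℂ f B → _ := fun hf => differentiableOn_coeff_C hf
  exact (((differentiableOn_coeff_mul (differentiableOn_coeff_mul (hC (differentiableOn_const _))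
    (differentiableOn_coeff_mul (hX 0) (hX 0))) (differentiableOn_coeff_mul (hX 1) (hX 1)) m).add
    (differentiableOn_coeff_mul (differentiableOn_coeff_mul (hC hA) (hX 0)) (hX 1) m)).add
    (differentiableOn_coeff_mul (hC hs) (hX 1) m)).sub
    (differentiableOn_coeff_mul (hC hh) (hX 0) m)

end Coeff

namespace Data

variable (P : Data)

/-- The coefficients of `x y` in the Hamiltonians. -/
def mixedCoeff (b : ℂ) (t : ℂ) : ℂ := Complex.I * P.c₁ + deriv P.r t / (2 * P.r t) - b

/-- The Hamiltonians in the three charts. -/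
def chartHam : Fin 3 → TPoly :=
  ![P.hamiltonian,
    quadHam (P.mixedCoeff (2 * (1 + Complex.I) * P.c₁)) P.sqrtNegR fun t => -P.expCoeff t,
    quadHam (P.mixedCoeff (2 * Complex.I * P.c₁)) (fun t => -P.sqrtNegR t) P.expCoeff]

theorem hamiltonian_eq : P.hamiltonian = quadHam (P.mixedCoeff 0) P.sqrtNegR P.expCoeff := by
  have h : P.mixedCoeff 0 = fun t => Complex.I * P.c₁ + deriv P.r t / (2 * P.r t) :=
    funext fun t => sub_zero _
  rw [h]
  rfl

variable {P} {B : Set ℂ}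

theorem differentiableOn_coeff_chartHam (hB : IsOpen B) (hr : DifferentiableOn ℂ P.r B)
    (hr0 : ∀ t ∈ B, P.r t ≠ 0)
    (hs : DifferentiableOn ℂ P.sqrtR B) (hs2 : ∀ t ∈ B, P.sqrtR t ^ 2 = P.r t)
    (hn : DifferentiableOn ℂ P.sqrtNegR B) (k : Fin 3) (m) :
    DifferentiableOn ℂ ((P.chartHam k).coeff m) B := by
  have hA : ∀ b, DifferentiableOn ℂ (P.mixedCoeff b) B := fun b =>
    ((((hr.deriv hB).div (hr.const_mul 2) fun t ht =>
      mul_ne_zero two_ne_zero (hr0 t ht)).const_add (Complex.I * P.c₁)).sub_const b)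
  have hg := differentiableOn_expCoeff hr0 hs hs2
  fin_cases k
  · change DifferentiableOn ℂ (P.hamiltonian.coeff m) B
    rw [hamiltonian_eq]
    exact differentiableOn_coeff_quadHam (hA _) hn hg m
  · exact differentiableOn_coeff_quadHam (hA _) hn hg.neg m
  · exact differentiableOn_coeff_quadHam (hA _) hn.neg hg m

/-- The logarithmic derivative of a square root. -/
theorem hasDerivAt_of_sq {f r : ℂ → ℂ} (hB : IsOpen B) (hr : DifferentiableOn ℂ r B)
    (hf : DifferentiableOn ℂ f B) (h2 : ∀ t ∈ B, f t ^ 2 = r t) {t : ℂ} (ht : t ∈ B)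
    (h0 : r t ≠ 0) : HasDerivAt f (f t * (deriv r t / (2 * r t))) t := by
  have hf' := (hf.differentiableAt (hB.mem_nhds ht)).hasDerivAt
  have hr' := (hr.differentiableAt (hB.mem_nhds ht)).hasDerivAt
  have h3 := (hf'.pow 2).congr_of_eventuallyEq
    (show r =ᶠ[𝓝 t] f ^ 2 by filter_upwards [hB.mem_nhds ht] with s hs using (h2 s hs).symm)
  refine hf'.congr_deriv ?_
  rw [h3.unique hr' |>.symm, ← h2 t ht]
  have h4 : f t ≠ 0 := fun h => h0 (by rw [← h2 t ht, h]; simp)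
  field_simp
  simp
  ring

theorem hasDerivAt_expCoeff (hB : IsOpen B) (hr : DifferentiableOn ℂ P.r B)
    (hr0 : ∀ t ∈ B, P.r t ≠ 0) (hs : DifferentiableOn ℂ P.sqrtR B)
    (hs2 : ∀ t ∈ B, P.sqrtR t ^ 2 = P.r t) {t : ℂ} (ht : t ∈ B) :
    HasDerivAt P.expCoeff (P.expCoeff t * (P.c₁ - deriv P.r t / (2 * P.r t))) t := by
  have h1 := hasDerivAt_of_sq hB hr hs hs2 ht (hr0 t ht)
  have h2 := sqrtR_ne hr0 hs2 ht
  have h3 : HasDerivAt (fun t => P.c₂ * Complex.exp (P.c₁ * t))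
      (P.c₂ * (Complex.exp (P.c₁ * t) * P.c₁)) t := by
    simpa using (((hasDerivAt_id t).const_mul P.c₁).cexp).const_mul P.c₂
  refine (h3.div h1 h2).congr_deriv ?_
  rw [expCoeff]
  have h4 := hr0 t ht
  field_simp

theorem hasDerivAt_sqrtNegR (hB : IsOpen B) (hr : DifferentiableOn ℂ P.r B)
    (hr0 : ∀ t ∈ B, P.r t ≠ 0) (hn : DifferentiableOn ℂ P.sqrtNegR B)
    (hn2 : ∀ t ∈ B, P.sqrtNegR t ^ 2 = -P.r t) {t : ℂ} (ht : t ∈ B) :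
    HasDerivAt P.sqrtNegR (P.sqrtNegR t * (deriv P.r t / (2 * P.r t))) t := by
  have h1 := hasDerivAt_of_sq hB hr.neg hn hn2 ht (neg_ne_zero.2 (hr0 t ht))
  refine h1.congr_deriv ?_
  rw [deriv.neg, Pi.neg_apply, mul_neg, neg_div_neg_eq]

/-- After substitution the polar terms cancel, the double pole by means of the logarithmic
derivatives: with `A`, `h`, `s` the coefficients of the original Hamiltonian, it has the coefficient
`h (β - 2 A) - 2 h'` in the first chart and `s (β' - 2 A) + 2 s'` in the second. Both vanish for `β
= 2 (1 + i) c₁` and `β' = 2 i c₁`, by `hasDerivAt_expCoeff` and `hasDerivAt_sqrtNegR`. -/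
theorem hasDerivAt_toChart (hB : IsOpen B) (hr : DifferentiableOn ℂ P.r B)
    (hr0 : ∀ t ∈ B, P.r t ≠ 0) (hs : DifferentiableOn ℂ P.sqrtR B)
    (hs2 : ∀ t ∈ B, P.sqrtR t ^ 2 = P.r t) (hn : DifferentiableOn ℂ P.sqrtNegR B)
    (hn2 : ∀ t ∈ B, P.sqrtNegR t ^ 2 = -P.r t) (k : Fin 3) {t : ℂ} (ht : t ∈ B)
    {z : ℂ → ℂ × ℂ} (hz : z t ∈ dom k) (hd : HasDerivAt z (hamField P.hamiltonian t (z t)) t) :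
    HasDerivAt (fun τ => P.toChart k τ (z τ)) (hamField (P.chartHam k) t (P.toChart k t (z t))) t := by
  fin_cases k
  · exact hd
  · change HasDerivAt (fun τ => P.toChart 1 τ (z τ))
      (hamField (quadHam _ _ _) t (P.toChart 1 t (z t))) t
    have hy : (z t).2 ≠ 0 := hz
    rw [hamiltonian_eq, hamField_quadHam] at hd
    have hx := hasFDerivAt_fst.comp_hasDerivAt t hd
    have hy' := hasFDerivAt_snd.comp_hasDerivAt t hd
    have hg := (hasDerivAt_expCoeff hB hr hr0 hs hs2 ht).const_mul 2
    simp only [toChart_one, hamField_quadHam]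
    have h1 := hx.add (((hasDerivAt_const t (2 * (1 + Complex.I) * P.c₁)).div hy' hy).sub
      (hg.div (hy'.pow 2) (pow_ne_zero 2 hy)))
    refine (h1.prodMk hy').congr_deriv (Prod.ext ?_ ?_)
    · simp [mixedCoeff]
      field_simp
      ring
    · simp [mixedCoeff]
      field_simp
      ring
  · change HasDerivAt (fun τ => P.toChart 2 τ (z τ))
      (hamField (quadHam _ _ _) t (P.toChart 2 t (z t))) t
    have hx0 : (z t).1 ≠ 0 := hz
    rw [hamiltonian_eq, hamField_quadHam] at hd
    have hx := hasFDerivAt_fst.comp_hasDerivAt t hd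
    have hy' := hasFDerivAt_snd.comp_hasDerivAt t hd
    have hg := (hasDerivAt_sqrtNegR hB hr hr0 hn hn2 ht).const_mul 2
    simp only [toChart_two, hamField_quadHam]
    have h1 := hy'.add (((hasDerivAt_const t (2 * Complex.I * P.c₁)).div hx hx0).add
      (hg.div (hx.pow 2) (pow_ne_zero 2 hx0)))
    refine (hx.prodMk h1).congr_deriv (Prod.ext ?_ ?_)
    · simp [mixedCoeff]
      field_simp
      ring
    · simp [mixedCoeff]
      field_simp
      ring

end Data

/-! ### The glued space -/

namespace Data

section Glue

variable (P : Data) (B : Set ℂ)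

theorem glue_iff (a b : Fin 3 × ((ℂ × ℂ) × B)) : P.Glue B a b ↔ a.2.2 = b.2.2 ∧ a.2.1 ∈ dom a.1 ∧
    P.ofChart a.1 a.2.2 a.2.1 ∈ dom b.1 ∧
    P.toChart b.1 a.2.2 (P.ofChart a.1 a.2.2 a.2.1) = b.2.1 := by
  constructor
  · rintro ⟨ht, z, ⟨h1, h2⟩, h3, h4⟩
    rw [← h3, ofChart_toChart]
    exact ⟨ht, P.toChart_mem _ _ h1, h2, ht ▸ h4⟩
  · rintro ⟨ht, h1, h2, h3⟩
    exact ⟨ht, _, ⟨P.ofChart_mem _ _ h1, h2⟩, P.toChart_ofChart _ _ _, ht ▸ h3⟩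

/-- The gluing relation is symmetric, and transitive because a point in a chart determines `(x, y)`.
It is not reflexive: a point off `dom k` is not related to itself. Adding equality gives the
generated equivalence relation. -/
theorem mk_eq_mk_iff (a b : Fin 3 × ((ℂ × ℂ) × B)) :
    (Quot.mk (P.Glue B) a = Quot.mk (P.Glue B) b) ↔ a = b ∨ P.Glue B a b := by
  have key : ∀ a b, Relation.EqvGen (P.Glue B) a b → a = b ∨ P.Glue B a b := by
    intro a b h
    induction h with
    | rel _ _ h => exact Or.inr h
    | refl _ => exact Or.inl rfl
    | symm _ _ _ ih =>
      rcases ih with h | ⟨ht, z, hz, h1, h2⟩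
      · exact Or.inl h.symm
      · exact Or.inr ⟨ht.symm, z, hz.symm, h2, h1⟩
    | trans x y z _ _ ih1 ih2 =>
      rcases ih1 with rfl | h3
      · exact ih2
      · rcases ih2 with rfl | h4
        · exact Or.inr h3
        · obtain ⟨ht, u, hu, h5, h6⟩ := h3
          obtain ⟨ht', v, hv, h7, h8⟩ := h4
          have h9 : u = v := by
            rw [← P.ofChart_toChart y.1 y.2.2 u, h6, ← h7, ofChart_toChart]
          exact Or.inr ⟨ht.trans ht', u, ⟨hu.1, h9 ▸ hv.2⟩, h5, h9 ▸ h8⟩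
  refine ⟨fun h => key a b (Quot.eqvGen_exact h), ?_⟩
  rintro (rfl | h)
  · rfl
  · exact Quot.sound h

theorem incl_eq_incl_iff (k l : Fin 3) (p q : (ℂ × ℂ) × B) : P.incl B k p = P.incl B l q ↔
    (k = l ∧ p = q) ∨ (k ≠ l ∧ p.2 = q.2 ∧ p.1 ∈ dom k ∧ P.ofChart k p.2 p.1 ∈ dom l ∧
      P.toChart l p.2 (P.ofChart k p.2 p.1) = q.1) := by
  refine (P.mk_eq_mk_iff B (k, p) (l, q)).trans ?_
  rw [glue_iff, Prod.mk.injEq]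
  constructor
  · rintro (h | ⟨h1, h2, h3, h4⟩)
    · exact Or.inl h
    · by_cases hkl : k = l
      · subst hkl
        simp only [toChart_ofChart] at h4
        exact Or.inl ⟨rfl, Prod.ext h4 h1⟩
      · exact Or.inr ⟨hkl, h1, h2, h3, h4⟩
  · rintro (h | ⟨-, h⟩)
    · exact Or.inl h
    · exact Or.inr h

theorem incl_injective (k : Fin 3) : Function.Injective (P.incl B k) := fun p q h => by
  rcases (P.incl_eq_incl_iff B k k p q).1 h with h | h
  · exact h.2
  · exact absurd rfl h.1

theorem exists_incl (q : P.PhaseSpace B) : ∃ k p, P.incl B k p = q := by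
  obtain ⟨⟨k, p⟩, rfl⟩ := Quot.exists_rep q
  exact ⟨k, p, rfl⟩

theorem continuous_incl (k : Fin 3) : Continuous (P.incl B k) :=
  continuous_quot_mk.comp (continuous_const.prodMk continuous_id)

end Glue

variable {P : Data} {B : Set ℂ}

theorem isOpen_dom (k : Fin 3) : IsOpen (dom k) := by
  fin_cases k
  exacts [isOpen_univ, isOpen_ne.preimage continuous_snd, isOpen_ne.preimage continuous_fst]

theorem contDiffOn_transition
    (hB : IsOpen B) (hr0 : ∀ t ∈ B, P.r t ≠ 0) (hs : DifferentiableOn ℂ P.sqrtR B)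
    (hs2 : ∀ t ∈ B, P.sqrtR t ^ 2 = P.r t) (hn : DifferentiableOn ℂ P.sqrtNegR B) (k l : Fin 3) :
    IsOpen {p : (ℂ × ℂ) × ℂ | p ∈ dom k ×ˢ B ∧ P.ofChart k p.2 p.1 ∈ dom l} ∧
    ContDiffOn ℂ ω (fun p : (ℂ × ℂ) × ℂ => (P.toChart l p.2 (P.ofChart k p.2 p.1), p.2))
      {p | p ∈ dom k ×ˢ B ∧ P.ofChart k p.2 p.1 ∈ dom l} := by
  have h1 := (contDiffOn_charts hB hr0 hs hs2 hn k).2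
  have h2 := (contDiffOn_charts hB hr0 hs hs2 hn l).1
  refine ⟨h1.continuousOn.isOpen_inter_preimage ((isOpen_dom k).prod hB) (isOpen_dom l), ?_⟩
  refine ContDiffOn.prodMk (h2.comp (f := fun p : (ℂ × ℂ) × ℂ => (P.ofChart k p.2 p.1, p.2))
    ((h1.mono fun p hp => hp.1).prodMk contDiffOn_snd) fun p hp => ⟨hp.2, hp.1.2⟩) contDiffOn_snd

/-- The part of another copy glued to an open set is its preimage under a transition map, continuous
on an open domain. -/
theorem isOpenMap_incl
    (hB : IsOpen B) (hr0 : ∀ t ∈ B, P.r t ≠ 0) (hs : DifferentiableOn ℂ P.sqrtR B)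
    (hs2 : ∀ t ∈ B, P.sqrtR t ^ 2 = P.r t) (hn : DifferentiableOn ℂ P.sqrtNegR B) (k : Fin 3) : IsOpenMap (P.incl B k) := by
  intro U hU
  have hj : IsOpenEmbedding (Prod.map id Subtype.val : (ℂ × ℂ) × B → (ℂ × ℂ) × ℂ) :=
    IsOpenEmbedding.id.prodMap hB.isOpenEmbedding_subtypeVal
  refine isOpen_coinduced.2 ?_
  have h1 : ∀ l, IsOpen {p : (ℂ × ℂ) × B | P.incl B l p ∈ P.incl B k '' U} := by
    intro l
    by_cases hkl : l = k
    · subst hkl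
      convert hU using 1
      ext p
      constructor
      · rintro ⟨u, hu, h⟩
        exact P.incl_injective B l h ▸ hu
      · exact fun hp => ⟨p, hp, rfl⟩
    · obtain ⟨h2, h3⟩ := contDiffOn_transition hB hr0 hs hs2 hn l k
      have h4 := (h3.continuousOn.isOpen_inter_preimage h2 (hj.isOpenMap U hU)).preimage
        hj.continuous
      convert h4 using 1
      ext p
      constructor
      · rintro ⟨u, hu, h⟩
        rcases (P.incl_eq_incl_iff B l k p u).1 h.symm with h | ⟨-, h5, h6, h7, h8⟩
        · exact absurd h.1 hkl
        · exact ⟨⟨⟨h6, p.2.2⟩, h7⟩, u, hu, Prod.ext h8.symm (congrArg Subtype.val h5.symm)⟩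
      · rintro ⟨⟨⟨h6, -⟩, h7⟩, u, hu, h⟩
        refine ⟨u, hu, ((P.incl_eq_incl_iff B l k p u).2 (Or.inr ⟨hkl, ?_, h6, h7, ?_⟩)).symm⟩
        · exact Subtype.ext (Prod.ext_iff.1 h).2.symm
        · exact (Prod.ext_iff.1 h).1.symm
  rw [isOpen_prod_iff]
  rintro l p hp
  exact ⟨{l}, _, isOpen_discrete _, h1 l, rfl, hp, by rintro ⟨l', p'⟩ ⟨rfl, h⟩; exact h⟩

theorem isOpenEmbedding_incl
    (hB : IsOpen B) (hr0 : ∀ t ∈ B, P.r t ≠ 0) (hs : DifferentiableOn ℂ P.sqrtR B)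
    (hs2 : ∀ t ∈ B, P.sqrtR t ^ 2 = P.r t) (hn : DifferentiableOn ℂ P.sqrtNegR B) (k : Fin 3) : IsOpenEmbedding (P.incl B k) :=
  .of_continuous_injective_isOpenMap (P.continuous_incl B k) (P.incl_injective B k)
    (isOpenMap_incl hB hr0 hs hs2 hn k)

theorem isOpenQuotientMap_mk
    (hB : IsOpen B) (hr0 : ∀ t ∈ B, P.r t ≠ 0) (hs : DifferentiableOn ℂ P.sqrtR B)
    (hs2 : ∀ t ∈ B, P.sqrtR t ^ 2 = P.r t) (hn : DifferentiableOn ℂ P.sqrtNegR B) : IsOpenQuotientMap (Quot.mk (P.Glue B)) where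
  surjective := Quot.exists_rep
  continuous := continuous_quot_mk
  isOpenMap U hU := by
    have h : Quot.mk (P.Glue B) '' U = ⋃ k, P.incl B k '' {p | (k, p) ∈ U} := by
      ext q
      constructor
      · rintro ⟨⟨k, p⟩, hp, rfl⟩
        exact mem_iUnion.2 ⟨k, p, hp, rfl⟩
      · intro h
        obtain ⟨k, p, hp, rfl⟩ := mem_iUnion.1 h
        exact ⟨(k, p), hp, rfl⟩
    rw [h]
    exact isOpen_iUnion fun k => isOpenMap_incl hB hr0 hs hs2 hn k _
      (hU.preimage (continuous_const.prodMk continuous_id))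

/-- The graphs of the coordinate changes, by polynomial equations. -/
def chartGraph (P : Data) : Fin 3 → ℂ → ℂ × ℂ → ℂ × ℂ → Prop
  | 0, _, z, w => w = z
  | 1, t, z, w => w.2 = z.2 ∧
      w.1 * z.2 ^ 2 = z.1 * z.2 ^ 2 + 2 * (1 + Complex.I) * P.c₁ * z.2 - 2 * P.expCoeff t
  | 2, t, z, w => w.1 = z.1 ∧
      w.2 * z.1 ^ 2 = z.2 * z.1 ^ 2 + 2 * Complex.I * P.c₁ * z.1 + 2 * P.sqrtNegR t

/-- For `y = 0` the first equation says `2 h = 0`, and for `x = 0` the second says `2 √(-r) = 0`.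
Both are impossible, so clearing denominators adds no points to the graphs. -/
theorem chartGraph_iff (hr0 : ∀ t ∈ B, P.r t ≠ 0)
    (hs2 : ∀ t ∈ B, P.sqrtR t ^ 2 = P.r t) (hn2 : ∀ t ∈ B, P.sqrtNegR t ^ 2 = -P.r t)
    (hc₂ : P.c₂ ≠ 0) {t : ℂ} (ht : t ∈ B) (k : Fin 3) (z w : ℂ × ℂ) :
    P.chartGraph k t z w ↔ z ∈ dom k ∧ P.toChart k t z = w := by
  fin_cases k
  · exact ⟨fun h => ⟨trivial, h.symm⟩, fun h => h.2.symm⟩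
  · change P.chartGraph 1 t z w ↔ z.2 ≠ 0 ∧ P.toChart 1 t z = w
    rw [toChart_one]
    constructor
    · rintro ⟨h1, h2⟩
      have h0 : z.2 ≠ 0 := by
        intro h0
        rw [h0] at h2
        exact expCoeff_ne hr0 hs2 hc₂ ht (by simpa using h2)
      refine ⟨h0, Prod.ext (mul_right_cancel₀ (pow_ne_zero 2 h0) ?_) h1.symm⟩
      rw [h2]
      field_simp
      ring
    · rintro ⟨h0, rfl⟩
      refine ⟨rfl, ?_⟩
      simp only []
      field_simp
      ring
  · change P.chartGraph 2 t z w ↔ z.1 ≠ 0 ∧ P.toChart 2 t z = w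
    rw [toChart_two]
    constructor
    · rintro ⟨h1, h2⟩
      have h0 : z.1 ≠ 0 := by
        intro h0
        rw [h0] at h2
        exact sqrtNegR_ne hr0 hn2 ht (by simpa using h2)
      refine ⟨h0, Prod.ext h1.symm (mul_right_cancel₀ (pow_ne_zero 2 h0) ?_)⟩
      rw [h2]
      field_simp
      ring
    · rintro ⟨h0, rfl⟩
      refine ⟨rfl, ?_⟩
      simp only []
      field_simp
      ring

theorem isClosed_chartGraph (hr0 : ∀ t ∈ B, P.r t ≠ 0) (hs : DifferentiableOn ℂ P.sqrtR B)
    (hs2 : ∀ t ∈ B, P.sqrtR t ^ 2 = P.r t) (hn : DifferentiableOn ℂ P.sqrtNegR B) (k : Fin 3)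
    {X : Type} [TopologicalSpace X] {t : X → B} {z w : X → ℂ × ℂ} (ht : Continuous t)
    (hz : Continuous z) (hw : Continuous w) :
    IsClosed {x | P.chartGraph k (t x) (z x) (w x)} := by
  have h1 : Continuous fun x => P.expCoeff (t x) :=
    (continuousOn_iff_continuous_domRestrict.1
      (differentiableOn_expCoeff hr0 hs hs2).continuousOn).comp ht
  have h2 : Continuous fun x => P.sqrtNegR (t x) :=
    (continuousOn_iff_continuous_domRestrict.1 hn.continuousOn).comp ht
  fin_cases k
  · exact isClosed_eq hw hz
  · exact (isClosed_eq (by fun_prop) (by fun_prop)).inter (isClosed_eq (by fun_prop) (by fun_prop))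
  · exact (isClosed_eq (by fun_prop) (by fun_prop)).inter (isClosed_eq (by fun_prop) (by fun_prop))

/-- The common source `(x, y)` of two glued points of different copies is a continuous function `φ`
of the pair: the first change keeps `y`, the second keeps `x`. The relation is thus an intersection
of closed graph conditions and of equality of the times. -/
theorem isClosed_incl_eq (hr0 : ∀ t ∈ B, P.r t ≠ 0) (hs : DifferentiableOn ℂ P.sqrtR B)
    (hs2 : ∀ t ∈ B, P.sqrtR t ^ 2 = P.r t) (hn : DifferentiableOn ℂ P.sqrtNegR B)
    (hn2 : ∀ t ∈ B, P.sqrtNegR t ^ 2 = -P.r t) (hc₂ : P.c₂ ≠ 0) (k l : Fin 3) :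
    IsClosed {x : ((ℂ × ℂ) × B) × ((ℂ × ℂ) × B) | P.incl B k x.1 = P.incl B l x.2} := by
  have key : k ≠ l → ∀ φ : (ℂ × ℂ) × (ℂ × ℂ) → ℂ × ℂ, Continuous φ →
      (∀ t z, φ (P.toChart k t z, P.toChart l t z) = z) →
      IsClosed {x : ((ℂ × ℂ) × B) × ((ℂ × ℂ) × B) | P.incl B k x.1 = P.incl B l x.2} := by
    intro hkl φ hφ hφ'
    have hc : Continuous fun x : ((ℂ × ℂ) × B) × ((ℂ × ℂ) × B) => φ (x.1.1, x.2.1) := by fun_prop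
    have h := ((isClosed_eq (f := fun x : ((ℂ × ℂ) × B) × ((ℂ × ℂ) × B) => x.1.2)
      (g := fun x => x.2.2) (by fun_prop) (by fun_prop)).inter
      (isClosed_chartGraph hr0 hs hs2 hn k (t := fun x : ((ℂ × ℂ) × B) × ((ℂ × ℂ) × B) => x.1.2)
        (w := fun x => x.1.1) (by fun_prop) hc (by fun_prop))).inter
      (isClosed_chartGraph hr0 hs hs2 hn l (t := fun x : ((ℂ × ℂ) × B) × ((ℂ × ℂ) × B) => x.1.2)
        (w := fun x => x.2.1) (by fun_prop) hc (by fun_prop))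
    convert h using 1
    ext ⟨⟨z, t⟩, ⟨w, s⟩⟩
    have hg := fun k z w => chartGraph_iff hr0 hs2 hn2 hc₂ t.2 k z w
    change P.incl B k (z, t) = P.incl B l (w, s) ↔
      (t = s ∧ P.chartGraph k t (φ (z, w)) z) ∧ P.chartGraph l t (φ (z, w)) w
    rw [incl_eq_incl_iff, hg, hg]
    constructor
    · rintro (h | ⟨-, rfl, h1, h2, rfl⟩)
      · exact absurd h.1 hkl
      · have h3 : φ (z, P.toChart l t (P.ofChart k t z)) = P.ofChart k t z := by
          conv_lhs => rw [← P.toChart_ofChart k t z, ofChart_toChart]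
          exact hφ' _ _
        simp only [h3]
        exact ⟨⟨trivial, P.ofChart_mem k t h1, P.toChart_ofChart k t z⟩, h2, trivial⟩
    · rintro ⟨⟨rfl, h1, h2⟩, h3, h4⟩
      have h5 : P.ofChart k t z = φ (z, w) := by
        conv_lhs => rw [← h2]
        rw [ofChart_toChart]
      refine Or.inr ⟨hkl, rfl, h2 ▸ P.toChart_mem k t h1, ?_, ?_⟩
      · simp only [h5]
        exact h3
      · simp only [h5]
        exact h4
  by_cases hkl : k = l
  · subst hkl
    convert isClosed_eq (continuous_fst (X := (ℂ × ℂ) × B) (Y := (ℂ × ℂ) × B)) continuous_snd using 1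
    ext x
    exact (P.incl_injective B k).eq_iff
  · fin_cases k <;> fin_cases l
    exacts [absurd rfl hkl, key hkl Prod.fst continuous_fst fun _ _ => rfl,
      key hkl Prod.fst continuous_fst fun _ _ => rfl,
      key hkl Prod.snd continuous_snd fun _ _ => rfl, absurd rfl hkl,
      key hkl (fun x => (x.2.1, x.1.2)) (by fun_prop) fun _ _ => rfl,
      key hkl Prod.snd continuous_snd fun _ _ => rfl,
      key hkl (fun x => (x.1.1, x.2.2)) (by fun_prop) fun _ _ => rfl, absurd rfl hkl]

/-- The quotient map is open, so the Hausdorff property amounts to closedness of the gluing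
relation, which is checked for each pair of copies. -/
theorem t2Space_phaseSpace (hB : IsOpen B) (hr0 : ∀ t ∈ B, P.r t ≠ 0)
    (hs : DifferentiableOn ℂ P.sqrtR B)
    (hs2 : ∀ t ∈ B, P.sqrtR t ^ 2 = P.r t) (hn : DifferentiableOn ℂ P.sqrtNegR B)
    (hn2 : ∀ t ∈ B, P.sqrtNegR t ^ 2 = -P.r t) (hc₂ : P.c₂ ≠ 0) : T2Space (P.PhaseSpace B) := by
  refine (t2Space_iff_of_isOpenQuotientMap (isOpenQuotientMap_mk hB hr0 hs hs2 hn)).2 ?_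
  have h : ∀ k l, IsClosed {x : (Fin 3 × ((ℂ × ℂ) × B)) × (Fin 3 × ((ℂ × ℂ) × B)) |
      (x.1.1 = k ∧ x.2.1 = l) → P.incl B k x.1.2 = P.incl B l x.2.2} := by
    intro k l
    refine isClosed_imp ?_ ?_
    · have hf : Continuous fun x : (Fin 3 × ((ℂ × ℂ) × B)) × (Fin 3 × ((ℂ × ℂ) × B)) =>
        (x.1.1, x.2.1) := by fun_prop
      convert (isOpen_discrete {(k, l)}).preimage hf using 1
      ext x
      simp
    · exact (isClosed_incl_eq hr0 hs hs2 hn hn2 hc₂ k l).preimage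
        (f := fun x : (Fin 3 × ((ℂ × ℂ) × B)) × (Fin 3 × ((ℂ × ℂ) × B)) => (x.1.2, x.2.2))
        (by fun_prop)
  convert isClosed_iInter fun k => isClosed_iInter fun l => h k l using 1
  ext ⟨⟨k, p⟩, ⟨l, q⟩⟩
  simp only [mem_iInter]
  exact ⟨fun h k' l' hkl => by obtain ⟨rfl, rfl⟩ := hkl; exact h, fun h => h k l ⟨rfl, rfl⟩⟩

/-- The glued space is a complex manifold. -/
theorem exists_chartedSpace (hB : IsOpen B) (hB' : B.Nonempty) (hr0 : ∀ t ∈ B, P.r t ≠ 0)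
    (hs : DifferentiableOn ℂ P.sqrtR B)
    (hs2 : ∀ t ∈ B, P.sqrtR t ^ 2 = P.r t) (hn : DifferentiableOn ℂ P.sqrtNegR B) :
    ∃ _ : ChartedSpace ((ℂ × ℂ) × ℂ) (P.PhaseSpace B),
      IsManifold 𝓘(ℂ, (ℂ × ℂ) × ℂ) ω (P.PhaseSpace B) ∧
      ∀ k, ∃ e ∈ IsManifold.maximalAtlas 𝓘(ℂ, (ℂ × ℂ) × ℂ) ω (P.PhaseSpace B),
        e.target = univ ×ˢ B ∧ ∀ (z : ℂ × ℂ) (t : B), e.symm (z, t) = P.incl B k (z, t) := by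
  have : Nonempty B := hB'.to_subtype
  have hj : IsOpenEmbedding (Prod.map id Subtype.val : (ℂ × ℂ) × B → (ℂ × ℂ) × ℂ) :=
    IsOpenEmbedding.id.prodMap hB.isOpenEmbedding_subtypeVal
  have hi := isOpenEmbedding_incl hB hr0 hs hs2 hn
  let ψ : Fin 3 → OpenPartialHomeomorph (P.PhaseSpace B) ((ℂ × ℂ) × ℂ) := fun k =>
    ((hi k).toOpenPartialHomeomorph _).symm.trans (hj.toOpenPartialHomeomorph _)
  have hψs : ∀ k, (ψ k).source = range (P.incl B k) := fun k => by simp [ψ]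
  have hψt : ∀ k, (ψ k).target = univ ×ˢ B := fun k => by
    simp [ψ, Set.range_prodMap]
  have hψi : ∀ k z (t : B), (ψ k).symm (z, t) = P.incl B k (z, t) := fun k z t => by
    have h := hj.toOpenPartialHomeomorph_left_inv (x := (z, t))
    simp only [ψ, OpenPartialHomeomorph.trans_symm_eq_symm_trans_symm,
      OpenPartialHomeomorph.coe_trans, Function.comp_apply, OpenPartialHomeomorph.symm_symm]
    exact congrArg (P.incl B k) h
  have hψ : ∀ k z (t : B), ψ k (P.incl B k (z, t)) = (z, (t : ℂ)) := fun k z t => by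
    rw [← hψi, (ψ k).right_inv (by rw [hψt]; exact ⟨trivial, t.2⟩)]
  have hcov : ∀ q : P.PhaseSpace B, ∃ k, q ∈ (ψ k).source := fun q => by
    obtain ⟨k, p, rfl⟩ := P.exists_incl B q
    exact ⟨k, by rw [hψs]; exact mem_range_self p⟩
  choose c hc using hcov
  let cs : ChartedSpace ((ℂ × ℂ) × ℂ) (P.PhaseSpace B) :=
    { atlas := range ψ
      chartAt := fun q => ψ (c q)
      mem_chart_source := hc
      chart_mem_atlas := fun q => mem_range_self _ }
  have hm : IsManifold 𝓘(ℂ, (ℂ × ℂ) × ℂ) ω (P.PhaseSpace B) := by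
    refine isManifold_of_contDiffOn _ _ _ ?_
    rintro _ _ ⟨k, rfl⟩ ⟨l, rfl⟩
    simp only [modelWithCornersSelf_coe, modelWithCornersSelf_coe_symm, Function.id_comp,
      Function.comp_id, preimage_id, range_id, inter_univ]
    have h1 : ∀ p ∈ ((ψ k).symm.trans (ψ l)).source, ∃ z, ∃ t : B, p = (z, (t : ℂ)) ∧
        ∃ w, ∃ s : B, P.incl B l (w, s) = P.incl B k (z, t) := by
      rintro ⟨z, t⟩ hp
      have h2 : (z, t) ∈ (ψ k).target := hp.1
      have h3 : (ψ k).symm (z, t) ∈ (ψ l).source := hp.2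
      rw [hψt] at h2
      rw [hψs, show t = ((⟨t, h2.2⟩ : B) : ℂ) from rfl, hψi] at h3
      obtain ⟨⟨w, s⟩, h4⟩ := h3
      exact ⟨z, ⟨t, h2.2⟩, rfl, w, s, h4⟩
    by_cases hkl : k = l
    · subst hkl
      refine contDiffOn_id.congr fun p hp => ?_
      exact (ψ k).right_inv hp.1
    · have h2 : ∀ p ∈ ((ψ k).symm.trans (ψ l)).source,
          (p ∈ dom k ×ˢ B ∧ P.ofChart k p.2 p.1 ∈ dom l) ∧
          ψ l ((ψ k).symm p) = (P.toChart l p.2 (P.ofChart k p.2 p.1), p.2) := by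
        intro p hp
        obtain ⟨z, t, rfl, w, s, h3⟩ := h1 p hp
        rw [hψi, ← h3, hψ]
        rcases (P.incl_eq_incl_iff B k l _ _).1 h3.symm with h | ⟨-, h5, h6, h7, h8⟩
        · exact absurd h.1 hkl
        · exact ⟨⟨⟨h6, t.2⟩, h7⟩, Prod.ext h8.symm (congrArg Subtype.val h5.symm)⟩
      refine ((contDiffOn_transition hB hr0 hs hs2 hn k l).2.mono fun p hp => (h2 p hp).1).congr
        fun p hp => (h2 p hp).2
  exact ⟨cs, hm, fun k => ⟨ψ k, IsManifold.subset_maximalAtlas (mem_range_self k), hψt k, hψi k⟩⟩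

end Data

/-! ### The fibres -/

namespace Data

variable {P : Data} {B : Set ℂ}

theorem exists_fibreIncl (t : B) (q : P.Fibre B t) : ∃ k z, P.fibreIncl B t k z = q := by
  obtain ⟨q, hq⟩ := q
  obtain ⟨k, ⟨z, s⟩, rfl⟩ := P.exists_incl B q
  obtain rfl : s = t := hq
  exact ⟨k, z, rfl⟩

theorem fibreIncl_eq_iff (t : B) (k l : Fin 3) (z w : ℂ × ℂ) :
    P.fibreIncl B t k z = P.fibreIncl B t l w ↔ (k = l ∧ z = w) ∨ (k ≠ l ∧ z ∈ dom k ∧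
      P.ofChart k t z ∈ dom l ∧ P.toChart l t (P.ofChart k t z) = w) := by
  have h : P.fibreIncl B t k z = P.fibreIncl B t l w ↔ P.incl B k (z, t) = P.incl B l (w, t) :=
    Subtype.ext_iff
  rw [h, incl_eq_incl_iff]
  simp

/-- A map of a fibre from compatible maps of the three patches. -/
theorem exists_fibreMap {M : Type} (t : B) (g : Fin 3 → ℂ × ℂ → M)
    (hg : ∀ k, Function.Injective (g k))
    (h0 : ∀ k, ∀ z ∈ dom k, g k (P.toChart k t z) = g 0 z)
    (h1 : ∀ k, ∀ z ∉ dom k, g k z ∉ range (g 0))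
    (h2 : ∀ k l, k ≠ l → ∀ z ∉ dom k, ∀ w ∉ dom l, g k z ≠ g l w) :
    ∃ Φ : P.Fibre B t → M, Function.Injective Φ ∧ (∀ k z, Φ (P.fibreIncl B t k z) = g k z) := by
  have h0' : ∀ k, ∀ z ∈ dom k, g k z = g 0 (P.ofChart k t z) := fun k z hz => by
    rw [← h0 k _ (P.ofChart_mem k t hz), toChart_ofChart]
  -- The map is defined through chosen representatives; compatibility on the domains makes it
  -- independent of the choice.
  choose K Z hKZ using exists_fibreIncl (P := P) (B := B) t
  have hΦ : ∀ k z, g (K (P.fibreIncl B t k z)) (Z (P.fibreIncl B t k z)) = g k z := by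
    intro k z
    rcases (fibreIncl_eq_iff t _ _ _ _).1 (hKZ (P.fibreIncl B t k z)) with ⟨h3, h4⟩ | ⟨-, h3, h4, h5⟩
    · rw [h3, h4]
    · rw [h0' _ _ h3, ← h0 k _ h4, h5]
  refine ⟨fun q => g (K q) (Z q), fun q q' h => ?_, hΦ⟩
  obtain ⟨k, z, rfl⟩ := exists_fibreIncl t q
  obtain ⟨l, w, rfl⟩ := exists_fibreIncl t q'
  simp only [hΦ] at h
  by_cases hkl : k = l
  · subst hkl
    rw [hg k h]
  · by_cases hz : z ∈ dom k
    · by_cases hw : w ∈ dom l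
      · rw [h0' k z hz, h0' l w hw] at h
        have h3 := hg 0 h
        refine (fibreIncl_eq_iff t _ _ _ _).2 (Or.inr ⟨hkl, hz, ?_, ?_⟩)
        · rw [h3]
          exact P.ofChart_mem l t hw
        · rw [h3, toChart_ofChart]
      · refine absurd ?_ (h1 l w hw)
        rw [← h, h0' k z hz]
        exact mem_range_self _
    · by_cases hw : w ∈ dom l
      · refine absurd ?_ (h1 k z hz)
        rw [h, h0' l w hw]
        exact mem_range_self _
      · exact absurd h (h2 k l hkl z hz w hw)

end Data

theorem IsAffinePatch.injective {S : Type} [TopologicalSpace S] [ChartedSpace (ℂ × ℂ) S]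
    {f : ℂ × ℂ → S} (h : IsAffinePatch f) : Function.Injective f := by
  obtain ⟨e, -, ht, hf⟩ := h
  intro z w hzw
  rw [← e.right_inv (x := z) (by simp [ht]), hf, hzw, ← hf, e.right_inv (by simp [ht])]

/-- The fibres of the glued space. -/
theorem Data.exists_surface_fibre {P : Data} {B : Set ℂ}
    (hr0 : ∀ t ∈ B, P.r t ≠ 0) (hs2 : ∀ t ∈ B, P.sqrtR t ^ 2 = P.r t)
    (hn2 : ∀ t ∈ B, P.sqrtNegR t ^ 2 = -P.r t) (hc₂ : P.c₂ ≠ 0) (t : B) :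
    ∃ M₀ M : MarkedSurface, IsProjectivePlane M₀ ∧ Arises (P.modifications t) M₀ M ∧
      ∃ D : Fin 8 → Set M, IsTypeD7 M D ∧
      ∃ Φ : P.Fibre B t → M, Function.Injective Φ ∧ range Φ = (⋃ i, D i)ᶜ ∧
        (∀ k, IsAffinePatch fun z => Φ (P.fibreIncl B t k z)) ∧
        ∀ z, Φ (P.fibreIncl B t 0 z) = M.patch z := by
  -- The curve `x₁ = 0` is `x = 2 h / s² - 2 (1 + i) c₁ / s`, and `y₂ = 0` is `y = -2 √(-r) / s² - 2
  -- i c₁ / s`, with `s` the curve parameter; this gives the values of `α` and `α'`.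
  have hα : 2 * P.expCoeff t ≠ 0 := mul_ne_zero two_ne_zero (expCoeff_ne hr0 hs2 hc₂ t.2)
  have hα' : -(2 * P.sqrtNegR t) ≠ 0 :=
    neg_ne_zero.2 (mul_ne_zero two_ne_zero (sqrtNegR_ne hr0 hn2 t.2))
  obtain ⟨M₀, M, hM₀, hA, O, O', F, F', b, b', cn, cn', d, d', H⟩ :=
    exists_isTwoSided (β := 2 * (1 + Complex.I) * P.c₁) (β' := 2 * Complex.I * P.c₁) hα hα'
      (γ₁ := fun s => P.ofChart 1 t (0, s)) (γ₂ := fun s => P.ofChart 2 t (s, 0))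
      (δ := fun s => (1 / s, 1 / s))
      (fun s _ => by rw [ofChart_one]; exact Prod.ext (by simp) rfl)
      (fun s _ => by rw [ofChart_two]; exact Prod.ext rfl (by simp only []; ring))
      (fun s _ => rfl)
  obtain ⟨e₁, he₁, te₁, pe₁, ze₁, se₁⟩ := H.left.exists_patch hα contDiff_id fun z => rfl
  obtain ⟨e₂, he₂, te₂, pe₂, ze₂, se₂⟩ := H.right.exists_patch hα'
    (contDiff_snd.prodMk contDiff_fst) fun z => rfl
  -- On the second side all coordinates come in the order `(y, x)`.
  obtain ⟨f₂, hf₂, -, tf₂, -, if₂⟩ := exists_coord_swap he₂ te₂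
  let g : Fin 3 → ℂ × ℂ → M := ![M.patch, e₁.symm, f₂.symm]
  have hg : ∀ k, IsAffinePatch (g k) := by
    intro k
    fin_cases k
    exacts [M.isPatch, ⟨e₁, he₁, te₁, fun z => rfl⟩, ⟨f₂, hf₂, tf₂, fun z => rfl⟩]
  have hz₁ : ∀ z ∉ dom 1, g 1 z ∈ cn.source ∧ (cn (g 1 z)).2 = 0 := by
    rintro ⟨x, y⟩ hz
    obtain rfl : y = 0 := not_not.1 hz
    exact ze₁ x
  have hz₂ : ∀ z ∉ dom 2, g 2 z ∈ cn'.source ∧ (cn' (g 2 z)).2 = 0 := by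
    rintro ⟨x, y⟩ hz
    obtain rfl : x = 0 := not_not.1 hz
    have h := ze₂ y
    rwa [← if₂ (0, y)] at h
  have hF : ∀ q ∈ cn.source, (cn q).2 = 0 → q ∈ O ∧ F q = 0 := fun q hq h0 =>
    ⟨H.left.tower.cn_sub q hq, by rw [H.left.tower.cn_eq q hq, h0]; simp⟩
  have hF' : ∀ q ∈ cn'.source, (cn' q).2 = 0 → q ∈ O' ∧ F' q = 0 := fun q hq h0 =>
    ⟨H.right.tower.cn_sub q hq, by rw [H.right.tower.cn_eq q hq, h0]; simp⟩
  -- The two added affine lines lie over different points of `ℙ¹ × ℙ¹`.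
  have hd : ∀ q ∈ cn.source, (cn q).2 = 0 → q ∉ cn'.source := fun q hq h0 hq' =>
    H.left_notMem q (hF q hq h0).1 (hF q hq h0).2 (H.right.tower.cn_sub q hq')
  obtain ⟨Φ, hΦ, hΦg⟩ := exists_fibreMap (P := P) (B := B) t g (fun k => (hg k).injective)
    (by
      intro k z hz
      fin_cases k
      · rfl
      · change e₁.symm (P.toChart 1 t z) = M.patch z
        rw [toChart_one, ← add_sub_assoc]
        exact pe₁ z hz
      · change f₂.symm (P.toChart 2 t z) = M.patch z
        rw [if₂, toChart_two, ← pe₂ z hz]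
        congr 2
        ring)
    (by
      rintro k z hz ⟨w, hw⟩
      change M.patch w = g k z at hw
      fin_cases k
      · exact hz trivial
      · obtain ⟨h1, h2⟩ := hF _ (hz₁ z hz).1 (hz₁ z hz).2
        change M.patch w = g 1 z at hw
        rw [← hw] at h1 h2
        exact H.left.patch_notMem_of_zero h1 h2
      · obtain ⟨h1, h2⟩ := hF' _ (hz₂ z hz).1 (hz₂ z hz).2
        change M.patch w = g 2 z at hw
        rw [← hw] at h1 h2
        exact H.right.patch_notMem_of_zero h1 h2)
    (by
      have h12 : ∀ z ∉ dom 1, ∀ w ∉ dom 2, g 1 z ≠ g 2 w := fun z hz w hw h =>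
        hd _ (hz₁ z hz).1 (hz₁ z hz).2 (h ▸ (hz₂ w hw).1)
      intro k l hkl z hz w hw
      fin_cases k <;> fin_cases l
      exacts [absurd rfl hkl, absurd trivial hz, absurd trivial hz, absurd trivial hw,
        absurd rfl hkl, h12 z hz w hw, absurd trivial hw, (h12 w hw z hz).symm, absurd rfl hkl])
  refine ⟨M₀, M, hM₀, hA, _, H.isTypeD7, Φ, hΦ, ?_, fun k => ?_, hΦg 0⟩
  · ext q
    rw [H.mem_compl_boundary]
    constructor
    · rintro ⟨p, rfl⟩
      obtain ⟨k, z, rfl⟩ := exists_fibreIncl t p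
      rw [hΦg]
      by_cases hz : z ∈ dom k
      · refine Or.inl ⟨P.ofChart k t z, ?_⟩
        have h1 : Φ (P.fibreIncl B t k z) = Φ (P.fibreIncl B t 0 (P.ofChart k t z)) := by
          congr 1
          rw [fibreIncl_eq_iff]
          by_cases hk : k = 0
          · subst hk
            exact Or.inl ⟨rfl, rfl⟩
          · exact Or.inr ⟨hk, hz, trivial, rfl⟩
        rw [hΦg, hΦg] at h1
        exact h1.symm
      · fin_cases k
        exacts [absurd trivial hz, Or.inr (Or.inl (hz₁ z hz)), Or.inr (Or.inr (hz₂ z hz))]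
    · rintro (⟨z, rfl⟩ | ⟨h1, h2⟩ | ⟨h1, h2⟩)
      · exact ⟨_, hΦg 0 z⟩
      · obtain ⟨x, rfl⟩ := se₁ q h1 h2
        exact ⟨_, hΦg 1 (x, 0)⟩
      · obtain ⟨x, rfl⟩ := se₂ q h1 h2
        exact ⟨_, (hΦg 2 (0, x)).trans (if₂ _)⟩
  · simp only [hΦg]
    exact hg k

end Ince

end

/-! ### The theorem -/

theorem mainTheorem6 (P : Ince.Data) (B : Set ℂ) (hB : IsOpen B) (hB' : B.Nonempty)
    (hr : DifferentiableOn ℂ P.r B) (hr0 : ∀ t ∈ B, P.r t ≠ 0)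
    (hs : DifferentiableOn ℂ P.sqrtR B) (hs2 : ∀ t ∈ B, P.sqrtR t ^ 2 = P.r t)
    (hn : DifferentiableOn ℂ P.sqrtNegR B) (hn2 : ∀ t ∈ B, P.sqrtNegR t ^ 2 = -P.r t)
    (hc₂ : P.c₂ ≠ 0) :
    -- the coordinate changes are birational, holomorphic in all variables, and symplectic
    (∀ k, (∀ t ∈ B, BijOn (P.toChart k t) (Ince.dom k) (Ince.dom k) ∧
          InvOn (P.ofChart k t) (P.toChart k t) (Ince.dom k) (Ince.dom k)) ∧
        DifferentiableOn ℂ (fun p : (ℂ × ℂ) × ℂ => P.toChart k p.2 p.1) (Ince.dom k ×ˢ B) ∧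
        DifferentiableOn ℂ (fun p : (ℂ × ℂ) × ℂ => P.ofChart k p.2 p.1) (Ince.dom k ×ˢ B) ∧
        ∀ t ∈ B, ∀ z ∈ Ince.dom k, (fderiv ℂ (P.toChart k t) z).det = 1) ∧
    -- in each chart the system is Hamiltonian, with a Hamiltonian polynomial in `(x_k, y_k)`
    (∃ K : Fin 3 → Ince.TPoly, K 0 = P.hamiltonian ∧
        (∀ k m, DifferentiableOn ℂ ((K k).coeff m) B) ∧
        ∀ k, ∀ t ∈ B, ∀ z : ℂ → ℂ × ℂ, z t ∈ Ince.dom k →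
          HasDerivAt z (Ince.hamField P.hamiltonian t (z t)) t →
          HasDerivAt (fun τ => P.toChart k τ (z τ))
            (Ince.hamField (K k) t (P.toChart k t (z t))) t) ∧
    -- the gluing of the three copies of `ℂ² × B` is a Hausdorff complex threefold
    T2Space (P.PhaseSpace B) ∧
    (∃ _ : ChartedSpace ((ℂ × ℂ) × ℂ) (P.PhaseSpace B),
        IsManifold 𝓘(ℂ, (ℂ × ℂ) × ℂ) ω (P.PhaseSpace B) ∧
        ∀ k, ∃ e ∈ IsManifold.maximalAtlas 𝓘(ℂ, (ℂ × ℂ) × ℂ) ω (P.PhaseSpace B),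
          e.target = univ ×ˢ B ∧ ∀ (z : ℂ × ℂ) (t : B), e.symm (z, t) = P.incl B k (z, t)) ∧
    -- its fibres are the complements of the boundary divisor in surfaces of type `D₇⁽¹⁾`
    ∀ t : B, ∃ M₀ M : Ince.MarkedSurface,
      Ince.IsProjectivePlane M₀ ∧ Ince.Arises (P.modifications t) M₀ M ∧
      ∃ D : Fin 8 → Set M, Ince.IsTypeD7 M D ∧
      ∃ Φ : P.Fibre B t → M, Function.Injective Φ ∧ range Φ = (⋃ i, D i)ᶜ ∧
        (∀ k, Ince.IsAffinePatch fun z => Φ (P.fibreIncl B t k z)) ∧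
        ∀ z, Φ (P.fibreIncl B t 0 z) = M.patch z := by
  have hc := Ince.Data.contDiffOn_charts (P := P) hB hr0 hs hs2 hn
  exact ⟨fun k => ⟨fun t _ => P.bijOn_toChart k t, (hc k).1.differentiableOn (by simp),
      (hc k).2.differentiableOn (by simp), fun t _ z hz => P.det_toChart k t hz⟩,
    ⟨P.chartHam, rfl, Ince.Data.differentiableOn_coeff_chartHam hB hr hr0 hs hs2 hn,
      fun k t ht z hz hd => Ince.Data.hasDerivAt_toChart hB hr hr0 hs hs2 hn hn2 k ht hz hd⟩,
    Ince.Data.t2Space_phaseSpace hB hr0 hs hs2 hn hn2 hc₂,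
    Ince.Data.exists_chartedSpace hB hB' hr0 hs hs2 hn,
    Ince.Data.exists_surface_fibre hr0 hs2 hn2 hc₂⟩
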